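/- **Definitions.** Let $\Xi$ be a countably infinite alphabet of variables with a distinguished element $\mathfrak u$ (the universe variable, treated as a constant symbol), and let $\alpha\in(\Xi\setminus\{\mathfrak u\})^+$ be a terminal-free pattern. A *bracketing* of $\alpha$ is a way $\tilde\alpha$ of writing $\alpha$ with fully bracketed binary concatenation. The *decomposition* $\Psi_{\tilde\alpha}$ is obtained by assigning to each distinct composite sub-bracketing $(\tilde\beta\cdot\tilde\gamma)$ of $\tilde\alpha$ its own new variable (to $\tilde\alpha$ itself the variable $\mathfrak u$) and taking the conjunction of the word equations $z\doteq x\cdot y$, where $z,x,y$ are the variables of $(\tilde\beta\cdot\tilde\gamma)$, $\tilde\beta$, $\tilde\gamma$; a single variable of $\alpha$ represents itself, and if $\alpha=x$ is one variable the decomposition is $\mathfrak u\doteq x$. A *join tree* of $\Psi_{\tilde\alpha}$ is an undirected tree whose nodes are the atoms of $\Psi_{\tilde\alpha}$ such that, whenever a variable other than $\mathfrak u$ occurs in two atoms, it occurs in all atoms on the path between them. $\Psi_{\tilde\alpha}$ is *acyclic* if it has a join tree, and $\alpha$ is *acyclic* if some bracketing of $\alpha$ has an acyclic decomposition. The *concatenation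 tree* of $\Psi_{\tilde\alpha}$ (for $|\alpha|\ge2$) is the following rooted ordered binary tree labelled with variables. Start with the root labelled $\mathfrak u$, and repeatedly give each node labelled $z$, where $z\doteq x\cdot y$ is an atom, a left child labelled $x$ and a right child labelled $y$. Then, among the non-leaf nodes with a common label, keep the one that is farthest from the root (the leftmost such node in case of a tie) and remove all descendants of the others. **Theorem.** It can be decided in time $O(|\alpha|^7)$ whether a given nonempty terminal-free pattern $\alpha$ is acyclic. Moreover, if $\alpha$ is acyclic and $|\alpha|\ge 2$, a concatenation tree of an acyclic decomposition of some bracketing of $\alpha$ is constructed within the same time. Precisely: there are a program of a random access machine with uniform cost measure (constants, addition, truncated subtraction, multiplication, indirect load and store, conditional jump, halt) and a constant $C$ such that, on every such input $\alpha$ of length $n$ whose variables are given as natural numbers at most $m$, one per memory cell, the program halts after at most $C\,n^7$ steps with the correct answer, and with the preorder code of such a concatenation tree in memory if $\alpha$ is acyclic and $n\ge2$; throughout the computation all machine words have at most $C\lceil\log_2(n+m+2)\rceil$ bits. -/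

import Mathlib

/-! ### Patterns, bracketings and their decompositions -/

/-- The countably infinite alphabet `Ξ` of variables. -/
abbrev Var : Type := ℕ

/-- The universe variable `𝔲`, a distinguished element of `Ξ`. It stands for the input document and is
treated as a constant symbol: it does not count as a variable of a formula. -/
def univVar : Var := 0

/-- Well-bracketed patterns `BPat`: every variable is one, and so is `(l · r)` if `l` and `r` are. -/
inductive BPat : Type
  | var (x : Var) : BPat
  | cat (l r : BPat) : BPat
  deriving DecidableEq

/-- The pattern that is left when the brackets are removed. -/
def BPat.flatten : BPat → List Var
  | .var x => [x]
  | .cat l r => l.flatten ++ r.flatten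

/-- The set of sub-bracketings `s ⊑ b` (including `b` itself). -/
def BPat.subs : BPat → Finset BPat
  | .var x => {.var x}
  | .cat l r => insert (.cat l r) (l.subs ∪ r.subs)

/-- A word equation `(lhs ≐ rhs)` whose left side is one variable and whose right side is a
terminal-free pattern. -/
structure WordEq : Type where
  lhs : Var
  rhs : List Var
  deriving DecidableEq

/-- The variables of an atom; the universe variable is a constant and is not among them. -/
def WordEq.vars (e : WordEq) : Set Var :=
  {x | (x = e.lhs ∨ x ∈ e.rhs) ∧ x ≠ univVar}

/-- A (terminal-free) conjunctive query `Ans(head) ← ⋀ body` in which the right side of every word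
equation has length at most two. -/
structure TwoFCCQ : Type where
  head : List Var
  body : Finset WordEq
  rhs_length_le : ∀ e ∈ body, e.rhs.length ≤ 2

/-- `Ψ` is a decomposition of the bracketing `b`.

For a composite `b`, each distinct composite sub-bracketing `(l · r)` of `b` is replaced, at all of
its occurrences, by its own new variable `ν (l · r)`, and contributes the atom
`(ν (l · r) ≐ ν l · ν r)`; the variable of `b` itself is `𝔲`. Here `ν` fixes the variables of `b` and
injectivity says that the introduced variables are new and pairwise distinct.

The decomposition of a single variable `x` is the single atom `(𝔲 ≐ x)`. -/
def IsDecomposition (b : BPat) (Ψ : TwoFCCQ) : Prop :=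
  Ψ.head = [] ∧
  match b with
  | .var x => Ψ.body = {⟨univVar, [x]⟩}
  | .cat l r => ∃ ν : BPat → Var,
      Set.InjOn ν ((BPat.cat l r).subs : Set BPat) ∧
      (∀ x, BPat.var x ∈ (BPat.cat l r).subs → ν (.var x) = x) ∧
      ν (.cat l r) = univVar ∧
      ∀ e : WordEq, e ∈ Ψ.body ↔
        ∃ p q : BPat, BPat.cat p q ∈ (BPat.cat l r).subs ∧ e = ⟨ν (.cat p q), [ν p, ν q]⟩

/-! ### Acyclicity -/

/-- `G` is a join tree for `Ψ`: an undirected tree on the set of atoms of `Ψ` such that a variable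
shared by two atoms occurs in every atom on the path between them. -/
def IsJoinTree (Ψ : TwoFCCQ) (G : SimpleGraph {e : WordEq // e ∈ Ψ.body}) : Prop :=
  G.IsTree ∧
  ∀ a b : {e : WordEq // e ∈ Ψ.body}, ∀ x : Var, x ∈ a.1.vars → x ∈ b.1.vars →
    ∀ p : G.Walk a b, p.IsPath → ∀ c ∈ p.support, x ∈ c.1.vars

def TwoFCCQ.IsAcyclic (Ψ : TwoFCCQ) : Prop := ∃ G, IsJoinTree Ψ G

def BPat.IsAcyclic (b : BPat) : Prop := ∃ Ψ, IsDecomposition b Ψ ∧ Ψ.IsAcyclic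

/-- A pattern is acyclic if one of its bracketings is. -/
def IsAcyclicPattern (α : List Var) : Prop := ∃ b : BPat, b.flatten = α ∧ b.IsAcyclic

/-! ### Concatenation trees -/

/-- Rooted ordered binary trees whose nodes are labelled with variables. -/
inductive LTree : Type
  | leaf (x : Var) : LTree
  | node (z : Var) (l r : LTree) : LTree

def LTree.label : LTree → Var
  | .leaf x => x
  | .node z _ _ => z

/-- First step of the construction: a node labelled with the left side of an atom `(z ≐ x · y)` has a
left child labelled `x` and a right child labelled `y`; the other nodes are leaves. -/
def IsUnfolding (Ψ : TwoFCCQ) : LTree → Prop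
  | .leaf x => ∀ e ∈ Ψ.body, e.lhs ≠ x
  | .node z l r => (⟨z, [l.label, r.label]⟩ : WordEq) ∈ Ψ.body ∧ IsUnfolding Ψ l ∧ IsUnfolding Ψ r

/-- The label of the non-leaf node at address `p` (`false` = left, `true` = right), if there is one. -/
def LTree.innerLabel : LTree → List Bool → Option Var
  | .leaf _, _ => none
  | .node z _ _, [] => some z
  | .node _ l _, false :: p => l.innerLabel p
  | .node _ _ r, true :: p => r.innerLabel p

/-- The node at address `p` appears to the left of the node at address `q`. -/
def IsLeftOf (p q : List Bool) : Prop :=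
  ∃ c p' q' : List Bool, p = c ++ false :: p' ∧ q = c ++ true :: q'

/-- The ordering `p ≪ q` of nodes (with a common label): `p` is strictly closer to the root than `q`,
or both are equally far from it and `p` appears to the right of `q`. -/
def NodeLT (p q : List Bool) : Prop :=
  p.length < q.length ∨ (p.length = q.length ∧ IsLeftOf q p)

/-- A non-leaf node is redundant if it is not the `≪`-maximum of the non-leaf nodes with its label. -/
def LTree.Redundant (T : LTree) (p : List Bool) : Prop :=
  ∃ z q, T.innerLabel p = some z ∧ T.innerLabel q = some z ∧ NodeLT p q

open Classical in
/-- Remove the descendants of all redundant nodes of `T` from its subtree at address `p`. -/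
noncomputable def LTree.pruneAt (T : LTree) : List Bool → LTree → LTree
  | _, .leaf x => .leaf x
  | p, .node z l r =>
      if T.Redundant p then .leaf z
      else .node z (T.pruneAt (p ++ [false]) l) (T.pruneAt (p ++ [true]) r)

/-- Second step of the construction: pruning. -/
noncomputable def LTree.prune (T : LTree) : LTree := T.pruneAt [] T

/-- `T` is the concatenation tree of `Ψ` (for the root variable `𝔲`). -/
def IsConcatTree (Ψ : TwoFCCQ) (T : LTree) : Prop :=
  ∃ U : LTree, U.label = univVar ∧ IsUnfolding Ψ U ∧ T = U.prune

/-- Preorder code of a labelled tree. -/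
def LTree.code : LTree → List ℕ
  | .leaf x => [0, x]
  | .node z l r => 1 :: z :: (l.code ++ r.code)

/-! ### Random access machines with uniform cost -/

/-- Instructions. A machine has registers `R₀, R₁, …` and memory cells `M₀, M₁, …`, and each of them
holds one machine word; memory is addressed indirectly through registers. -/
inductive Instr : Type
  /-- `R_d := c` -/
  | const (d c : ℕ) : Instr
  /-- `R_d := R_a + R_b` -/
  | add (d a b : ℕ) : Instr
  /-- `R_d := R_a - R_b` (zero if `R_a < R_b`) -/
  | sub (d a b : ℕ) : Instr
  /-- `R_d := R_a * R_b` -/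
  | mul (d a b : ℕ) : Instr
  /-- `R_d := M_{R_a}` -/
  | load (d a : ℕ) : Instr
  /-- `M_{R_a} := R_b` -/
  | store (a b : ℕ) : Instr
  /-- if `R_a < R_b` go to the instruction with number `t` -/
  | jumpLT (a b t : ℕ) : Instr
  /-- stop -/
  | halt : Instr

/-- A program is a finite list of instructions, numbered from `0`. -/
abbrev Program : Type := List Instr

structure Config : Type where
  pc : ℕ
  reg : ℕ → ℕ
  mem : ℕ → ℕ

/-- The machine has stopped: it is at a `halt` instruction or beyond the end of the program. -/
def Halted (P : Program) (c : Config) : Prop :=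
  P[c.pc]? = none ∨ P[c.pc]? = some .halt

/-- One step of the machine; every instruction has cost one. A stopped machine does not change. -/
def step (P : Program) (c : Config) : Config :=
  match P[c.pc]? with
  | none => c
  | some .halt => c
  | some (.const d k) => { c with pc := c.pc + 1, reg := Function.update c.reg d k }
  | some (.add d a b) =>
      { c with pc := c.pc + 1, reg := Function.update c.reg d (c.reg a + c.reg b) }
  | some (.sub d a b) =>
      { c with pc := c.pc + 1, reg := Function.update c.reg d (c.reg a - c.reg b) }
  | some (.mul d a b) =>
      { c with pc := c.pc + 1, reg := Function.update c.reg d (c.reg a * c.reg b) }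
  | some (.load d a) =>
      { c with pc := c.pc + 1, reg := Function.update c.reg d (c.mem (c.reg a)) }
  | some (.store a b) =>
      { c with pc := c.pc + 1, mem := Function.update c.mem (c.reg a) (c.reg b) }
  | some (.jumpLT a b t) => { c with pc := if c.reg a < c.reg b then t else c.pc + 1 }

/-- The initial configuration on the input word `α`: its length is in `R₀`, its letters are in
`M₀, …, M_{|α| - 1}`, and everything else is zero. -/
def initial (α : List Var) : Config where
  pc := 0
  reg := Function.update (fun _ => 0) 0 α.length
  mem := fun i => α.getD i 0

/-- The configuration after `t` steps on the input `α`. -/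
def runFor (P : Program) (α : List Var) (t : ℕ) : Config := (step P)^[t] (initial α)

/-- All words of the configuration are less than `2 ^ w`, that is, they fit into `w` bits. -/
def Config.FitsIn (c : Config) (w : ℕ) : Prop :=
  (∀ r, c.reg r < 2 ^ w) ∧ ∀ a, c.mem a < 2 ^ w

/-- Word length `C · ⌈log₂ (n + m + 2)⌉` for an input `α` of length `n` whose letters are at most `m`:
logarithmic in the length of the input and long enough for a letter to fit into a word. -/
def wordLength (C : ℕ) (α : List Var) : ℕ :=
  C * Nat.clog 2 (α.length + α.foldr max 0 + 2)

/-- The memory starts with the list `l`. -/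
def Config.HoldsList (c : Config) (l : List ℕ) : Prop :=
  ∀ i (h : i < l.length), c.mem i = l[i]

/-!
A bracketing `b` is acyclic if and only if it is *good*: the factors `l` and `r` of each composite
sub-bracketing `(l · r)` are equal, or one of them is a factor of the other (`r = (l · y)`,
`r = (y · l)`, and symmetrically), or they have no letter in common. This removes decompositions and
join trees from the problem.

The link between the two notions is the *base* of a sub-bracketing. If `x` is a factor of `p`, and the
other factor of `p` has the factor `x` as well, then `x` can be split off `p`; splitting off as long as
possible leads to `base x p`. In a join tree, the atoms of two parents `p`, `q` of `x` are connected
through atoms that share a longer bracketing with their neighbours, and such neighbours have the same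
base with respect to `x`, so that `base x p = base x q` (`BPat.sameBase_of_isJoinTree`). Conversely, if
all parents of a sub-bracketing have the same base, a join tree arises by linking every atom with the
atom of the base of its parents (`BPat.SameBase.exists_isJoinTree`). Comparing bases is the same as
goodness (`BPat.Good.sameBase`, `BPat.SameBase.good`). For a good bracketing, the pruning of the
concatenation tree is a local matter, too: a child is cut off exactly if it is a factor of its sibling,
or if it is the right one of two equal children (`BPat.pruneAt_toTree`).

Goodness admits a dynamic program over the factors of `α`. A split of a factor into `u` and `v` is good
if and only if `u`, `v` have good bracketings and no common letter, or `u = v` has a good bracketing,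
or one of `u`, `v` is a prefix or a suffix of the other one, with a good split of the latter at the
corresponding position (`SegGood.cases`, `segGood_of_cases`). The case that applies also says which
child is a leaf of the pruned tree and where the other one is split, so that the tables suffice to write
the tree (`exists_emits`). In a good bracketing, sub-bracketings with the same letters are equal
(`BPat.Good.flatten_injOn`). Hence words can serve as names of sub-bracketings, and a number for every
word among the factors of `α` is computed by comparing factors with earlier ones (`exec_labels`).

The algorithm is written in a small language of bounded loops, whose statements are translated into
machine programs (`Stmt.reaches_code`). The running time is a polynomial whose degree is the nesting
depth of the loops, which is at most seven (in fact five), and since values grow by at most one in a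
step and tables are addressed through a polynomial pairing function, all words have logarithmic length
(`Stmt.exists_program`).
-/

set_option linter.constructorNameAsVariable false

/-! ### Sub-bracketings -/

namespace BPat

/-- The number of letters. -/
def len (b : BPat) : ℕ := b.flatten.length

@[simp] lemma len_var (x : Var) : (BPat.var x).len = 1 := rfl

@[simp] lemma len_cat (l r : BPat) : (BPat.cat l r).len = l.len + r.len := by
  simp [len, flatten]

lemma len_pos (b : BPat) : 0 < b.len := by
  induction b <;> simp; omega

lemma flatten_ne_nil (b : BPat) : b.flatten ≠ [] := by
  have := b.len_pos
  intro h
  simp [len, h] at this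

@[simp] lemma mem_subs_cat {s l r : BPat} :
    s ∈ (BPat.cat l r).subs ↔ s = .cat l r ∨ s ∈ l.subs ∨ s ∈ r.subs := by
  simp [subs]

@[simp] lemma mem_subs_var {s : BPat} {x : Var} : s ∈ (BPat.var x).subs ↔ s = .var x := by
  simp [subs]

@[simp] lemma self_mem_subs (b : BPat) : b ∈ b.subs := by
  cases b <;> simp

lemma subs_subset {s b : BPat} (h : s ∈ b.subs) : s.subs ⊆ b.subs := by
  induction b with
  | var x => rw [mem_subs_var] at h; rw [h]
  | cat l r ihl ihr =>
    rcases mem_subs_cat.1 h with rfl | h | h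
    · exact subset_rfl
    · exact fun t ht => mem_subs_cat.2 (.inr (.inl (ihl h ht)))
    · exact fun t ht => mem_subs_cat.2 (.inr (.inr (ihr h ht)))

lemma left_mem_subs {l r b : BPat} (h : .cat l r ∈ b.subs) : l ∈ b.subs :=
  subs_subset h (by simp)

lemma right_mem_subs {l r b : BPat} (h : .cat l r ∈ b.subs) : r ∈ b.subs :=
  subs_subset h (by simp)

lemma len_le_of_mem_subs {s b : BPat} (h : s ∈ b.subs) : s.len ≤ b.len := by
  induction b with
  | var x => rw [mem_subs_var] at h; rw [h]
  | cat l r ihl ihr =>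
    rcases mem_subs_cat.1 h with rfl | h | h
    · rfl
    · have := ihl h; simp; omega
    · have := ihr h; simp; omega

lemma eq_of_mem_subs_of_len_le {s b : BPat} (h : s ∈ b.subs) (hl : b.len ≤ s.len) : s = b := by
  cases b with
  | var x => exact mem_subs_var.1 h
  | cat l r =>
    have hl' := l.len_pos
    have hr' := r.len_pos
    rcases mem_subs_cat.1 h with rfl | h | h
    · rfl
    · have := len_le_of_mem_subs h; simp at hl; omega
    · have := len_le_of_mem_subs h; simp at hl; omega

lemma flatten_subset_of_mem_subs {s b : BPat} (h : s ∈ b.subs) : s.flatten ⊆ b.flatten := by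
  induction b with
  | var x => rw [mem_subs_var] at h; rw [h]; exact List.Subset.refl _
  | cat l r ihl ihr =>
    rcases mem_subs_cat.1 h with rfl | h | h
    · exact List.Subset.refl _
    · exact fun t ht => List.mem_append.2 (.inl (ihl h ht))
    · exact fun t ht => List.mem_append.2 (.inr (ihr h ht))

lemma var_mem_subs {x : Var} {b : BPat} (h : x ∈ b.flatten) : .var x ∈ b.subs := by
  induction b with
  | var y => simpa [flatten] using h
  | cat l r ihl ihr =>
    rcases List.mem_append.1 h with h | h
    · exact mem_subs_cat.2 (.inr (.inl (ihl h)))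
    · exact mem_subs_cat.2 (.inr (.inr (ihr h)))

/-- `p.HasChild x`: the bracketing `p` is composite and `x` is one of its two factors. -/
def HasChild : BPat → BPat → Prop
  | .var _, _ => False
  | .cat l r, x => l = x ∨ r = x

@[simp] lemma hasChild_cat {l r x : BPat} : (BPat.cat l r).HasChild x ↔ l = x ∨ r = x := Iff.rfl

instance (p x : BPat) : Decidable (p.HasChild x) := by
  cases p <;> unfold HasChild <;> infer_instance

lemma HasChild.mem_subs {p x : BPat} (h : p.HasChild x) : x ∈ p.subs := by
  cases p with
  | var => exact h.elim
  | cat l r => rcases h with rfl | rfl <;> simp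

lemma HasChild.len_lt {p x : BPat} (h : p.HasChild x) : x.len < p.len := by
  cases p with
  | var => exact h.elim
  | cat l r =>
    have := l.len_pos
    have := r.len_pos
    rcases h with rfl | rfl <;> simp <;> omega

lemma exists_hasChild {x b : BPat} (h : x ∈ b.subs) (hne : x ≠ b) :
    ∃ p ∈ b.subs, p.HasChild x := by
  induction b with
  | var y => exact (hne (mem_subs_var.1 h)).elim
  | cat l r ihl ihr =>
    rcases mem_subs_cat.1 h with rfl | h | h
    · exact (hne rfl).elim
    · by_cases hx : x = l
      · exact ⟨_, self_mem_subs _, .inl hx.symm⟩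
      · obtain ⟨p, hp, hc⟩ := ihl h hx
        exact ⟨p, mem_subs_cat.2 (.inr (.inl hp)), hc⟩
    · by_cases hx : x = r
      · exact ⟨_, self_mem_subs _, .inr hx.symm⟩
      · obtain ⟨p, hp, hc⟩ := ihr h hx
        exact ⟨p, mem_subs_cat.2 (.inr (.inr hp)), hc⟩

/-! ### Good bracketings and the base of a parent -/

/-- The two factors of a concatenation are *compatible* if they are equal, or one is a factor of the
other, or they have no letter in common. -/
def Compat (l r : BPat) : Prop :=
  l = r ∨ r.HasChild l ∨ l.HasChild r ∨ l.flatten.Disjoint r.flatten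

/-- A bracketing is *good* if the two factors of each of its composite sub-bracketings are
compatible. -/
def Good : BPat → Prop
  | .var _ => True
  | .cat l r => l.Good ∧ r.Good ∧ Compat l r

/-- Starting from a bracketing that has `x` as a factor, split off `x` for as long as the other
factor has `x` as a factor, too. -/
def base (x : BPat) : BPat → BPat
  | .var y => .var y
  | .cat l r =>
      if l = x ∧ r.HasChild x then base x r
      else if r = x ∧ l.HasChild x then base x l
      else .cat l r

lemma base_mem_subs (x p : BPat) : base x p ∈ p.subs := by
  induction p with
  | var y => simp [base]
  | cat l r ihl ihr =>
    rw [base]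
    split_ifs
    · simp [ihr]
    · simp [ihl]
    · simp

lemma base_hasChild {x p : BPat} (h : p.HasChild x) : (base x p).HasChild x := by
  induction p with
  | var y => exact h.elim
  | cat l r ihl ihr =>
    rw [base]
    split_ifs with h1 h2
    · exact ihr h1.2
    · exact ihl h2.2
    · exact h

/-- All sub-bracketings of `b` with a common factor `x` have the same base with respect to `x`. -/
def SameBase (b : BPat) : Prop :=
  ∀ x p q : BPat, p ∈ b.subs → q ∈ b.subs → p.HasChild x → q.HasChild x → base x p = base x q

/-- If `t` has the two factors `x` and `s`, and `s` has the factor `x`, then `x` can be split off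
`t`. -/
lemma base_eq_base {x s t : BPat} (hx : t.HasChild x) (hs : t.HasChild s) (hsx : s.HasChild x) :
    base x t = base x s := by
  have hne : s ≠ x := by rintro rfl; exact absurd hsx.len_lt (lt_irrefl _)
  cases t with
  | var => exact hx.elim
  | cat l r =>
    rcases hx with rfl | rfl
    · rcases hs with h | rfl
      · exact (hne h.symm).elim
      · rw [base, if_pos ⟨rfl, hsx⟩]
    · rcases hs with rfl | h
      · rw [base, if_neg (fun h => hne h.1), if_pos ⟨rfl, hsx⟩]
      · exact (hne h.symm).elim

/-- If `t` has the two factors `x` and `s`, and `s` has the factor `x`, then nothing can be split off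
`t` with respect to `s`. -/
lemma base_eq_self {x s t : BPat} (hx : t.HasChild x) (hs : t.HasChild s) (hsx : s.HasChild x) :
    base s t = t := by
  have hlt := hsx.len_lt
  have hn : ¬ x.HasChild s := fun h => absurd h.len_lt (by omega)
  have hns : ¬ s.HasChild s := fun h => absurd h.len_lt (lt_irrefl _)
  cases t with
  | var => exact hx.elim
  | cat l r =>
    have key : ∀ c d : BPat, c = s ∧ d.HasChild s → d ≠ x ∧ d ≠ s := fun c d h =>
      ⟨fun e => hn (e ▸ h.2), fun e => hns (e ▸ h.2)⟩
    have hne : s ≠ x := by rintro rfl; exact absurd hlt (lt_irrefl _)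
    rw [base, if_neg, if_neg]
    · intro h
      have := key r l h
      rcases hx with h1 | h1
      · exact this.1 h1
      · exact hne (h.1.symm.trans h1)
    · intro h
      have := key l r h
      rcases hx with h1 | h1
      · exact hne (h.1.symm.trans h1)
      · exact this.1 h1

lemma not_disjoint_of_mem_subs {x l r : BPat} (hl : x ∈ l.subs) (hr : x ∈ r.subs) :
    ¬ l.flatten.Disjoint r.flatten := by
  obtain ⟨a, ha⟩ := List.exists_mem_of_ne_nil _ x.flatten_ne_nil
  exact fun h => h (flatten_subset_of_mem_subs hl ha) (flatten_subset_of_mem_subs hr ha)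

lemma Good.of_mem_subs {s b : BPat} (h : b.Good) (hs : s ∈ b.subs) : s.Good := by
  induction b with
  | var y => rw [mem_subs_var] at hs; rw [hs]; exact h
  | cat l r ihl ihr =>
    rcases mem_subs_cat.1 hs with rfl | hs | hs
    · exact h
    · exact ihl h.1 hs
    · exact ihr h.2.1 hs

/-- Two parents of `x` in different factors of a compatible concatenation are parents of `x` within one
of the factors. If the root `(l · r)` is a parent of `x = r`, say, and `x` has another parent, then `x`
is also a factor of `l`, and can be split off the root. -/
lemma Good.sameBase {b : BPat} (h : b.Good) : b.SameBase := by
  induction b with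
  | var y =>
    intro x p q hp _ hpx _
    rw [mem_subs_var] at hp
    subst hp
    exact hpx.elim
  | cat l r ihl ihr =>
    obtain ⟨gl, gr, hc⟩ := h
    have il := ihl gl
    have ir := ihr gr
    have hl0 := l.len_pos
    have hr0 := r.len_pos
    -- parents on different sides
    have cross : ∀ x p q : BPat, p ∈ l.subs → q ∈ r.subs → p.HasChild x → q.HasChild x →
        base x p = base x q := by
      intro x p q hp hq hpx hqx
      rcases hc with rfl | hc | hc | hc
      · exact il x p q hp hq hpx hqx
      · exact ir x p q (subs_subset hc.mem_subs hp) hq hpx hqx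
      · exact il x p q hp (subs_subset hc.mem_subs hq) hpx hqx
      · exact (not_disjoint_of_mem_subs (subs_subset hp hpx.mem_subs)
          (subs_subset hq hqx.mem_subs) hc).elim
    -- the root as a parent
    have top : ∀ x q : BPat, q ∈ l.subs ∨ q ∈ r.subs → (BPat.cat l r).HasChild x → q.HasChild x →
        base x (.cat l r) = base x q := by
      intro x q hq hx hqx
      have hlt := hqx.len_lt
      rcases hq with hq | hq
      · have hle := len_le_of_mem_subs hq
        have hxl : l ≠ x := by rintro rfl; omega
        have hxr : r = x := hx.resolve_left hxl
        subst hxr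
        have hc' : l.HasChild r := by
          rcases hc with hc | hc | hc | hc
          · exact (hxl hc).elim
          · have := hc.len_lt; omega
          · exact hc
          · exact (not_disjoint_of_mem_subs (subs_subset hq hqx.mem_subs)
              (self_mem_subs _) hc).elim
        rw [base, if_neg (fun h => hxl h.1), if_pos ⟨rfl, hc'⟩]
        exact il _ _ _ (self_mem_subs _) hq hc' hqx
      · have hle := len_le_of_mem_subs hq
        have hxr : r ≠ x := by rintro rfl; omega
        have hxl : l = x := hx.resolve_right hxr
        subst hxl
        have hc' : r.HasChild l := by
          rcases hc with hc | hc | hc | hc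
          · exact (hxr hc.symm).elim
          · exact hc
          · have := hc.len_lt; omega
          · exact (not_disjoint_of_mem_subs (self_mem_subs _)
              (subs_subset hq hqx.mem_subs) hc).elim
        rw [base, if_pos ⟨rfl, hc'⟩]
        exact ir _ _ _ (self_mem_subs _) hq hc' hqx
    intro x p q hp hq hpx hqx
    rcases mem_subs_cat.1 hp with rfl | hp <;> rcases mem_subs_cat.1 hq with rfl | hq
    · rfl
    · exact top x q hq hpx hqx
    · exact (top x p hp hqx hpx).symm
    · rcases hp with hp | hp <;> rcases hq with hq | hq
      · exact il x p q hp hq hpx hqx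
      · exact cross x p q hp hq hpx hqx
      · exact (cross x q p hq hp hqx hpx).symm
      · exact ir x p q hp hq hpx hqx

/-- If the factors `l`, `r` are not compatible, a longest common sub-bracketing `x` of them has parents
with different bases: a common base would be a longer common sub-bracketing or, if `x` is `l` or `r`,
it would be the root and lie within one of the factors. -/
lemma SameBase.good {b : BPat} (h : b.SameBase) : b.Good := by
  induction b with
  | var y => trivial
  | cat l r ihl ihr =>
    have subl : ∀ {s}, s ∈ l.subs → s ∈ (BPat.cat l r).subs := fun hs =>
      mem_subs_cat.2 (.inr (.inl hs))
    have subr : ∀ {s}, s ∈ r.subs → s ∈ (BPat.cat l r).subs := fun hs =>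
      mem_subs_cat.2 (.inr (.inr hs))
    refine ⟨ihl fun x p q hp hq => h x p q (subl hp) (subl hq),
      ihr fun x p q hp hq => h x p q (subr hp) (subr hq), ?_⟩
    by_contra hc
    simp only [Compat, not_or] at hc
    obtain ⟨hne, hrl, hlr, hd⟩ := hc
    have hl0 := l.len_pos
    have hr0 := r.len_pos
    -- a common sub-bracketing of maximal length
    have hex : (l.subs ∩ r.subs).Nonempty := by
      simp only [List.Disjoint, not_forall] at hd
      obtain ⟨a, ha, hb, -⟩ := hd
      exact ⟨.var a, Finset.mem_inter.2 ⟨var_mem_subs ha, var_mem_subs hb⟩⟩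
    obtain ⟨x, hx, hmax⟩ := Finset.exists_max_image _ len hex
    obtain ⟨hxl, hxr⟩ := Finset.mem_inter.1 hx
    by_cases h1 : x = l
    · subst h1
      obtain ⟨q, hq, hqx⟩ := exists_hasChild hxr hne
      have e := h x _ q (self_mem_subs _) (subr hq) (.inl rfl) hqx
      rw [base, if_neg (fun h => hrl h.2), if_neg (fun h => hne h.1.symm)] at e
      have := len_le_of_mem_subs (base_mem_subs x q)
      have := len_le_of_mem_subs hq
      rw [← e, len_cat] at *
      omega
    by_cases h2 : x = r
    · subst h2
      obtain ⟨q, hq, hqx⟩ := exists_hasChild hxl (Ne.symm hne)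
      have e := h x _ q (self_mem_subs _) (subl hq) (.inr rfl) hqx
      rw [base, if_neg (fun h => hne h.1), if_neg (fun h => hlr h.2)] at e
      have := len_le_of_mem_subs (base_mem_subs x q)
      have := len_le_of_mem_subs hq
      rw [← e, len_cat] at *
      omega
    · obtain ⟨p, hp, hpx⟩ := exists_hasChild hxl h1
      obtain ⟨q, hq, hqx⟩ := exists_hasChild hxr h2
      have e := h x p q (subl hp) (subr hq) hpx hqx
      have hm := hmax (base x p) (Finset.mem_inter.2 ⟨subs_subset hp (base_mem_subs x p),
        e ▸ subs_subset hq (base_mem_subs x q)⟩)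
      have := (base_hasChild hpx).len_lt
      omega

end BPat

/-! ### Trees given by a parent function -/

/-- A function that assigns to every element other than `root` a parent of smaller rank defines a
tree. -/
lemma exists_isTree_of_parent {V : Type*} [Finite V] (root : V) (par : V → V) (rk : V → ℕ)
    (h : ∀ v, v ≠ root → rk (par v) < rk v) :
    ∃ G : SimpleGraph V, G.IsTree ∧ ∀ v, v ≠ root → G.Adj v (par v) := by
  classical
  have := Fintype.ofFinite V
  let G : SimpleGraph V := SimpleGraph.fromRel fun v w => v ≠ root ∧ par v = w
  have hadj : ∀ v, v ≠ root → G.Adj v (par v) := by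
    intro v hv
    rw [SimpleGraph.fromRel_adj]
    refine ⟨fun e => ?_, .inl ⟨hv, rfl⟩⟩
    have := h v hv
    rw [← e] at this
    omega
  have hreach : ∀ k v, rk v ≤ k → G.Reachable v root := by
    intro k
    induction k with
    | zero =>
      intro v hk
      by_cases hv : v = root
      · rw [hv]
      · have := h v hv; omega
    | succ k ih =>
      intro v hk
      by_cases hv : v = root
      · rw [hv]
      · have := h v hv
        exact (hadj v hv).reachable.trans (ih _ (by omega))
  have hconn : G.Connected :=
    haveI : Nonempty V := ⟨root⟩
    ⟨fun v w => (hreach _ v le_rfl).trans (hreach _ w le_rfl).symm⟩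
  refine ⟨G, SimpleGraph.isTree_iff_connected_and_card.2 ⟨hconn, ?_⟩, hadj⟩
  have h1 := hconn.card_vert_le_card_edgeSet_add_one
  have h2 : G.edgeSet ⊆ (Finset.univ.erase root).image fun v => s(v, par v) := by
    intro e
    induction e with
    | _ v w =>
      intro he
      rw [SimpleGraph.mem_edgeSet, SimpleGraph.fromRel_adj] at he
      simp only [Finset.coe_image, Set.mem_image, Finset.mem_coe, Finset.mem_erase,
        Finset.mem_univ, and_true]
      rcases he.2 with ⟨hv, rfl⟩ | ⟨hw, rfl⟩
      · exact ⟨v, hv, rfl⟩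
      · exact ⟨w, hw, Sym2.eq_swap⟩
  have h3 : Nat.card G.edgeSet ≤ Nat.card V - 1 := by
    refine (Nat.card_mono (Finset.finite_toSet _) h2).trans ?_
    rw [Nat.card_coe_set_eq, Set.ncard_coe_finset]
    refine Finset.card_image_le.trans ?_
    rw [Finset.card_erase_of_mem (Finset.mem_univ _), Finset.card_univ, Nat.card_eq_fintype_card]
  have h4 : 0 < Nat.card V := Nat.card_pos_iff.2 ⟨⟨root⟩, inferInstance⟩
  omega

/-- In an acyclic graph the darts of a path are among the darts of every walk with the same ends. -/
lemma SimpleGraph.IsAcyclic.darts_subset {V : Type*} {G : SimpleGraph V} (hG : G.IsAcyclic)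
    {u v : V} {p : G.Walk u v} (hp : p.IsPath) (w : G.Walk u v) : p.darts ⊆ w.darts := by
  classical
  have : p = w.bypass := congrArg Subtype.val
    ((hG.subsingleton_path u v).elim ⟨p, hp⟩ w.toPath)
  rw [this]
  exact w.darts_bypass_subset_darts

lemma SimpleGraph.IsAcyclic.support_subset {V : Type*} {G : SimpleGraph V} (hG : G.IsAcyclic)
    {u v : V} {p : G.Walk u v} (hp : p.IsPath) (w : G.Walk u v) : p.support ⊆ w.support := by
  classical
  have : p = w.bypass := congrArg Subtype.val
    ((hG.subsingleton_path u v).elim ⟨p, hp⟩ w.toPath)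
  rw [this]
  exact w.support_bypass_subset_support

/-! ### Acyclic decompositions -/

namespace BPat

/-- The atom `(ν (l · r) ≐ ν l · ν r)` of a composite bracketing; the value at a variable is of no
importance. -/
def atom (ν : BPat → Var) : BPat → WordEq
  | .var x => ⟨ν (.var x), []⟩
  | .cat l r => ⟨ν (.cat l r), [ν l, ν r]⟩

/-- The bracketing is composite. -/
def IsCat (s : BPat) : Prop := ∃ l r, s = .cat l r

lemma HasChild.isCat {p x : BPat} (h : p.HasChild x) : p.IsCat := by
  cases p with
  | var => exact h.elim
  | cat l r => exact ⟨l, r, rfl⟩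

lemma isCat_cat (l r : BPat) : (BPat.cat l r).IsCat := ⟨l, r, rfl⟩

/-- `ν` names the sub-bracketings of `b` as a decomposition of `b` does. -/
structure IsNaming (b : BPat) (ν : BPat → Var) : Prop where
  injOn : Set.InjOn ν (b.subs : Set BPat)
  root : ν b = univVar

variable {b : BPat} {ν : BPat → Var}

lemma IsNaming.mem_vars (hν : IsNaming b ν) {x s : BPat} (hx : x ∈ b.subs) (hs : s ∈ b.subs)
    (hc : s.IsCat) : ν x ∈ (s.atom ν).vars ↔ x ≠ b ∧ (x = s ∨ s.HasChild x) := by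
  obtain ⟨l, r, rfl⟩ := hc
  have hb : ν x ≠ univVar ↔ x ≠ b := by
    rw [← hν.root]
    exact (hν.injOn.eq_iff (Finset.mem_coe.2 hx) (Finset.mem_coe.2 (self_mem_subs b))).not
  have e : ∀ {t}, t ∈ b.subs → (ν x = ν t ↔ x = t) := fun ht =>
    hν.injOn.eq_iff (Finset.mem_coe.2 hx) (Finset.mem_coe.2 ht)
  simp only [WordEq.vars, atom, Set.mem_ofPred_eq, hb, List.mem_cons, List.not_mem_nil, or_false,
    e hs, e (left_mem_subs hs), e (right_mem_subs hs), hasChild_cat]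
  tauto

lemma exists_eq_of_mem_vars {s : BPat} (hs : s ∈ b.subs)
    (hc : s.IsCat) {z : Var} (hz : z ∈ (s.atom ν).vars) : ∃ x ∈ b.subs, z = ν x := by
  obtain ⟨l, r, rfl⟩ := hc
  simp only [WordEq.vars, atom, Set.mem_ofPred_eq, List.mem_cons, List.not_mem_nil,
    or_false] at hz
  rcases hz.1 with h | h | h
  · exact ⟨_, hs, h⟩
  · exact ⟨_, left_mem_subs hs, h⟩
  · exact ⟨_, right_mem_subs hs, h⟩

lemma IsNaming.atom_injOn (hν : IsNaming b ν) {s t : BPat} (hs : s ∈ b.subs) (ht : t ∈ b.subs)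
    (hsc : s.IsCat) (htc : t.IsCat) (h : s.atom ν = t.atom ν) : s = t := by
  obtain ⟨l, r, rfl⟩ := hsc
  obtain ⟨l', r', rfl⟩ := htc
  simp only [atom, WordEq.mk.injEq] at h
  exact hν.injOn hs ht h.1

/-- An acyclic decomposition forces all parents of a sub-bracketing `x` to have the same base.

The atoms of two parents `p`, `q` of `x` are linked by a walk in the join tree through atoms of
sub-bracketings that properly contain `x`, namely from `p` up to the root and down to `q`. It covers
the path between them, so that any two neighbours on this path share `x` and, moreover, a variable of
a bracketing that properly contains `x`. Such neighbours have the same base. -/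
lemma sameBase_of_isJoinTree (hν : IsNaming b ν) {Ψ : TwoFCCQ}
    (hΨ : ∀ e, e ∈ Ψ.body ↔ ∃ s ∈ b.subs, s.IsCat ∧ e = s.atom ν)
    {G : SimpleGraph {e : WordEq // e ∈ Ψ.body}} (hG : IsJoinTree Ψ G) : b.SameBase := by
  classical
  obtain ⟨hT, hJ⟩ := hG
  let A : ∀ s, s ∈ b.subs → s.IsCat → {e : WordEq // e ∈ Ψ.body} := fun s hs hc =>
    ⟨s.atom ν, (hΨ _).2 ⟨s, hs, hc, rfl⟩⟩
  have hf : ∀ e : {e : WordEq // e ∈ Ψ.body}, ∃ s, s ∈ b.subs ∧ s.IsCat ∧ e.1 = s.atom ν :=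
    fun e => (hΨ e.1).1 e.2
  choose f hfs hfc hfe using hf
  have hfA : ∀ s hs hc, f (A s hs hc) = s := fun s hs hc =>
    hν.atom_injOn (hfs _) hs (hfc _) hc (hfe _).symm
  have hAf : ∀ e, A (f e) (hfs e) (hfc e) = e := fun e => Subtype.ext (hfe e).symm
  -- neighbours on the path share a bracketing that properly contains `x`
  let Conn : BPat → {e : WordEq // e ∈ Ψ.body} → {e : WordEq // e ∈ Ψ.body} → Prop :=
    fun x B C => ∃ w : G.Walk B C, ∀ d ∈ w.darts, ∃ v ∈ b.subs, x.len < v.len ∧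
      ν v ∈ d.fst.1.vars ∧ ν v ∈ d.snd.1.vars
  have conn_symm : ∀ {x B C}, Conn x B C → Conn x C B := by
    rintro x B C ⟨w, hw⟩
    refine ⟨w.reverse, fun d hd => ?_⟩
    obtain ⟨v, hv, h1, h2, h3⟩ := hw d.symm (by simpa using hd)
    exact ⟨v, hv, h1, h3, h2⟩
  have conn_trans : ∀ {x B C D}, Conn x B C → Conn x C D → Conn x B D := by
    rintro x B C D ⟨w, hw⟩ ⟨w', hw'⟩
    refine ⟨w.append w', fun d hd => ?_⟩
    rw [SimpleGraph.Walk.darts_append, List.mem_append] at hd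
    exact hd.elim (hw d) (hw' d)
  have conn_of_share : ∀ {x v s t} (hs : s ∈ b.subs) (hsc : s.IsCat) (ht : t ∈ b.subs)
      (htc : t.IsCat), v ∈ b.subs → x.len < v.len → ν v ∈ (s.atom ν).vars →
      ν v ∈ (t.atom ν).vars → Conn x (A s hs hsc) (A t ht htc) := by
    intro x v s t hs hsc ht htc hv hlt h1 h2
    obtain ⟨p, hp, -⟩ := hT.existsUnique_path (A s hs hsc) (A t ht htc)
    have := hJ _ _ _ h1 h2 p hp
    exact ⟨p, fun d hd => ⟨v, hv, hlt, this _ (p.dart_fst_mem_support_of_mem_darts hd),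
      this _ (p.dart_snd_mem_support_of_mem_darts hd)⟩⟩
  have conn_root : ∀ x k s (hs : s ∈ b.subs) (hsc : s.IsCat) (hb : b.IsCat), x.len < s.len →
      b.len - s.len ≤ k → Conn x (A s hs hsc) (A b (self_mem_subs b) hb) := by
    intro x k
    induction k with
    | zero =>
      intro s hs hsc hb hlt hk
      obtain rfl := eq_of_mem_subs_of_len_le hs (by omega)
      exact ⟨.nil, by simp⟩
    | succ k ih =>
      intro s hs hsc hb hlt hk
      by_cases hsb : s = b
      · subst hsb
        exact ⟨.nil, by simp⟩
      · obtain ⟨t, ht, hts⟩ := exists_hasChild hs hsb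
        have := hts.len_lt
        have := len_le_of_mem_subs ht
        exact conn_trans (conn_of_share hs hsc ht hts.isCat hs hlt
          ((hν.mem_vars hs hs hsc).2 ⟨hsb, .inl rfl⟩)
          ((hν.mem_vars hs ht hts.isCat).2 ⟨hsb, .inr hts⟩))
          (ih t ht hts.isCat hb (by omega) (by omega))
  have ne_root : ∀ {x p}, p ∈ b.subs → p.HasChild x → x ≠ b := by
    rintro x p hp hpx rfl
    have := hpx.len_lt
    have := len_le_of_mem_subs hp
    omega
  have edge : ∀ x p q (hp : p ∈ b.subs) (hq : q ∈ b.subs) (hpx : p.HasChild x)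
      (hqx : q.HasChild x) (w : G.Walk (A p hp hpx.isCat) (A q hq hqx.isCat)), w.IsPath →
      ∀ d ∈ w.darts, (ν x ∈ d.fst.1.vars ∧ ν x ∈ d.snd.1.vars) ∧
        ∃ v ∈ b.subs, x.len < v.len ∧ ν v ∈ d.fst.1.vars ∧ ν v ∈ d.snd.1.vars := by
    intro x p q hp hq hpx hqx w hw d hd
    have hb : b.IsCat := by
      cases b with
      | var y => rw [mem_subs_var] at hp; exact (hp ▸ hpx).elim
      | cat l r => exact isCat_cat l r
    have hx := subs_subset hp hpx.mem_subs
    have hxb := ne_root hp hpx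
    have hs := hJ (A p hp hpx.isCat) (A q hq hqx.isCat) (ν x)
      ((hν.mem_vars hx hp hpx.isCat).2 ⟨hxb, .inr hpx⟩)
      ((hν.mem_vars hx hq hqx.isCat).2 ⟨hxb, .inr hqx⟩) w hw
    refine ⟨⟨hs _ (w.dart_fst_mem_support_of_mem_darts hd),
      hs _ (w.dart_snd_mem_support_of_mem_darts hd)⟩, ?_⟩
    obtain ⟨w', hw'⟩ := conn_trans (conn_root x _ p hp hpx.isCat hb hpx.len_lt le_rfl)
      (conn_symm (conn_root x _ q hq hqx.isCat hb hqx.len_lt le_rfl))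
    exact hw' d (hT.isAcyclic.darts_subset hw w' hd)
  -- neighbours that share `x` and a longer bracketing `v` have the same base: if one of them is `v`,
  -- then `x` can be split off the other one; else both are `(x · v)` or `(v · x)`, and the path between
  -- these parents of `v` requires them to share a still longer bracketing, so that they are equal
  have step : ∀ x s t (hs : s ∈ b.subs) (ht : t ∈ b.subs) (hsc : s.IsCat) (htc : t.IsCat),
      G.Adj (A s hs hsc) (A t ht htc) → x ∈ b.subs →
      ν x ∈ (s.atom ν).vars → ν x ∈ (t.atom ν).vars →
      (∃ v ∈ b.subs, x.len < v.len ∧ ν v ∈ (s.atom ν).vars ∧ ν v ∈ (t.atom ν).vars) →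
      base x s = base x t := by
    rintro x s t hs ht hsc htc hadj hx hxs hxt ⟨v, hv, hlt, hvs, hvt⟩
    have hst : s ≠ t := by
      rintro rfl
      exact hadj.ne rfl
    have child : ∀ {s}, s ∈ b.subs → s.IsCat → ν x ∈ (s.atom ν).vars → ν v ∈ (s.atom ν).vars →
        s.HasChild x ∧ (v = s ∨ s.HasChild v) := by
      intro s hs hsc hxs hvs
      have h1 := ((hν.mem_vars hx hs hsc).1 hxs).2
      have h2 := ((hν.mem_vars hv hs hsc).1 hvs).2
      refine ⟨h1.resolve_left ?_, h2⟩
      rintro rfl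
      rcases h2 with rfl | h2
      · omega
      · have := h2.len_lt; omega
    obtain ⟨hsx, hsv⟩ := child hs hsc hxs hvs
    obtain ⟨htx, htv⟩ := child ht htc hxt hvt
    rcases hsv with rfl | hsv <;> rcases htv with rfl | htv
    · exact (hst rfl).elim
    · exact (base_eq_base htx htv hsx).symm
    · exact base_eq_base hsx hsv htx
    · exfalso
      obtain ⟨-, u, hu, hlu, hus, hut⟩ := edge v s t hs ht hsv htv hadj.toWalk
        (by simp [SimpleGraph.Adj.toWalk, hadj.ne]) ⟨(_, _), hadj⟩ (List.mem_singleton.2 rfl)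
      have key : ∀ {s}, s ∈ b.subs → s.IsCat → s.HasChild x → s.HasChild v →
          ν u ∈ (s.atom ν).vars → u = s := by
        intro s hs hsc h1 h2 h3
        refine ((hν.mem_vars hu hs hsc).1 h3).2.resolve_right fun h4 => ?_
        obtain ⟨l, r, rfl⟩ := hsc
        have e1 : x ≠ v := by rintro rfl; omega
        have e2 : x ≠ u := by rintro rfl; omega
        have e3 : v ≠ u := by rintro rfl; omega
        rw [hasChild_cat] at h1 h2 h4
        grind
      exact hst ((key hs hsc hsx hsv hus).symm.trans (key ht htc htx htv hut))
  intro x p q hp hq hpx hqx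
  have hx := subs_subset hp hpx.mem_subs
  obtain ⟨w, hw, -⟩ := hT.existsUnique_path (A p hp hpx.isCat) (A q hq hqx.isCat)
  have hd := edge x p q hp hq hpx hqx w hw
  have main : ∀ {B C} (w : G.Walk B C), (∀ d ∈ w.darts,
      (ν x ∈ d.fst.1.vars ∧ ν x ∈ d.snd.1.vars) ∧
        ∃ v ∈ b.subs, x.len < v.len ∧ ν v ∈ d.fst.1.vars ∧ ν v ∈ d.snd.1.vars) →
      base x (f B) = base x (f C) := by
    intro B C w
    induction w with
    | nil => intro _; rfl
    | @cons B C D hadj w ih =>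
      intro h
      have h1 := h ⟨(_, _), hadj⟩ (by simp)
      rw [← ih fun d hd => h d (by simp [hd])]
      refine step x (f B) (f C) (hfs B) (hfs C) (hfc B) (hfc C) ?_ hx ?_ ?_ ?_
      · rw [hAf, hAf]; exact hadj
      · rw [← hfe]; exact h1.1.1
      · rw [← hfe]; exact h1.1.2
      · rw [← hfe, ← hfe]; exact h1.2
  have := main w hd
  rwa [hfA p hp hpx.isCat, hfA q hq hqx.isCat] at this

/-- If all parents of a sub-bracketing have the same base, then a join tree arises by linking the atom
of every sub-bracketing with the atom of the base of its parents. -/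
lemma SameBase.exists_isJoinTree (h : b.SameBase) (hb : b.IsCat) (hν : IsNaming b ν) {Ψ : TwoFCCQ}
    (hΨ : ∀ e, e ∈ Ψ.body ↔ ∃ s ∈ b.subs, s.IsCat ∧ e = s.atom ν) : ∃ G, IsJoinTree Ψ G := by
  classical
  let A : ∀ s, s ∈ b.subs → s.IsCat → {e : WordEq // e ∈ Ψ.body} := fun s hs hc =>
    ⟨s.atom ν, (hΨ _).2 ⟨s, hs, hc, rfl⟩⟩
  have hf : ∀ e : {e : WordEq // e ∈ Ψ.body}, ∃ s, s ∈ b.subs ∧ s.IsCat ∧ e.1 = s.atom ν :=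
    fun e => (hΨ e.1).1 e.2
  choose f hfs hfc hfe using hf
  have hfA : ∀ s hs hc, f (A s hs hc) = s := fun s hs hc =>
    hν.atom_injOn (hfs _) hs (hfc _) hc (hfe _).symm
  have hpar : ∀ e : {e : WordEq // e ∈ Ψ.body}, ∃ e' : {e : WordEq // e ∈ Ψ.body},
      f e ≠ b → (f e').HasChild (f e) ∧
        ∀ q ∈ b.subs, q.HasChild (f e) → f e' = base (f e) q := by
    intro e
    by_cases he : f e = b
    · exact ⟨e, fun h => (h he).elim⟩
    · obtain ⟨p, hp, hpe⟩ := exists_hasChild (hfs e) he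
      have hs := subs_subset hp (base_mem_subs (f e) p)
      have hc := base_hasChild hpe
      refine ⟨A _ hs hc.isCat, fun _ => ?_⟩
      rw [hfA _ hs hc.isCat]
      exact ⟨hc, fun q hq hqe => h _ p q hp hq hpe hqe⟩
  choose par hpar using hpar
  have hroot : ∀ e, e ≠ A b (self_mem_subs b) hb → f e ≠ b :=
    fun e he hfb => he (Subtype.ext ((hfe e).trans (congrArg (atom ν) hfb)))
  obtain ⟨G, hT, hadj⟩ := exists_isTree_of_parent (A b (self_mem_subs b) hb) par
    (fun e => b.len - (f e).len) (by
      intro e he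
      have := (hpar e (hroot e he)).1.len_lt
      have := len_le_of_mem_subs (hfs (par e))
      omega)
  have hadj' : ∀ e, f e ≠ b → G.Adj e (par e) := by
    intro e he
    refine hadj e ?_
    rintro rfl
    exact he (hfA b (self_mem_subs b) hb)
  refine ⟨G, hT, fun B C z hB hC p hp c hc => ?_⟩
  -- it suffices to link all atoms with `z` to one of them, by walks through such atoms
  suffices hall : ∃ D, ∀ B : {e : WordEq // e ∈ Ψ.body}, z ∈ B.1.vars →
      ∃ w : G.Walk B D, ∀ c ∈ w.support, z ∈ c.1.vars by
    obtain ⟨D, hD⟩ := hall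
    obtain ⟨w, hw⟩ := hD B hB
    obtain ⟨w', hw'⟩ := hD C hC
    have := hT.isAcyclic.support_subset hp (w.append w'.reverse) hc
    rw [SimpleGraph.Walk.mem_support_append_iff, SimpleGraph.Walk.support_reverse,
      List.mem_reverse] at this
    exact this.elim (hw c) (hw' c)
  obtain ⟨x, hx, rfl⟩ := exists_eq_of_mem_vars (hfs B) (hfc B) (hfe B ▸ hB)
  have hmem : ∀ e : {e : WordEq // e ∈ Ψ.body},
      ν x ∈ e.1.vars ↔ x ≠ b ∧ (x = f e ∨ (f e).HasChild x) := by
    intro e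
    rw [hfe e]
    exact hν.mem_vars hx (hfs e) (hfc e)
  have hxb : x ≠ b := ((hmem B).1 hB).1
  obtain ⟨p₀, hp₀, hpx₀⟩ := exists_hasChild hx hxb
  have hs₀ := subs_subset hp₀ (base_mem_subs x p₀)
  have hc₀ := base_hasChild hpx₀
  have down : ∀ k (e : {e : WordEq // e ∈ Ψ.body}), (f e).len ≤ k → (f e).HasChild x →
      ∃ w : G.Walk e (A _ hs₀ hc₀.isCat), ∀ c ∈ w.support, ν x ∈ c.1.vars := by
    intro k
    induction k with
    | zero => intro e hk; have := (f e).len_pos; omega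
    | succ k ih =>
      intro e hk hex
      have hbase : base x (f e) = base x p₀ := h x _ _ (hfs e) hp₀ hex hpx₀
      by_cases hself : base x (f e) = f e
      · have : e = A _ hs₀ hc₀.isCat := by
          exact Subtype.ext ((hfe e).trans (congrArg (atom ν) (hself.symm.trans hbase)))
        subst this
        refine ⟨.nil, fun c hc => ?_⟩
        rw [SimpleGraph.Walk.support_nil, List.mem_singleton] at hc
        subst hc
        exact (hmem _).2 ⟨hxb, .inr hex⟩
      · obtain ⟨s, hs, hes, hsx⟩ : ∃ s, s ∈ b.subs ∧ (f e).HasChild s ∧ s.HasChild x := by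
          have hfse := hfs e
          revert hself hfse
          generalize f e = t
          intro hself ht
          cases t with
          | var y => exact (hself rfl).elim
          | cat l r =>
            rw [base] at hself
            split_ifs at hself with h1 h2
            · exact ⟨r, right_mem_subs ht, .inr rfl, h1.2⟩
            · exact ⟨l, left_mem_subs ht, .inl rfl, h2.2⟩
            · exact (hself rfl).elim
        have hlt := hes.len_lt
        have hle := len_le_of_mem_subs (hfs e)
        have hsA := hfA s hs hsx.isCat
        have hsb : f (A s hs hsx.isCat) ≠ b := by
          rw [hsA]
          rintro rfl
          omega
        have hpe : par (A s hs hsx.isCat) = e := by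
          have := (hpar _ hsb).2 (f e) (hfs e) (by rw [hsA]; exact hes)
          rw [hsA, base_eq_self hex hes hsx] at this
          exact Subtype.ext ((hfe _).trans ((congrArg (atom ν) this).trans (hfe e).symm))
        have had := hadj' _ hsb
        rw [hpe] at had
        obtain ⟨w, hw⟩ := ih (A s hs hsx.isCat) (by rw [hsA]; omega) (by rw [hsA]; exact hsx)
        refine ⟨.cons had.symm w, fun c hc => ?_⟩
        rw [SimpleGraph.Walk.support_cons, List.mem_cons] at hc
        rcases hc with rfl | hc
        · exact (hmem _).2 ⟨hxb, .inr hex⟩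
        · exact hw c hc
  refine ⟨A _ hs₀ hc₀.isCat, fun e he => ?_⟩
  rcases ((hmem e).1 he).2 with hxe | hex
  · have hne : f e ≠ b := hxe ▸ hxb
    obtain ⟨w, hw⟩ := down _ (par e) le_rfl (hxe ▸ (hpar e hne).1)
    refine ⟨.cons (hadj' e hne) w, fun c hc => ?_⟩
    rw [SimpleGraph.Walk.support_cons, List.mem_cons] at hc
    rcases hc with rfl | hc
    · exact he
    · exact hw c hc
  · exact down _ e le_rfl hex

lemma exists_isNaming_of_isDecomposition {l r : BPat} {Ψ : TwoFCCQ}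
    (h : IsDecomposition (.cat l r) Ψ) : ∃ ν, IsNaming (.cat l r) ν ∧
      ∀ e, e ∈ Ψ.body ↔ ∃ s ∈ (BPat.cat l r).subs, s.IsCat ∧ e = s.atom ν := by
  obtain ⟨-, ν, hinj, -, hroot, hbody⟩ := h
  refine ⟨ν, ⟨hinj, hroot⟩, fun e => (hbody e).trans ⟨?_, ?_⟩⟩
  · rintro ⟨p, q, hpq, rfl⟩
    exact ⟨_, hpq, isCat_cat p q, rfl⟩
  · rintro ⟨_, hs, ⟨p, q, rfl⟩, rfl⟩
    exact ⟨p, q, hs, rfl⟩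

/-- The decomposition can be disregarded: acyclicity depends only on the bracketing. -/
lemma IsAcyclic.good {b : BPat} (h : b.IsAcyclic) : b.Good := by
  obtain ⟨Ψ, hd, G, hG⟩ := h
  cases b with
  | var x => trivial
  | cat l r =>
    obtain ⟨ν, hν, hΨ⟩ := exists_isNaming_of_isDecomposition hd
    exact (sameBase_of_isJoinTree hν hΨ hG).good

lemma Good.isAcyclic_of_isDecomposition {b : BPat} (h : b.Good) {Ψ : TwoFCCQ}
    (hd : IsDecomposition b Ψ) : Ψ.IsAcyclic := by
  cases b with
  | var x =>
    have hb : Ψ.body = {⟨univVar, [x]⟩} := hd.2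
    have : Subsingleton {e : WordEq // e ∈ Ψ.body} := by
      rw [hb]
      exact ⟨fun a b => Subtype.ext ((Finset.mem_singleton.1 a.2).trans
        (Finset.mem_singleton.1 b.2).symm)⟩
    have : Nonempty {e : WordEq // e ∈ Ψ.body} := by
      rw [hb]
      exact ⟨⟨_, Finset.mem_singleton_self _⟩⟩
    refine ⟨⊥, SimpleGraph.IsTree.of_subsingleton, fun a b z ha _ p _ c _ => ?_⟩
    rwa [Subsingleton.elim c a]
  | cat l r =>
    obtain ⟨ν, hν, hΨ⟩ := exists_isNaming_of_isDecomposition hd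
    exact h.sameBase.exists_isJoinTree (isCat_cat l r) hν hΨ

end BPat

/-! ### The concatenation tree of a good bracketing -/

namespace BPat

/-- The tree of a bracketing, with its sub-bracketings named by `ν`. -/
def toTree (ν : BPat → Var) : BPat → LTree
  | .var x => .leaf (ν (.var x))
  | .cat l r => .node (ν (.cat l r)) (l.toTree ν) (r.toTree ν)

/-- The pruned tree of a good bracketing: among the two children of a node, a child is cut off if it
is a factor of the other one, and so is the right child if the two are equal. -/
def concatTree (ν : BPat → Var) : BPat → LTree
  | .var x => .leaf (ν (.var x))
  | .cat l r => .node (ν (.cat l r))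
      (if r.HasChild l then .leaf (ν l) else l.concatTree ν)
      (if l = r ∨ l.HasChild r then .leaf (ν r) else r.concatTree ν)

/-- The sub-bracketing at an address (`false` = left, `true` = right). -/
def at? : BPat → List Bool → Option BPat
  | b, [] => some b
  | .var _, _ :: _ => none
  | .cat l _, false :: p => l.at? p
  | .cat _ r, true :: p => r.at? p

@[simp] lemma at?_nil (b : BPat) : b.at? [] = some b := by cases b <;> rfl

lemma at?_append (b : BPat) (p q : List Bool) :
    b.at? (p ++ q) = (b.at? p).bind fun s => s.at? q := by
  induction p generalizing b with
  | nil => simp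
  | cons d p ih => cases b <;> cases d <;> simp [at?, ih]

lemma mem_subs_of_at? {b s : BPat} {p : List Bool} (h : b.at? p = some s) : s ∈ b.subs := by
  induction p generalizing b with
  | nil => simp at h; simp [h]
  | cons d p ih =>
    cases b <;> cases d <;> simp only [at?, reduceCtorEq] at h
    · exact mem_subs_cat.2 (.inr (.inl (ih h)))
    · exact mem_subs_cat.2 (.inr (.inr (ih h)))

lemma exists_at? {b s : BPat} (h : s ∈ b.subs) : ∃ p, b.at? p = some s := by
  induction b with
  | var y => exact ⟨[], by simp [mem_subs_var.1 h]⟩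
  | cat l r ihl ihr =>
    rcases mem_subs_cat.1 h with rfl | h | h
    · exact ⟨[], by simp⟩
    · obtain ⟨p, hp⟩ := ihl h; exact ⟨false :: p, hp⟩
    · obtain ⟨p, hp⟩ := ihr h; exact ⟨true :: p, hp⟩

@[simp] lemma label_toTree (ν : BPat → Var) (b : BPat) : (b.toTree ν).label = ν b := by
  cases b <;> rfl

lemma innerLabel_toTree {ν : BPat → Var} {b : BPat} {p : List Bool} {z : Var} :
    (b.toTree ν).innerLabel p = some z ↔ ∃ s, b.at? p = some s ∧ s.IsCat ∧ ν s = z := by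
  induction p generalizing b with
  | nil =>
    cases b with
    | var x => simp [toTree, LTree.innerLabel, IsCat]
    | cat l r => simp [toTree, LTree.innerLabel, IsCat]
  | cons d p ih =>
    cases b with
    | var x => simp [toTree, LTree.innerLabel, at?]
    | cat l r => cases d <;> simp [toTree, LTree.innerLabel, at?, ih]

/-- The address `p` of a composite sub-bracketing is not the last one with respect to `≪`. -/
def RedundantAt (b : BPat) (p : List Bool) : Prop :=
  ∃ s q, b.at? p = some s ∧ s.IsCat ∧ b.at? q = some s ∧ NodeLT p q

lemma redundant_toTree {ν : BPat → Var} {b : BPat} (hν : IsNaming b ν) {p : List Bool} :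
    (b.toTree ν).Redundant p ↔ b.RedundantAt p := by
  simp only [LTree.Redundant, innerLabel_toTree, RedundantAt]
  constructor
  · rintro ⟨z, q, ⟨s, hs, hc, rfl⟩, ⟨t, ht, -, he⟩, hlt⟩
    obtain rfl := hν.injOn (mem_subs_of_at? ht) (mem_subs_of_at? hs) he
    exact ⟨t, q, hs, hc, ht, hlt⟩
  · rintro ⟨s, q, hs, hc, hq, hlt⟩
    exact ⟨ν s, q, ⟨s, hs, hc, rfl⟩, ⟨s, hq, hc, rfl⟩, hlt⟩

lemma isLeftOf_concat {p q : List Bool} {d e : Bool} (hl : p.length = q.length)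
    (h : IsLeftOf (p ++ [d]) (q ++ [e])) : IsLeftOf p q ∨ (p = q ∧ d = false ∧ e = true) := by
  obtain ⟨c, p', q', hp, hq⟩ := h
  induction p' using List.reverseRecOn with
  | nil =>
    obtain ⟨rfl, hd⟩ := List.append_inj' hp rfl
    have : q'.length = 0 := by
      have := congrArg List.length hq
      simp at this
      omega
    obtain rfl := List.length_eq_zero_iff.1 this
    obtain ⟨rfl, he⟩ := List.append_inj' hq rfl
    simp at hd he
    exact .inr ⟨rfl, hd, he⟩
  | append_singleton p' d' =>
    have : q' ≠ [] := by
      rintro rfl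
      have h1 := congrArg List.length hp
      have h2 := congrArg List.length hq
      simp at h1 h2
      omega
    obtain ⟨q', e', rfl⟩ := List.eq_nil_or_concat q' |>.resolve_left this
    rw [List.concat_eq_append] at hq
    rw [← List.cons_append, ← List.append_assoc] at hp hq
    exact .inl ⟨c, p', q', (List.append_inj' hp rfl).1, (List.append_inj' hq rfl).1⟩

/-- Below the last occurrence of a bracketing that is the base of its parents' factor `x`, the factor
`x` occurs for the last time, too: every other parent of `x` contains `s`, whence its occurrences are
closer to the root. -/
lemma not_redundantAt_child {b s x : BPat} (hb : b.SameBase) {p : List Bool} {e : Bool}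
    (hp : b.at? p = some s) (hnr : ¬ b.RedundantAt p) (hx : s.at? [e] = some x)
    (hbase : base x s = s) (hlr : ∀ l, s ≠ .cat l l ∨ e = false) : ¬ b.RedundantAt (p ++ [e]) := by
  have hsx : s.HasChild x := by
    cases s <;> cases e <;> simp_all [at?]
  rintro ⟨x', q, hx', -, hq, hlt⟩
  rw [at?_append, hp, Option.bind_some, hx, Option.some_inj] at hx'
  subst hx'
  have hs := mem_subs_of_at? hp
  induction q using List.reverseRecOn with
  | nil =>
    rw [at?_nil, Option.some_inj] at hq
    subst hq
    have := hsx.len_lt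
    have := len_le_of_mem_subs hs
    omega
  | append_singleton q d _ =>
    rw [at?_append] at hq
    obtain ⟨t, ht, hd⟩ := Option.bind_eq_some_iff.1 hq
    have htx : t.HasChild x := by
      cases t <;> cases d <;> simp_all [at?]
    have hts := hb x t s (mem_subs_of_at? ht) hs htx hsx
    rw [hbase] at hts
    obtain ⟨w, hw⟩ := exists_at? (base_mem_subs x t)
    rw [hts] at hw
    have hqw : b.at? (q ++ w) = some s := by rw [at?_append, ht, Option.bind_some, hw]
    have hn : ¬ NodeLT p (q ++ w) := fun h => hnr ⟨s, _, hp, hsx.isCat, hqw, h⟩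
    have hlen : ¬ p.length < (q ++ w).length := fun h => hn (.inl h)
    rw [List.length_append] at hlen
    rcases hlt with hlt | ⟨hl, hlt⟩
    · simp at hlt; omega
    · simp at hl
      have : w = [] := List.length_eq_zero_iff.1 (by omega)
      subst this
      rw [at?_nil, Option.some_inj] at hw
      subst hw
      rcases isLeftOf_concat hl.symm hlt with h | ⟨rfl, rfl, rfl⟩
      · exact hn (.inr ⟨by simpa using hl, by simpa using h⟩)
      · cases t with
        | var => exact hsx
        | cat l r =>
          simp only [at?, at?_nil, Option.some_inj] at hd hx
          exact (hlr x).elim (fun h => h (by rw [hd, hx])) (by simp)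

lemma pruneAt_toTree {ν : BPat → Var} {b : BPat} (hb : b.SameBase) (hν : IsNaming b ν) {s : BPat}
    {p : List Bool} (hp : b.at? p = some s) (hnr : ¬ b.RedundantAt p) :
    (b.toTree ν).pruneAt p (s.toTree ν) = s.concatTree ν := by
  have leaf : ∀ {x : BPat} {q : List Bool}, (x.IsCat → b.RedundantAt q) →
      (b.toTree ν).pruneAt q (x.toTree ν) = .leaf (ν x) := by
    intro x q h
    cases x with
    | var y => rfl
    | cat l r =>
      simp only [toTree, LTree.pruneAt, if_pos ((redundant_toTree hν).2 (h (isCat_cat l r)))]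
  induction s generalizing p with
  | var y => rfl
  | cat l r ihl ihr =>
    have hatl : b.at? (p ++ [false]) = some l := by
      rw [at?_append, hp, Option.bind_some]; simp [at?]
    have hatr : b.at? (p ++ [true]) = some r := by
      rw [at?_append, hp, Option.bind_some]; simp [at?]
    have hself : ∀ {t : BPat}, ¬ t.HasChild t := fun h => absurd h.len_lt (lt_irrefl _)
    -- a grandchild is farther from the root than its copy among the children
    have deeper : ∀ {x y : BPat} {d e : Bool}, b.at? (p ++ [d]) = some y →
        b.at? (p ++ [e]) = some x → y.HasChild x → x.IsCat → b.RedundantAt (p ++ [e]) := by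
      intro x y d e hy hx hyx hxc
      obtain ⟨d', hd'⟩ : ∃ d', y.at? [d'] = some x := by
        cases y with
        | var => exact hyx.elim
        | cat l r =>
          rcases hyx with rfl | rfl
          · exact ⟨false, by simp [at?]⟩
          · exact ⟨true, by simp [at?]⟩
      exact ⟨x, p ++ [d] ++ [d'], hx, hxc, by rw [at?_append, hy, Option.bind_some, hd'],
        .inl (by simp)⟩
    simp only [toTree, LTree.pruneAt, concatTree]
    rw [if_neg (fun h => hnr ((redundant_toTree hν).1 h))]
    congr 1
    · split_ifs with h
      · exact leaf (deeper hatr hatl h)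
      · refine ihl hatl (not_redundantAt_child (x := l) hb hp hnr (by simp [at?]) ?_
          (fun _ => .inr rfl))
        rw [base, if_neg (fun h' => h h'.2), if_neg (fun h' => hself h'.2)]
    · split_ifs with h
      · refine leaf fun hc => ?_
        rcases h with rfl | h
        · exact ⟨l, p ++ [false], hatr, hc, hatl, .inr ⟨by simp, p, [], [], rfl, rfl⟩⟩
        · exact deeper hatl hatr h hc
      · rw [not_or] at h
        refine ihr hatr (not_redundantAt_child (x := r) hb hp hnr (by simp [at?]) ?_ ?_)
        · rw [base, if_neg (fun h' => hself h'.2), if_neg (fun h' => h.2 h'.2)]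
        · intro t
          left
          rintro ⟨⟩
          exact h.1 rfl

lemma isUnfolding_toTree {ν : BPat → Var} {b : BPat} (hν : IsNaming b ν) {Ψ : TwoFCCQ}
    (hΨ : ∀ e, e ∈ Ψ.body ↔ ∃ s ∈ b.subs, s.IsCat ∧ e = s.atom ν) {s : BPat} (hs : s ∈ b.subs) :
    IsUnfolding Ψ (s.toTree ν) := by
  induction s with
  | var y =>
    intro e he
    obtain ⟨_, ht, ⟨l, r, rfl⟩, rfl⟩ := (hΨ e).1 he
    intro h
    exact absurd (hν.injOn ht hs h) (by simp)
  | cat l r ihl ihr =>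
    refine ⟨?_, ihl (left_mem_subs hs), ihr (right_mem_subs hs)⟩
    rw [label_toTree, label_toTree]
    exact (hΨ _).2 ⟨_, hs, isCat_cat l r, rfl⟩

/-- The pruned tree is the concatenation tree of the decomposition with the given names. -/
lemma Good.exists_isConcatTree {b : BPat} (h : b.Good) (hb : b.IsCat) {ν : BPat → Var}
    (hν : IsNaming b ν) (hvar : ∀ x, .var x ∈ b.subs → ν (.var x) = x) :
    ∃ Ψ, IsDecomposition b Ψ ∧ Ψ.IsAcyclic ∧ IsConcatTree Ψ (b.concatTree ν) := by
  classical
  have hΨ : ∀ e, e ∈ (b.subs.filter IsCat).image (atom ν) ↔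
      ∃ s ∈ b.subs, s.IsCat ∧ e = s.atom ν := by
    intro e
    simp only [Finset.mem_image, Finset.mem_filter]
    constructor
    · rintro ⟨s, ⟨h1, h2⟩, rfl⟩
      exact ⟨s, h1, h2, rfl⟩
    · rintro ⟨s, h1, h2, rfl⟩
      exact ⟨s, ⟨h1, h2⟩, rfl⟩
  let Ψ : TwoFCCQ := ⟨[], (b.subs.filter IsCat).image (atom ν), by
    intro e he
    obtain ⟨_, -, ⟨l, r, rfl⟩, rfl⟩ := (hΨ e).1 he
    simp [atom]⟩
  have hd : IsDecomposition b Ψ := by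
    obtain ⟨l, r, rfl⟩ := hb
    refine ⟨rfl, ν, hν.injOn, hvar, hν.root, fun e => (hΨ e).trans ⟨?_, ?_⟩⟩
    · rintro ⟨_, hs, ⟨p, q, rfl⟩, rfl⟩
      exact ⟨p, q, hs, rfl⟩
    · rintro ⟨p, q, hs, rfl⟩
      exact ⟨_, hs, isCat_cat p q, rfl⟩
  refine ⟨Ψ, hd, h.isAcyclic_of_isDecomposition hd, b.toTree ν, ?_,
    isUnfolding_toTree hν hΨ (self_mem_subs b), ?_⟩
  · rw [label_toTree, hν.root]
  · refine (pruneAt_toTree h.sameBase hν (at?_nil b) ?_).symm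
    rintro ⟨s, q, hs, -, hq, hlt⟩
    rw [at?_nil, Option.some_inj] at hs
    subst hs
    -- the whole bracketing occurs at the root only
    have hroot : ∀ {q : List Bool} {t : BPat}, t.at? q = some b → t.len ≤ b.len → q = [] := by
      intro q t hq hle
      cases q with
      | nil => rfl
      | cons d q =>
        cases t with
        | var y => simp [at?] at hq
        | cat l r =>
          have := l.len_pos
          have := r.len_pos
          simp only [len_cat] at hle
          cases d <;> simp only [at?] at hq <;>
            have := len_le_of_mem_subs (mem_subs_of_at? hq) <;> omega
    rw [hroot hq le_rfl] at hlt
    rcases hlt with hlt | ⟨-, c, p', q', h1, -⟩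
    · simp at hlt
    · simp at h1

/-- Two sub-bracketings of a good bracketing that differ only in their brackets are equal. -/
lemma Good.flatten_injOn {b : BPat} (h : b.Good) :
    Set.InjOn flatten (b.subs : Set BPat) := by
  have hlen : ∀ {s t : BPat}, s.flatten = t.flatten → s.len = t.len := fun h => by
    simp only [len, h]
  have top : ∀ {b s : BPat}, s ∈ b.subs → s.flatten = b.flatten → s = b := fun hs he =>
    eq_of_mem_subs_of_len_le hs (hlen he).ge
  induction b with
  | var y =>
    intro s hs t ht _
    rw [Finset.mem_coe, mem_subs_var] at hs ht
    rw [hs, ht]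
  | cat l r ihl ihr =>
    obtain ⟨gl, gr, hc⟩ := h
    have cross : ∀ s t : BPat, s ∈ l.subs → t ∈ r.subs → s.flatten = t.flatten → s = t := by
      intro s t hs ht he
      rcases hc with rfl | hc | hc | hc
      · exact ihl gl hs ht he
      · exact ihr gr (subs_subset hc.mem_subs hs) ht he
      · exact ihl gl hs (subs_subset hc.mem_subs ht) he
      · obtain ⟨a, ha⟩ := List.exists_mem_of_ne_nil _ s.flatten_ne_nil
        exact (hc (flatten_subset_of_mem_subs hs ha)
          (flatten_subset_of_mem_subs ht (he ▸ ha))).elim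
    intro s hs t ht he
    rw [Finset.mem_coe] at hs ht
    rcases mem_subs_cat.1 hs with rfl | hs'
    · exact (top ht he.symm).symm
    rcases mem_subs_cat.1 ht with rfl | ht'
    · exact top hs he
    rcases hs' with hs' | hs' <;> rcases ht' with ht' | ht'
    · exact ihl gl hs' ht' he
    · exact cross s t hs' ht' he
    · exact (cross t s ht' hs' he.symm).symm
    · exact ihr gr hs' ht' he

end BPat

/-! ### A language of bounded loops -/

/-- Names of the variables of a program. -/
inductive Loc : Type
  | zero | one | n | ans | x | y | i | i' | j | k | p | q | r | s | t | u | v | w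
  | max | fresh | lab | good | split | ok | ls | rs | top | out
  deriving DecidableEq

/-- Names of the tables of a program; each has three indices. -/
inductive Tab : Type
  | lab | good | split | ok | ls | rs | stackI | stackK | stackJ
  deriving DecidableEq

/-- Elementary operations: assignments of constants, successors, values and truncated differences,
access to the input and output cells, and access to a table. There is no addition, so that no value
can grow by more than one in a step. -/
inductive Op : Type
  | const (d : Loc) (c : ℕ) : Op
  | inc (d a : Loc) : Op
  | copy (d a : Loc) : Op
  | sub (d a b : Loc) : Op
  | rd (d p : Loc) : Op
  | wr (p a : Loc) : Op
  | ld (d : Loc) (T : Tab) (i k j : Loc) : Op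
  | st (T : Tab) (i k j a : Loc) : Op

/-- Statements. In `loop x s` the body `s` is executed for `x = 0, …, n - 1`, where `n` is the length
of the input, so that the running time is bounded by a polynomial in `n` whose degree is the nesting
depth. -/
inductive Stmt : Type
  | skip : Stmt
  | op (o : Op) : Stmt
  | seq (s t : Stmt) : Stmt
  | ite (a b : Loc) (s t : Stmt) : Stmt
  | loop (x : Loc) (s : Stmt) : Stmt

infixr:60 " ;; " => Stmt.seq

/-- The values of the variables, of the input and output cells and of the tables. -/
structure St : Type where
  var : Loc → ℕ
  raw : ℕ → ℕ
  tab : Tab → ℕ → ℕ → ℕ → ℕ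

namespace St

/-- Assign the value `a` to the variable `d`. -/
def setVar (σ : St) (d : Loc) (a : ℕ) : St := { σ with var := Function.update σ.var d a }

/-- Write `a` to the input and output cell `p`. -/
def setRaw (σ : St) (p a : ℕ) : St := { σ with raw := Function.update σ.raw p a }

/-- Write `a` to the entry `(i, k, j)` of the table `T`. -/
def setTab (σ : St) (T : Tab) (i k j a : ℕ) : St :=
  { σ with tab := fun T' i' k' j' =>
      if T' = T ∧ i' = i ∧ k' = k ∧ j' = j then a else σ.tab T' i' k' j' }

end St

/-- The effect of an operation on an input of length `n`. The input and output cells have the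
addresses up to `4 * n`; larger addresses are cut down to this value. -/
def Op.exec (n : ℕ) : Op → St → St
  | .const d c, σ => σ.setVar d c
  | .inc d a, σ => σ.setVar d (σ.var a + 1)
  | .copy d a, σ => σ.setVar d (σ.var a)
  | .sub d a b, σ => σ.setVar d (σ.var a - σ.var b)
  | .rd d p, σ => σ.setVar d (σ.raw (min (σ.var p) (4 * n)))
  | .wr p a, σ => σ.setRaw (min (σ.var p) (4 * n)) (σ.var a)
  | .ld d T i k j, σ => σ.setVar d (σ.tab T (σ.var i) (σ.var k) (σ.var j))
  | .st T i k j a, σ => σ.setTab T (σ.var i) (σ.var k) (σ.var j) (σ.var a)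

/-- The effect of a statement on an input of length `n`. -/
def Stmt.exec (n : ℕ) : Stmt → St → St
  | .skip, σ => σ
  | .op o, σ => o.exec n σ
  | .seq s t, σ => t.exec n (s.exec n σ)
  | .ite a b s t, σ => if σ.var a < σ.var b then s.exec n σ else t.exec n σ
  | .loop x s, σ => Nat.rec σ (fun i τ => s.exec n (τ.setVar x i)) n

/-- A bound on the number of machine steps. -/
def Stmt.cost (n : ℕ) : Stmt → ℕ
  | .skip => 0
  | .op _ => 13
  | .seq s t => s.cost n + t.cost n
  | .ite _ _ s t => 2 + s.cost n + t.cost n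
  | .loop _ s => 3 + n * (s.cost n + 4)

/-- The nesting depth of loops. -/
def Stmt.depth : Stmt → ℕ
  | .skip => 0
  | .op _ => 0
  | .seq s t => max s.depth t.depth
  | .ite _ _ s t => max s.depth t.depth
  | .loop _ s => s.depth + 1

lemma Stmt.exists_cost_le (s : Stmt) : ∃ C, ∀ n, 1 ≤ n → s.cost n ≤ C * n ^ s.depth := by
  induction s with
  | skip => exact ⟨0, fun n _ => by simp [cost]⟩
  | op o => exact ⟨13, fun n _ => by simp [cost, depth]⟩
  | seq s t ihs iht =>
    obtain ⟨C, hC⟩ := ihs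
    obtain ⟨D, hD⟩ := iht
    refine ⟨C + D, fun n hn => ?_⟩
    have h1 : C * n ^ s.depth ≤ C * n ^ max s.depth t.depth :=
      Nat.mul_le_mul_left _ (Nat.pow_le_pow_right hn (le_max_left _ _))
    have h2 : D * n ^ t.depth ≤ D * n ^ max s.depth t.depth :=
      Nat.mul_le_mul_left _ (Nat.pow_le_pow_right hn (le_max_right _ _))
    have := hC n hn
    have := hD n hn
    simp only [cost, depth, add_mul]
    omega
  | ite a b s t ihs iht =>
    obtain ⟨C, hC⟩ := ihs
    obtain ⟨D, hD⟩ := iht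
    refine ⟨2 + C + D, fun n hn => ?_⟩
    have h1 : C * n ^ s.depth ≤ C * n ^ max s.depth t.depth :=
      Nat.mul_le_mul_left _ (Nat.pow_le_pow_right hn (le_max_left _ _))
    have h2 : D * n ^ t.depth ≤ D * n ^ max s.depth t.depth :=
      Nat.mul_le_mul_left _ (Nat.pow_le_pow_right hn (le_max_right _ _))
    have := hC n hn
    have := hD n hn
    have := Nat.one_le_pow (max s.depth t.depth) n hn
    simp only [cost, depth, add_mul]
    omega
  | loop x s ih =>
    obtain ⟨C, hC⟩ := ih
    refine ⟨C + 7, fun n hn => ?_⟩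
    have h1 := Nat.mul_le_mul_left n (hC n hn)
    have h2 := Nat.one_le_pow s.depth n hn
    have h3 := Nat.mul_le_mul_left n h2
    simp only [cost, depth, pow_succ]
    nlinarith

/-! ### Translation into machine programs -/

lemma Loc.ctorIdx_injective : Function.Injective Loc.ctorIdx := by
  intro a b h
  cases a <;> cases b <;> first | rfl | (exact absurd h (by decide))

lemma Tab.ctorIdx_injective : Function.Injective Tab.ctorIdx := by
  intro a b h
  cases a <;> cases b <;> first | rfl | (exact absurd h (by decide))

/-- The register of a variable. The registers `R₀, R₁, R₂, R₃` hold the length `n` of the input, `4 n`,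
zero and one, and `R₄, …, R₁₅` are used for the computation of addresses. -/
def Loc.reg (v : Loc) : ℕ := 20 + 2 * v.ctorIdx

/-- The register of the counter of a loop inside of `d` other loops. -/
def counter (d : ℕ) : ℕ := 21 + 2 * d

/-- An injective pairing function that is computed without a case distinction. -/
def sqPair (a b : ℕ) : ℕ := (a + b) * (a + b) + a

lemma sqPair_inj {a b c d : ℕ} (h : sqPair a b = sqPair c d) : a = c ∧ b = d := by
  unfold sqPair at h
  have h1 : a + b = c + d := by
    rcases lt_trichotomy (a + b) (c + d) with hl | hl | hl
    · nlinarith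
    · exact hl
    · nlinarith
  rw [h1] at h
  omega

/-- The memory cell of an entry of a table. -/
def tabAddr (n : ℕ) (T : Tab) (i k j : ℕ) : ℕ :=
  sqPair T.ctorIdx (sqPair i (sqPair k j)) + 4 * n + 1

lemma tabAddr_inj {n : ℕ} {T T' : Tab} {i k j i' k' j' : ℕ}
    (h : tabAddr n T i k j = tabAddr n T' i' k' j') : T = T' ∧ i = i' ∧ k = k' ∧ j = j' := by
  have h0 : sqPair T.ctorIdx (sqPair i (sqPair k j)) =
      sqPair T'.ctorIdx (sqPair i' (sqPair k' j')) := by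
    unfold tabAddr at h
    omega
  obtain ⟨h1, h2⟩ := sqPair_inj h0
  obtain ⟨h2, h3⟩ := sqPair_inj h2
  obtain ⟨h3, h4⟩ := sqPair_inj h3
  exact ⟨Tab.ctorIdx_injective h1, h2, h3, h4⟩

/-- Load the address of a table entry into `R₁₅`. -/
def tabAddrCode (T : Tab) (i k j : Loc) : List Instr :=
  [.add 4 k.reg j.reg, .mul 5 4 4, .add 6 5 k.reg, .add 7 i.reg 6, .mul 8 7 7, .add 9 8 i.reg,
    .const 10 T.ctorIdx, .add 11 10 9, .mul 12 11 11, .add 13 12 10, .add 14 13 1, .add 15 14 3]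

/-- The machine code of an operation. -/
def Op.code : Op → List Instr
  | .const d c => [.const d.reg c]
  | .inc d a => [.add d.reg a.reg 3]
  | .copy d a => [.sub d.reg a.reg 2]
  | .sub d a b => [.sub d.reg a.reg b.reg]
  -- `p - (p - 4 n)` is the minimum of `p` and `4 n`
  | .rd d p => [.sub 4 p.reg 1, .sub 4 p.reg 4, .load d.reg 4]
  | .wr p a => [.sub 4 p.reg 1, .sub 4 p.reg 4, .store 4 a.reg]
  | .ld d T i k j => tabAddrCode T i k j ++ [.load d.reg 15]
  | .st T i k j a => tabAddrCode T i k j ++ [.store 15 a.reg]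

/-- The number of instructions of the code of a statement. -/
def Stmt.size : Stmt → ℕ
  | .skip => 0
  | .op o => o.code.length
  | .seq s t => s.size + t.size
  | .ite _ _ s t => s.size + t.size + 2
  | .loop _ s => s.size + 6

/-- The code of a statement inside of `d` loops, to be placed at the address `off`. As `R₂ = 0` and
`R₃ = 1`, a conditional jump with these registers is always taken. -/
def Stmt.code : Stmt → (off d : ℕ) → List Instr
  | .skip, _, _ => []
  | .op o, _, _ => o.code
  | .seq s t, off, d => s.code off d ++ t.code (off + s.size) d
  | .ite a b s t, off, d =>
      .jumpLT a.reg b.reg (off + t.size + 2) :: (t.code (off + 1) d ++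
        .jumpLT 2 3 (off + s.size + t.size + 2) :: s.code (off + t.size + 2) d)
  | .loop x s, off, d =>
      .const (counter d) 0 :: .jumpLT (counter d) 0 (off + 3) :: .jumpLT 2 3 (off + s.size + 6) ::
        .sub x.reg (counter d) 2 :: (s.code (off + 4) (d + 1) ++
          [.add (counter d) (counter d) 3, .jumpLT 2 3 (off + 1)])

lemma Stmt.length_code (s : Stmt) (off d : ℕ) : (s.code off d).length = s.size := by
  induction s generalizing off d with
  | skip => rfl
  | op o => rfl
  | seq s t ihs iht => simp [code, size, ihs, iht]
  | ite a b s t ihs iht => simp [code, size, ihs, iht]; omega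
  | loop x s ih => simp [code, size, ih]

/-- The list `l` is a part of the program that starts at the address `off`. -/
def CodeAt (P : Program) (off : ℕ) (l : List Instr) : Prop :=
  ∃ l₁ l₂, P = l₁ ++ l ++ l₂ ∧ l₁.length = off

lemma CodeAt.left {P : Program} {off : ℕ} {l l' : List Instr} (h : CodeAt P off (l ++ l')) :
    CodeAt P off l := by
  obtain ⟨l₁, l₂, rfl, rfl⟩ := h
  exact ⟨l₁, l' ++ l₂, by simp, rfl⟩

lemma CodeAt.right {P : Program} {off : ℕ} {l l' : List Instr} (h : CodeAt P off (l ++ l'))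
    {off' : ℕ} (ho : off' = off + l.length) : CodeAt P off' l' := by
  obtain ⟨l₁, l₂, rfl, rfl⟩ := h
  exact ⟨l₁ ++ l, l₂, by simp, by simp [ho]⟩

lemma CodeAt.tail {P : Program} {off : ℕ} {i : Instr} {l : List Instr}
    (h : CodeAt P off (i :: l)) : CodeAt P (off + 1) l :=
  CodeAt.right (l := [i]) h rfl

lemma CodeAt.head {P : Program} {off : ℕ} {i : Instr} {l : List Instr}
    (h : CodeAt P off (i :: l)) : P[off]? = some i := by
  obtain ⟨l₁, l₂, rfl, rfl⟩ := h
  simp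

/-- The effect of an instruction other than a jump on the registers and the memory. -/
def lineStep (c : Config) : Instr → Config
  | .const d k => { c with reg := Function.update c.reg d k }
  | .add d a b => { c with reg := Function.update c.reg d (c.reg a + c.reg b) }
  | .sub d a b => { c with reg := Function.update c.reg d (c.reg a - c.reg b) }
  | .mul d a b => { c with reg := Function.update c.reg d (c.reg a * c.reg b) }
  | .load d a => { c with reg := Function.update c.reg d (c.mem (c.reg a)) }
  | .store a b => { c with mem := Function.update c.mem (c.reg a) (c.reg b) }
  | _ => c

/-- The instruction is neither a jump nor `halt`. -/
def Instr.IsLine : Instr → Prop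
  | .jumpLT _ _ _ => False
  | .halt => False
  | _ => True

lemma lineStep_with_pc (c : Config) (i : Instr) (k : ℕ) :
    lineStep { c with pc := k } i = { lineStep c i with pc := k } := by
  cases i <;> rfl

lemma iterate_step_line {P : Program} {l : List Instr} (hl : ∀ i ∈ l, i.IsLine) (c : Config)
    (h : CodeAt P c.pc l) :
    (step P)^[l.length] c = { l.foldl lineStep c with pc := c.pc + l.length } := by
  induction l generalizing c with
  | nil => rfl
  | cons i l ih =>
    have h1 : step P c = { lineStep c i with pc := c.pc + 1 } := by
      have hi := hl i (by simp)
      rw [step, h.head]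
      cases i <;> first | rfl | exact hi.elim
    rw [List.length_cons, Function.iterate_succ_apply, h1, ih (fun j hj => hl j (by simp [hj])) _
      h.tail, List.foldl_cons]
    have : ∀ (l : List Instr) (c : Config) (k : ℕ), l.foldl lineStep { c with pc := k } =
        { l.foldl lineStep c with pc := k } := by
      intro l
      induction l with
      | nil => intro c k; rfl
      | cons i l ih => intro c k; rw [List.foldl_cons, lineStep_with_pc, ih, List.foldl_cons]
    rw [this]
    simp only [Config.mk.injEq, and_true]
    omega

/-- The configuration `c` represents the state `σ`. -/
structure Encodes (n : ℕ) (σ : St) (c : Config) : Prop where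
  reg0 : c.reg 0 = n
  reg1 : c.reg 1 = 4 * n
  reg2 : c.reg 2 = 0
  reg3 : c.reg 3 = 1
  var : ∀ v : Loc, c.reg v.reg = σ.var v
  raw : ∀ p ≤ 4 * n, c.mem p = σ.raw p
  tab : ∀ T i k j, c.mem (tabAddr n T i k j) = σ.tab T i k j

lemma Loc.reg_inj {v w : Loc} : v.reg = w.reg ↔ v = w := by
  constructor
  · intro h
    apply Loc.ctorIdx_injective
    unfold Loc.reg at h
    omega
  · rintro rfl
    rfl

lemma Loc.reg_ne {v : Loc} {a : ℕ} (h : a < 20) : v.reg ≠ a := by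
  unfold Loc.reg; omega

lemma Loc.reg_ne_counter {v : Loc} {d : ℕ} : v.reg ≠ counter d := by
  unfold Loc.reg counter; omega

lemma counter_ne {d a : ℕ} (h : a < 20) : counter d ≠ a := by
  unfold counter; omega

lemma counter_inj {d e : ℕ} : counter d = counter e ↔ d = e := by
  unfold counter; omega

namespace Encodes

variable {n : ℕ} {σ : St} {c c' : Config}

/-- Only the registers of variables, the first four registers and the memory matter. -/
lemma congr (h : Encodes n σ c) (h0 : c'.reg 0 = c.reg 0) (h1 : c'.reg 1 = c.reg 1)
    (h2 : c'.reg 2 = c.reg 2) (h3 : c'.reg 3 = c.reg 3)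
    (hv : ∀ v : Loc, c'.reg v.reg = c.reg v.reg) (hm : c'.mem = c.mem) : Encodes n σ c' where
  reg0 := h0.trans h.reg0
  reg1 := h1.trans h.reg1
  reg2 := h2.trans h.reg2
  reg3 := h3.trans h.reg3
  var v := (hv v).trans (h.var v)
  raw p hp := by rw [hm, h.raw p hp]
  tab T i k j := by rw [hm, h.tab]

lemma setVar (h : Encodes n σ c) (d : Loc) {a b : ℕ} (hab : b = a) :
    Encodes n (σ.setVar d a) { c with reg := Function.update c.reg d.reg b } where
  reg0 := (Function.update_of_ne (Loc.reg_ne (by norm_num)).symm _ _).trans h.reg0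
  reg1 := (Function.update_of_ne (Loc.reg_ne (by norm_num)).symm _ _).trans h.reg1
  reg2 := (Function.update_of_ne (Loc.reg_ne (by norm_num)).symm _ _).trans h.reg2
  reg3 := (Function.update_of_ne (Loc.reg_ne (by norm_num)).symm _ _).trans h.reg3
  var v := by simp [St.setVar, Function.update_apply, Loc.reg_inj, h.var, hab]
  raw := h.raw
  tab := h.tab

lemma setRaw (h : Encodes n σ c) {p q a b : ℕ} (hp : p ≤ 4 * n) (hpq : q = p) (hab : b = a) :
    Encodes n (σ.setRaw p a) { c with mem := Function.update c.mem q b } where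
  reg0 := h.reg0
  reg1 := h.reg1
  reg2 := h.reg2
  reg3 := h.reg3
  var := h.var
  raw q hq := by
    subst hpq hab
    simp only [St.setRaw, Function.update_apply]
    split_ifs
    · rfl
    · exact h.raw q hq
  tab T i k j := by
    subst hpq
    refine (Function.update_of_ne ?_ _ _).trans (h.tab T i k j)
    unfold tabAddr
    omega

lemma setTab (h : Encodes n σ c) {T : Tab} {i k j q a b : ℕ} (hq : q = tabAddr n T i k j)
    (hab : b = a) : Encodes n (σ.setTab T i k j a) { c with mem := Function.update c.mem q b } where
  reg0 := h.reg0
  reg1 := h.reg1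
  reg2 := h.reg2
  reg3 := h.reg3
  var := h.var
  raw p hp := by
    subst hq
    refine (Function.update_of_ne ?_ _ _).trans (h.raw p hp)
    unfold tabAddr
    omega
  tab T' i' k' j' := by
    subst hq hab
    simp only [St.setTab, Function.update_apply]
    by_cases he : T' = T ∧ i' = i ∧ k' = k ∧ j' = j
    · obtain ⟨rfl, rfl, rfl, rfl⟩ := he
      simp
    · rw [if_neg he, if_neg fun h' => he (tabAddr_inj h'), h.tab]

end Encodes

lemma Op.code_isLine (o : Op) : ∀ i ∈ o.code, i.IsLine := by
  cases o <;> simp [Op.code, tabAddrCode, Instr.IsLine]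

lemma Op.length_code_le (o : Op) : o.code.length ≤ 13 := by
  cases o <;> simp [Op.code, tabAddrCode]

lemma foldl_tabAddrCode {n : ℕ} {σ : St} {c : Config} (h : Encodes n σ c) (T : Tab) (i k j : Loc) :
    ((tabAddrCode T i k j).foldl lineStep c).reg 15 =
        tabAddr n T (σ.var i) (σ.var k) (σ.var j) ∧
      ((tabAddrCode T i k j).foldl lineStep c).mem = c.mem ∧
      ∀ r, r < 4 ∨ 20 ≤ r → ((tabAddrCode T i k j).foldl lineStep c).reg r = c.reg r := by
  have hne : ∀ (v : Loc) (a : ℕ), a < 20 → v.reg ≠ a := fun v a => Loc.reg_ne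
  refine ⟨?_, rfl, ?_⟩
  · simp [tabAddrCode, lineStep, hne, h.var, h.reg1, h.reg3, tabAddr, sqPair]
  · intro r hr
    have : ∀ a, 4 ≤ a → a < 16 → r ≠ a := by omega
    simp [tabAddrCode, lineStep, Function.update_apply, this]

lemma Op.foldl_code {n : ℕ} {σ : St} {c : Config} (h : Encodes n σ c) (o : Op) :
    Encodes n (o.exec n σ) (o.code.foldl lineStep c) ∧
      ∀ d, (o.code.foldl lineStep c).reg (counter d) = c.reg (counter d) := by
  have hne : ∀ (v : Loc) (a : ℕ), a < 20 → v.reg ≠ a := fun v a => Loc.reg_ne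
  have hcv : ∀ (d : ℕ) (v : Loc), counter d ≠ v.reg := fun d v => Loc.reg_ne_counter.symm
  have hc : ∀ d a : ℕ, a < 20 → counter d ≠ a := fun d a => counter_ne
  have hmin : ∀ a b : ℕ, a - (a - b) = min a b := fun a b => by omega
  cases o with
  | const d k => exact ⟨h.setVar d rfl, fun e => by simp [code, lineStep, hcv]⟩
  | inc d a => exact ⟨h.setVar d (by rw [h.var, h.reg3]), fun e => by simp [code, lineStep, hcv]⟩
  | copy d a =>
    exact ⟨h.setVar d (by rw [h.var, h.reg2, Nat.sub_zero]),
      fun e => by simp [code, lineStep, hcv]⟩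
  | sub d a b => exact ⟨h.setVar d (by rw [h.var, h.var]), fun e => by simp [code, lineStep, hcv]⟩
  | rd d p =>
    refine ⟨?_, fun e => by simp [code, lineStep, Function.update_apply, hcv, hc]⟩
    have h' : Encodes n σ ([Instr.sub 4 p.reg 1, .sub 4 p.reg 4].foldl lineStep c) := by
      refine h.congr ?_ ?_ ?_ ?_ ?_ rfl <;>
        simp [lineStep, hne]
    refine h'.setVar d ?_
    refine (h'.raw _ ?_).trans ?_
    · simp [lineStep, hne, h.var, h.reg1, hmin]
    · simp [lineStep, hne, h.var, h.reg1, hmin]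
  | wr p a =>
    refine ⟨?_, fun e => by simp [code, lineStep, Function.update_apply, hc]⟩
    have h' : Encodes n σ ([Instr.sub 4 p.reg 1, .sub 4 p.reg 4].foldl lineStep c) := by
      refine h.congr ?_ ?_ ?_ ?_ ?_ rfl <;>
        simp [lineStep, hne]
    refine h'.setRaw (min_le_right _ _) ?_ (h'.var a)
    simp [lineStep, hne, h.var, h.reg1, hmin]
  | ld d T i k j =>
    obtain ⟨h1, h2, h3⟩ := foldl_tabAddrCode h T i k j
    have h' : Encodes n σ ((tabAddrCode T i k j).foldl lineStep c) :=
      h.congr (h3 _ (by omega)) (h3 _ (by omega)) (h3 _ (by omega)) (h3 _ (by omega))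
        (fun v => h3 _ (.inr (by unfold Loc.reg; omega))) h2
    simp only [code, List.foldl_append, List.foldl_cons, List.foldl_nil]
    refine ⟨h'.setVar d (by rw [h1, h'.tab]), fun e => ?_⟩
    simp only [lineStep]
    rw [Function.update_of_ne (hcv e d), h3 _ (.inr (by unfold counter; omega))]
  | st T i k j a =>
    obtain ⟨h1, h2, h3⟩ := foldl_tabAddrCode h T i k j
    have h' : Encodes n σ ((tabAddrCode T i k j).foldl lineStep c) :=
      h.congr (h3 _ (by omega)) (h3 _ (by omega)) (h3 _ (by omega)) (h3 _ (by omega))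
        (fun v => h3 _ (.inr (by unfold Loc.reg; omega))) h2
    simp only [code, List.foldl_append, List.foldl_cons, List.foldl_nil]
    exact ⟨h'.setTab h1 (h'.var a), fun e => h3 _ (.inr (by unfold counter; omega))⟩

/-- Within `k` steps, the machine gets from `c` to a configuration that represents `σ`, at the
instruction `pc`, without a change of the counters of the `d` outermost loops. -/
def Reaches (P : Program) (n d k : ℕ) (c : Config) (pc : ℕ) (σ : St) : Prop :=
  ∃ t ≤ k, ((step P)^[t] c).pc = pc ∧ Encodes n σ ((step P)^[t] c) ∧
    ∀ e < d, ((step P)^[t] c).reg (counter e) = c.reg (counter e)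

lemma Reaches.refl {P : Program} {n d : ℕ} {c : Config} {σ : St} (h : Encodes n σ c) :
    Reaches P n d 0 c c.pc σ := ⟨0, le_rfl, rfl, h, fun _ _ => rfl⟩

lemma Reaches.trans {P : Program} {n d k k' : ℕ} {c : Config} {pc pc' : ℕ} {σ σ' : St}
    (h : Reaches P n d k c pc σ)
    (h' : ∀ c' : Config, c'.pc = pc → Encodes n σ c' →
      (∀ e < d, c'.reg (counter e) = c.reg (counter e)) → Reaches P n d k' c' pc' σ') :
    Reaches P n d (k + k') c pc' σ' := by
  obtain ⟨t, ht, h1, h2, h3⟩ := h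
  obtain ⟨t', ht', h1', h2', h3'⟩ := h' _ h1 h2 h3
  refine ⟨t' + t, by omega, ?_⟩
  rw [Function.iterate_add_apply]
  exact ⟨h1', h2', fun e he => (h3' e he).trans (h3 e he)⟩

lemma Reaches.step {P : Program} {n d k : ℕ} {c : Config} {pc : ℕ} {σ : St}
    (h : Reaches P n d k (step P c) pc σ)
    (hc : ∀ e < d, (_root_.step P c).reg (counter e) = c.reg (counter e)) :
    Reaches P n d (k + 1) c pc σ := by
  obtain ⟨t, ht, h1, h2, h3⟩ := h
  exact ⟨t + 1, by omega, by rwa [Function.iterate_succ_apply],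
    by rwa [Function.iterate_succ_apply], fun e he => by
      rw [Function.iterate_succ_apply, h3 e he, hc e he]⟩

lemma Reaches.mono {P : Program} {n d k k' : ℕ} {c : Config} {pc : ℕ} {σ : St}
    (h : Reaches P n d k c pc σ) (hk : k ≤ k') : Reaches P n d k' c pc σ := by
  obtain ⟨t, ht, h'⟩ := h
  exact ⟨t, ht.trans hk, h'⟩

/-- The jump at the end of a branch or of a loop body. -/
lemma Reaches.goto {P : Program} {n d off pc : ℕ} {c : Config} {σ : St} {l : List Instr}
    (hP : CodeAt P off (.jumpLT 2 3 pc :: l)) (hc : c.pc = off) (h : Encodes n σ c) :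
    Reaches P n d 1 c pc σ := by
  have hs : _root_.step P c = { c with pc := pc } := by
    rw [_root_.step, hc, hP.head]
    simp [h.reg2, h.reg3]
  exact ⟨1, le_rfl, by rw [Function.iterate_one, hs], by
    rw [Function.iterate_one, hs]
    exact h.congr rfl rfl rfl rfl (fun _ => rfl) rfl, fun e _ => by rw [Function.iterate_one, hs]⟩

/-- The machine code of a statement has the effect of the statement, within the given time. -/
theorem Stmt.reaches_code (P : Program) (n : ℕ) (s : Stmt) (off d : ℕ) (c : Config) (σ : St)
    (hP : CodeAt P off (s.code off d)) (hc : c.pc = off) (h : Encodes n σ c) :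
    Reaches P n d (s.cost n) c (off + s.size) (s.exec n σ) := by
  induction s generalizing off d c σ with
  | skip => exact hc ▸ Reaches.refl h
  | op o =>
    subst hc
    obtain ⟨h1, h2⟩ := o.foldl_code h
    refine ⟨o.code.length, o.length_code_le, ?_⟩
    rw [iterate_step_line o.code_isLine c hP]
    exact ⟨rfl, h1.congr rfl rfl rfl rfl (fun _ => rfl) rfl, fun e _ => h2 e⟩
  | seq s t ihs iht =>
    refine (ihs off d c σ hP.left hc h).trans fun c' hc' h' _ => ?_
    have := iht (off + s.size) d c' _ (hP.right (by rw [length_code])) hc' h'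
    rwa [add_assoc] at this
  | ite a b s t ihs iht =>
    simp only [code] at hP
    have hjump : _root_.step P c =
        { c with pc := if σ.var a < σ.var b then off + t.size + 2 else off + 1 } := by
      rw [_root_.step, hc, hP.head]
      simp [h.var]
    have h' : Encodes n σ (_root_.step P c) := by
      rw [hjump]
      exact h.congr rfl rfl rfl rfl (fun _ => rfl) rfl
    have hP2 := hP.tail.right (off' := off + t.size + 1) (by rw [length_code]; omega)
    simp only [exec, cost, size]
    by_cases hab : σ.var a < σ.var b
    · rw [if_pos hab]
      rw [if_pos hab] at hjump
      have := ihs (off + t.size + 2) d (_root_.step P c) σ hP2.tail (by rw [hjump]) h'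
      have e : off + t.size + 2 + s.size = off + (s.size + t.size + 2) := by omega
      rw [e] at this
      exact (Reaches.step this fun e _ => by rw [hjump]).mono (by omega)
    · rw [if_neg hab]
      rw [if_neg hab] at hjump
      have := iht (off + 1) d (_root_.step P c) σ hP.tail.left (by rw [hjump]) h'
      refine (Reaches.step (this.trans fun c' hc' h' _ => ?_) fun e _ => by rw [hjump]).mono
        (k := t.cost n + 1 + 1) (by omega)
      have e : off + (s.size + t.size + 2) = off + s.size + t.size + 2 := by omega
      rw [e]
      exact Reaches.goto hP2 (by rw [hc']; omega) h'
  | loop x s ih =>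
    simp only [code] at hP
    have hP1 := hP.tail
    have hP2 := hP1.tail
    have hP3 := hP2.tail
    have hP4 := hP3.tail
    have hP5 := hP4.right (off' := off + s.size + 4) (by rw [length_code]; omega)
    have hP6 := hP5.tail
    -- the loop from the test with the counter at `n - k`
    have main : ∀ k i (c : Config) (σ : St), i + k = n → c.pc = off + 1 → Encodes n σ c →
        c.reg (counter d) = i → Reaches P n d (2 + k * (s.cost n + 4)) c (off + s.size + 6)
          (Nat.rec (motive := fun _ => St) σ (fun i' τ => s.exec n (τ.setVar x (i + i'))) k) := by
      intro k
      induction k with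
      | zero =>
        intro i c σ hk hc h hi
        have hjump : _root_.step P c = { c with pc := off + 2 } := by
          rw [_root_.step, hc, hP1.head]
          simp [h.reg0, hi]
          omega
        refine (Reaches.step (k := 1) (Reaches.goto hP2 (by rw [hjump]) ?_)
          fun e _ => by rw [hjump]).mono (by omega)
        rw [hjump]
        exact h.congr rfl rfl rfl rfl (fun _ => rfl) rfl
      | succ k ihk =>
        intro i c σ hk hc h hi
        have hjump : _root_.step P c = { c with pc := off + 3 } := by
          rw [_root_.step, hc, hP1.head]
          simp [h.reg0, hi]
          omega
        have hset : _root_.step P (_root_.step P c) =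
            { c with pc := off + 4, reg := Function.update c.reg x.reg i } := by
          rw [hjump, _root_.step, hP3.head]
          simp [h.reg2, hi]
        have hr : Encodes n (σ.setVar x i) (_root_.step P (_root_.step P c)) := by
          rw [hset]
          exact (h.setVar x rfl).congr rfl rfl rfl rfl (fun _ => rfl) rfl
        have hbody := ih (off + 4) (d + 1) _ _ hP4.left (by rw [hset]) hr
        obtain ⟨t, ht, h1, h2, h3⟩ := hbody
        set c₁ := (_root_.step P)^[t] (_root_.step P (_root_.step P c)) with hc₁
        have hinc : _root_.step P c₁ = { c₁ with
            pc := off + s.size + 5,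
            reg := Function.update c₁.reg (counter d) (i + 1) } := by
          have e : off + 4 + s.size = off + s.size + 4 := by omega
          rw [_root_.step, h1, e, hP5.head]
          simp only [h2.reg3, h3 d (by omega)]
          rw [hset]
          simp only [Function.update_of_ne (Loc.reg_ne_counter (v := x) (d := d)).symm, hi]
        have hne : ∀ a, a < 20 → a ≠ counter d := fun a ha => (counter_ne ha).symm
        have hr2 : Encodes n (s.exec n (σ.setVar x i)) (_root_.step P c₁) := by
          rw [hinc]
          refine h2.congr ?_ ?_ ?_ ?_ (fun v => ?_) rfl
          · exact Function.update_of_ne (hne _ (by norm_num)) _ _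
          · exact Function.update_of_ne (hne _ (by norm_num)) _ _
          · exact Function.update_of_ne (hne _ (by norm_num)) _ _
          · exact Function.update_of_ne (hne _ (by norm_num)) _ _
          · exact Function.update_of_ne Loc.reg_ne_counter _ _
        have hback : _root_.step P (_root_.step P c₁) =
            { _root_.step P c₁ with pc := off + 1 } := by
          have hpc : (_root_.step P c₁).pc = off + s.size + 4 + 1 := by rw [hinc]
          rw [_root_.step, hpc, hP6.head]
          simp [hr2.reg2, hr2.reg3]
        have hr3 : Encodes n (s.exec n (σ.setVar x i)) (_root_.step P (_root_.step P c₁)) := by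
          rw [hback]
          exact hr2.congr rfl rfl rfl rfl (fun _ => rfl) rfl
        obtain ⟨t', ht', g1, g2, g3⟩ := ihk (i + 1) _ _ (by omega) (by rw [hback]) hr3
          (by rw [hback, hinc]; exact Function.update_self _ _ _)
        refine ⟨t' + (2 + (t + 2)), ?_, ?_⟩
        · have : (k + 1) * (s.cost n + 4) = k * (s.cost n + 4) + (s.cost n + 4) := by ring
          omega
        have hrun : (_root_.step P)^[t' + (2 + (t + 2))] c =
            (_root_.step P)^[t'] (_root_.step P (_root_.step P c₁)) := by
          rw [Function.iterate_add_apply, Function.iterate_add_apply, Function.iterate_add_apply]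
          rfl
        rw [hrun]
        refine ⟨g1, ?_, fun e he => ?_⟩
        · have hstep : ∀ k : ℕ, (Nat.rec (motive := fun _ => St) σ
              (fun i' τ => s.exec n (τ.setVar x (i + i'))) (k + 1) : St) =
              Nat.rec (motive := fun _ => St) (s.exec n (σ.setVar x i))
                (fun i' τ => s.exec n (τ.setVar x (i + 1 + i'))) k := by
            intro k
            induction k with
            | zero => rfl
            | succ k ih =>
              have e : i + (k + 1) = i + 1 + k := by omega
              change s.exec n (St.setVar (Nat.rec (motive := fun _ => St) σ
                (fun i' τ => s.exec n (τ.setVar x (i + i'))) (k + 1)) x (i + (k + 1))) = _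
              rw [ih, e]
          rw [hstep]
          exact g2
        · rw [g3 e he, hback, hinc]
          simp only
          rw [Function.update_of_ne (fun h => (by omega : e ≠ d) (counter_inj.1 h)),
            h3 e (by omega), hset]
          simp only
          rw [Function.update_of_ne Loc.reg_ne_counter.symm]
    have hinit : _root_.step P c =
        { c with pc := off + 1, reg := Function.update c.reg (counter d) 0 } := by
      rw [_root_.step, hc, hP.head]
    have hne : ∀ a, a < 20 → a ≠ counter d := fun a ha => (counter_ne ha).symm
    have hr : Encodes n σ (_root_.step P c) := by
      rw [hinit]
      refine h.congr ?_ ?_ ?_ ?_ (fun v => ?_) rfl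
      · exact Function.update_of_ne (hne _ (by norm_num)) _ _
      · exact Function.update_of_ne (hne _ (by norm_num)) _ _
      · exact Function.update_of_ne (hne _ (by norm_num)) _ _
      · exact Function.update_of_ne (hne _ (by norm_num)) _ _
      · exact Function.update_of_ne Loc.reg_ne_counter _ _
    have := main n 0 _ _ (by omega) (by rw [hinit]) hr
      (by rw [hinit]; exact Function.update_self _ _ _)
    simp only [zero_add] at this
    refine (Reaches.step this fun e he => ?_).mono (by simp only [cost]; omega)
    rw [hinit]
    exact Function.update_of_ne (fun h => (by omega : e ≠ d) (counter_inj.1 h)) _ _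

/-! ### Word length and running time of translated programs -/

/-- The level of a register: if all words of the input and all constants are less than `W`, then the
contents of a register of level `e` will be less than `(W + t) ^ e` after `t` steps. -/
def level (r : ℕ) : ℕ :=
  [1, 4, 1, 1, 2, 4, 5, 6, 12, 13, 1, 14, 28, 29, 30, 31].getD r 1

lemma level_of_le {r : ℕ} (h : 16 ≤ r) : level r = 1 := by
  unfold level
  rw [List.getD_eq_default]
  simpa using h

lemma level_reg (v : Loc) : level v.reg = 1 := level_of_le (by unfold Loc.reg; omega)

lemma level_counter (d : ℕ) : level (counter d) = 1 := level_of_le (by unfold counter; omega)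

lemma level_bounds (r : ℕ) : 1 ≤ level r ∧ level r ≤ 31 := by
  by_cases h : 16 ≤ r
  · simp [level_of_le h]
  · have : r < 16 := by omega
    interval_cases r <;> simp [level]

/-- A condition on the levels of the registers of an instruction, with constants up to `k`, that makes
sure that the contents of the registers obey the bounds given by their levels. The register `R₃` may
only get the values zero and one, and every register may be increased by `R₃`. -/
def Instr.Safe (k : ℕ) : Instr → Prop
  | .const d c => c ≤ k ∧ (d = 3 → c ≤ 1)
  | .add d a b => d ≠ 3 ∧
      ((level a < level d ∧ level b < level d) ∨ (b = 3 ∧ level a ≤ level d))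
  | .sub d a _ => d ≠ 3 ∧ level a ≤ level d
  | .mul d a b => d ≠ 3 ∧ level a + level b ≤ level d
  | .load d _ => d ≠ 3
  | .store _ b => level b = 1
  | .jumpLT _ _ _ => True
  | .halt => True

lemma Instr.Safe.mono {k k' : ℕ} (h : k ≤ k') {i : Instr} (hi : i.Safe k) : i.Safe k' := by
  cases i <;> first | exact hi | exact ⟨hi.1.trans h, hi.2⟩

/-- The words of the configuration obey the bounds given by the levels of the registers; the memory has
level one. -/
structure Config.Bounded (c : Config) (W : ℕ) : Prop where
  reg : ∀ r, c.reg r < W ^ level r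
  reg3 : c.reg 3 ≤ 1
  mem : ∀ a, c.mem a < W

/-- Registers of level one grow by at most one in a step, whence the bounds remain valid with `W + 1`
instead of `W`. -/
lemma Config.Bounded.step {P : Program} {k W : ℕ} (hP : ∀ i ∈ P, i.Safe k) (hW : 2 ≤ W)
    (hk : k < W) {c : Config} (h : c.Bounded W) : (step P c).Bounded (W + 1) := by
  have mono : ∀ e, W ^ e ≤ (W + 1) ^ e := fun e => Nat.pow_le_pow_left (by omega) e
  have mono' : ∀ {e f}, e ≤ f → W ^ e ≤ W ^ f := fun h => Nat.pow_le_pow_right (by omega) h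
  have h0 : c.Bounded (W + 1) := ⟨fun r => (h.reg r).trans_le (mono _), h.reg3,
    fun a => (h.mem a).trans (by omega)⟩
  have hset : ∀ (d a pc : ℕ), a < (W + 1) ^ level d → (d = 3 → a ≤ 1) →
      Config.Bounded { c with pc := pc, reg := Function.update c.reg d a } (W + 1) := by
    intro d a pc ha h3
    refine ⟨fun r => ?_, ?_, h0.mem⟩
    · simp only [Function.update_apply]
      split_ifs with hr
      · exact hr ▸ ha
      · exact h0.reg r
    · simp only [Function.update_apply]
      split_ifs with hr
      · exact h3 hr.symm
      · exact h0.reg3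
  have hle : ∀ {a d}, a < W → a < (W + 1) ^ level d := by
    intro a d ha
    have h1 := (level_bounds d).1
    calc a < W := ha
      _ = W ^ 1 := (pow_one W).symm
      _ ≤ W ^ level d := mono' h1
      _ ≤ _ := mono _
  unfold _root_.step
  cases hi : P[c.pc]? with
  | none => exact h0
  | some i =>
    have hs := hP i (List.mem_of_getElem? hi)
    cases i with
    | const d a => exact hset _ _ _ (hle (by have := hs.1; omega)) hs.2
    | add d a b =>
      obtain ⟨hd, ⟨h1, h2⟩ | ⟨rfl, h1⟩⟩ := hs
      · refine hset _ _ _ ?_ fun h => (hd h).elim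
        refine lt_of_lt_of_le ?_ (mono _)
        obtain ⟨e, he⟩ : ∃ e, level d = e + 1 := ⟨level d - 1, by omega⟩
        have ha := (h.reg a).trans_le (mono' (show level a ≤ e by omega))
        have hb := (h.reg b).trans_le (mono' (show level b ≤ e by omega))
        have := Nat.mul_le_mul_left (W ^ e) hW
        rw [he, pow_succ]
        omega
      · refine hset _ _ _ ?_ fun h => (hd h).elim
        have ha := (h.reg a).trans_le (mono' h1)
        have hb := h.reg3
        have := Nat.pow_lt_pow_left (show W < W + 1 by omega)
          (show level d ≠ 0 by have := (level_bounds d).1; omega)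
        omega
    | sub d a b =>
      refine hset _ _ _ ?_ fun h => (hs.1 h).elim
      exact (Nat.sub_le _ _).trans_lt ((h.reg a).trans_le ((mono' hs.2).trans (mono _)))
    | mul d a b =>
      refine hset _ _ _ ?_ fun h => (hs.1 h).elim
      refine lt_of_lt_of_le ?_ ((mono' hs.2).trans (mono _))
      rw [pow_add]
      exact Nat.mul_lt_mul'' (h.reg a) (h.reg b)
    | load d a => exact hset _ _ _ (hle (h.mem _)) fun h => (hs h).elim
    | store a b =>
      refine ⟨h0.reg, h0.reg3, fun r => ?_⟩
      simp only [Function.update_apply]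
      split_ifs
      · have := h0.reg b
        rwa [show level b = 1 from hs, pow_one] at this
      · exact h0.mem r
    | jumpLT a b t => exact ⟨h0.reg, h0.reg3, h0.mem⟩
    | halt => exact h0

lemma Op.exists_safe (o : Op) : ∃ k, ∀ i ∈ o.code, i.Safe k := by
  have hne : ∀ v : Loc, v.reg ≠ 3 := fun v => Loc.reg_ne (by norm_num)
  have addr : ∀ T i k j, ∀ a ∈ tabAddrCode T i k j, a.Safe T.ctorIdx := by
    intro T i k j
    have h1 := level_reg i
    have h2 := level_reg k
    have h3 := level_reg j
    simp [tabAddrCode, Instr.Safe, h1, h2, h3]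
    simp [level]
  cases o with
  | const d c => exact ⟨c, by simp [code, Instr.Safe, hne]⟩
  | inc d a => exact ⟨0, by simp [code, Instr.Safe, hne, level_reg]⟩
  | copy d a => exact ⟨0, by simp [code, Instr.Safe, hne, level_reg]⟩
  | sub d a b => exact ⟨0, by simp [code, Instr.Safe, hne, level_reg]⟩
  | rd d p => exact ⟨0, by simp [code, Instr.Safe, hne, level_reg]; simp [level]⟩
  | wr p a => exact ⟨0, by simp [code, Instr.Safe, level_reg]; simp [level]⟩
  | ld d T i k j =>
    refine ⟨T.ctorIdx, fun a ha => ?_⟩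
    rcases List.mem_append.1 ha with ha | ha
    · exact addr T i k j a ha
    · rw [List.mem_singleton.1 ha]; exact hne d
  | st T i k j b =>
    refine ⟨T.ctorIdx, fun a ha => ?_⟩
    rcases List.mem_append.1 ha with ha | ha
    · exact addr T i k j a ha
    · rw [List.mem_singleton.1 ha]; exact level_reg b

lemma Stmt.exists_safe (s : Stmt) : ∃ k, ∀ off d, ∀ i ∈ s.code off d, i.Safe k := by
  induction s with
  | skip => exact ⟨0, by simp [code]⟩
  | op o =>
    obtain ⟨k, hk⟩ := o.exists_safe
    exact ⟨k, fun _ _ => hk⟩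
  | seq s t ihs iht =>
    obtain ⟨k, hk⟩ := ihs
    obtain ⟨l, hl⟩ := iht
    refine ⟨max k l, fun off d i hi => ?_⟩
    rcases List.mem_append.1 hi with hi | hi
    · exact (hk _ _ _ hi).mono (le_max_left _ _)
    · exact (hl _ _ _ hi).mono (le_max_right _ _)
  | ite a b s t ihs iht =>
    obtain ⟨k, hk⟩ := ihs
    obtain ⟨l, hl⟩ := iht
    refine ⟨max k l, fun off d i hi => ?_⟩
    simp only [code, List.mem_cons, List.mem_append] at hi
    rcases hi with rfl | hi | rfl | hi
    · trivial
    · exact (hl _ _ _ hi).mono (le_max_right _ _)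
    · trivial
    · exact (hk _ _ _ hi).mono (le_max_left _ _)
  | loop x s ih =>
    obtain ⟨k, hk⟩ := ih
    refine ⟨k, fun off d i hi => ?_⟩
    simp only [code, List.mem_cons, List.mem_append, List.not_mem_nil, or_false] at hi
    have hc : counter d ≠ 3 := counter_ne (by norm_num)
    rcases hi with rfl | rfl | rfl | rfl | hi | rfl | rfl
    · exact ⟨Nat.zero_le _, fun _ => Nat.zero_le _⟩
    · trivial
    · trivial
    · exact ⟨Loc.reg_ne (by norm_num), by rw [level_reg, level_counter]⟩
    · exact hk _ _ _ hi
    · exact ⟨hc, .inr ⟨rfl, le_rfl⟩⟩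
    · trivial

/-- The state at the start of a program: `n` is the length of the input, and the input cells hold the
input. -/
def St.init (α : List Var) : St where
  var := Function.update (fun _ => 0) .n α.length
  raw := fun i => α.getD i 0
  tab := fun _ _ _ _ => 0

/-- Set up the registers `R₁, R₂, R₃` and the variable `n`. -/
def prologue : List Instr :=
  [.const 3 1, .add 4 0 0, .add 5 4 4, .sub 1 5 2, .sub Loc.n.reg 0 2]

lemma iterate_prologue {P : Program} (hP : CodeAt P 0 prologue) (α : List Var) :
    ((step P)^[5] (initial α)).pc = 5 ∧
      Encodes α.length (St.init α) ((step P)^[5] (initial α)) := by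
  have h := iterate_step_line (P := P) (l := prologue) (by simp [prologue, Instr.IsLine])
    (initial α) hP
  have hlen : prologue.length = 5 := rfl
  rw [hlen] at h
  rw [h]
  have hne : ∀ (v : Loc) (a : ℕ), a < 20 → v.reg ≠ a := fun v a => Loc.reg_ne
  have hne' : ∀ (v : Loc) (a : ℕ), a < 20 → a ≠ v.reg := fun v a h => (Loc.reg_ne h).symm
  refine ⟨rfl, ?_, ?_, ?_, ?_, ?_, ?_, ?_⟩
  · simp [prologue, lineStep, initial, hne']
  · simp [prologue, lineStep, initial, hne']
    omega
  · simp [prologue, lineStep, initial, hne']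
  · simp [prologue, lineStep, initial, hne']
  · intro v
    simp [prologue, lineStep, initial, St.init, Function.update_apply, hne, Loc.reg_inj]
  · intro p _
    rfl
  · intro T i k j
    refine List.getD_eq_default _ _ ?_
    unfold tabAddr
    omega

lemma foldr_max_ge {α : List Var} {x : Var} (h : x ∈ α) : x ≤ α.foldr max 0 := by
  induction α with
  | nil => simp at h
  | cons a α ih =>
    rcases List.mem_cons.1 h with rfl | h
    · exact le_max_left _ _
    · exact (ih h).trans (le_max_right _ _)

/-- A program of nesting depth at most seven runs in time `O(n ^ 7)` with words of logarithmic
length. -/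
theorem Stmt.exists_program (s : Stmt) (hs : s.depth ≤ 7) :
    ∃ (P : Program) (C : ℕ), ∀ α : List Var, α ≠ [] → ∃ t, t ≤ C * α.length ^ 7 ∧
      Halted P (runFor P α t) ∧ (∀ t' ≤ t, (runFor P α t').FitsIn (wordLength C α)) ∧
      (runFor P α t).reg 0 = (s.exec α.length (St.init α)).var .ans ∧
      ∀ p ≤ 4 * α.length, (runFor P α t).mem p = (s.exec α.length (St.init α)).raw p := by
  obtain ⟨K, hK⟩ := s.exists_cost_le
  obtain ⟨k₀, hk₀⟩ := s.exists_safe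
  let P : Program := prologue ++ s.code 5 0 ++ [.sub 0 Loc.ans.reg 2]
  let k := k₀ + 1
  have hsafe : ∀ i ∈ P, i.Safe k := by
    intro i hi
    rcases List.mem_append.1 hi with hi | hi
    · rcases List.mem_append.1 hi with hi | hi
      · have hne : Loc.n.reg ≠ 3 := Loc.reg_ne (by norm_num)
        have hn := level_reg .n
        have h0 : ∀ i ∈ prologue, i.Safe 1 := by
          simp [prologue, Instr.Safe, hne, hn]
          simp [level]
        exact (h0 i hi).mono (by omega)
      · exact (hk₀ _ _ _ hi).mono (by omega)
    · rw [List.mem_singleton.1 hi]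
      exact ⟨by norm_num, by rw [level_reg]; simp [level]⟩
  -- six steps are spent on the prologue and on the final copy of the answer to `R₀`
  let C := K + 6
  -- with `N = n + max α + 2`, the words of level one stay below `N ^ (8 + k + C)` for `C * n ^ 7` steps,
  -- and the highest level is 31
  let D := 31 * (8 + k + C)
  refine ⟨P, D, fun α hα => ?_⟩
  set n := α.length with hn
  have hn1 : 1 ≤ n := List.length_pos_of_ne_nil hα
  have hP1 : CodeAt P 0 prologue := ⟨[], s.code 5 0 ++ [.sub 0 Loc.ans.reg 2], by simp [P], rfl⟩
  have hP2 : CodeAt P 5 (s.code 5 0) := ⟨prologue, [.sub 0 Loc.ans.reg 2], rfl, rfl⟩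
  have hP3 : CodeAt P (5 + s.size) [.sub 0 Loc.ans.reg 2] :=
    ⟨prologue ++ s.code 5 0, [], by simp [P], by simp [length_code, prologue]; omega⟩
  obtain ⟨hpc, henc⟩ := iterate_prologue hP1 α
  obtain ⟨t, ht, h1, h2, -⟩ := s.reaches_code P n 5 0 _ _ hP2 hpc henc
  rw [← Function.iterate_add_apply] at h1 h2
  have hlast : runFor P α (t + 5 + 1) =
      { (step P)^[t + 5] (initial α) with
        pc := 5 + s.size + 1,
        reg := Function.update ((step P)^[t + 5] (initial α)).reg 0
          ((s.exec n (St.init α)).var .ans) } := by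
    rw [runFor, Function.iterate_succ_apply', step, h1, hP3.head]
    simp only [h2.var, h2.reg2, Nat.sub_zero]
  have htime : t + 5 + 1 ≤ C * n ^ 7 := by
    have h3 := hK n hn1
    have h4 : K * n ^ s.depth ≤ K * n ^ 7 :=
      Nat.mul_le_mul_left _ (Nat.pow_le_pow_right hn1 hs)
    have h5 := Nat.one_le_pow 7 n hn1
    simp only [C, add_mul]
    omega
  refine ⟨t + 5 + 1, htime.trans (Nat.mul_le_mul_right _ (by simp only [D]; omega)), ?_, ?_, ?_, ?_⟩
  · left
    rw [hlast]
    simp [P, length_code, prologue]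
    omega
  · intro t' ht'
    set N := n + α.foldr max 0 + 2 with hN
    have hbd : ∀ t, (runFor P α t).Bounded (N + k + t) := by
      intro t
      induction t with
      | zero =>
        refine ⟨fun r => ?_, ?_, fun a => ?_⟩
        · refine lt_of_lt_of_le ?_ (Nat.pow_le_pow_right (by omega) (level_bounds r).1)
          simp only [runFor, Function.iterate_zero, id, initial, Function.update_apply, pow_one]
          split_ifs <;> omega
        · simp [runFor, initial]
        · change α.getD a 0 < N + k
          by_cases ha : a < α.length
          · rw [List.getD_eq_getElem _ _ ha]
            exact Nat.lt_of_le_of_lt (foldr_max_ge (List.getElem_mem ha)) (by omega)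
          · rw [List.getD_eq_default _ _ (by omega)]
            exact (by omega : 0 < N + k)
      | succ t ih =>
        rw [runFor, Function.iterate_succ_apply']
        exact ih.step hsafe (by omega) (by omega)
    have hW : N + k + t' ≤ N ^ (8 + k + C) := by
      have hN2 : 2 ≤ N := by omega
      have h3 : N ≤ N ^ 7 := Nat.le_self_pow (by norm_num) N
      have h4 : n ^ 7 ≤ N ^ 7 := Nat.pow_le_pow_left (by omega) 7
      have h5 : C * n ^ 7 ≤ C * N ^ 7 := Nat.mul_le_mul_left _ h4
      have h6 : k * 1 ≤ k * N ^ 7 := Nat.mul_le_mul_left _ (Nat.one_le_pow _ _ (by omega))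
      have h7 : 1 + k + C ≤ N ^ (1 + k + C) :=
        (Nat.lt_two_pow_self).le.trans (Nat.pow_le_pow_left hN2 _)
      calc N + k + t' ≤ (1 + k + C) * N ^ 7 := by rw [add_mul, add_mul]; omega
        _ ≤ N ^ (1 + k + C) * N ^ 7 := Nat.mul_le_mul_right _ h7
        _ = N ^ (8 + k + C) := by rw [← pow_add]; congr 1; omega
    have hfit : ∀ e, e ≤ 31 → (N + k + t') ^ e ≤ 2 ^ wordLength D α := by
      intro e he
      calc (N + k + t') ^ e ≤ (N + k + t') ^ 31 := Nat.pow_le_pow_right (by omega) he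
        _ ≤ (N ^ (8 + k + C)) ^ 31 := Nat.pow_le_pow_left hW 31
        _ = N ^ D := by rw [← pow_mul]; congr 1; simp only [D]; ring
        _ ≤ (2 ^ Nat.clog 2 N) ^ D := Nat.pow_le_pow_left (Nat.le_pow_clog (by norm_num) N) D
        _ = 2 ^ wordLength D α := by rw [← pow_mul, wordLength, mul_comm]
    refine ⟨fun r => ((hbd t').reg r).trans_le (hfit _ (level_bounds r).2), fun a => ?_⟩
    have := hfit 1 (by norm_num)
    rw [pow_one] at this
    exact ((hbd t').mem a).trans_le this
  · rw [hlast]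
    simp
  · intro p hp
    rw [hlast]
    exact h2.raw p hp

/-! ### Factors of a word -/

/-- The factor of `α` from position `i` (included) to position `j` (excluded). -/
def seg (α : List Var) (i j : ℕ) : List Var := (α.take j).drop i

section seg

variable {α : List Var} {i j k p q : ℕ}

lemma length_seg (hj : j ≤ α.length) : (seg α i j).length = j - i := by
  simp [seg, hj]

lemma seg_append (hik : i ≤ k) (hkj : k ≤ j) : seg α i k ++ seg α k j = seg α i j := by
  unfold seg
  have h : α.take k = (α.take j).take k := by rw [List.take_take, min_eq_left hkj]
  rw [h]
  generalize α.take j = β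
  by_cases hk : k ≤ β.length
  · have h2 : β.drop i = (β.take k ++ β.drop k).drop i := by rw [List.take_append_drop]
    rw [h2, List.drop_append_of_le_length]
    rw [List.length_take]
    omega
  · rw [List.take_of_length_le (by omega), List.drop_eq_nil_of_le (as := β) (i := k) (by omega),
      List.append_nil]

lemma seg_zero_length : seg α 0 α.length = α := by simp [seg]

lemma seg_succ (hi : i < α.length) : seg α i (i + 1) = [α.getD i 0] := by
  rw [List.getD_eq_getElem _ _ hi]
  unfold seg
  rw [List.take_add_one, List.getElem?_eq_getElem hi, List.drop_append_of_le_length]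
  · simp
  · rw [List.length_take]; omega

lemma mem_seg {a : Var} (hj : j ≤ α.length) :
    a ∈ seg α i j ↔ ∃ p, i ≤ p ∧ p < j ∧ α.getD p 0 = a := by
  rw [List.mem_iff_getElem]
  constructor
  · rintro ⟨m, hm, rfl⟩
    have hm' := hm
    rw [length_seg hj] at hm'
    refine ⟨i + m, by omega, by omega, ?_⟩
    rw [List.getD_eq_getElem _ _ (by omega)]
    simp [seg]
  · rintro ⟨p, h1, h2, rfl⟩
    refine ⟨p - i, by rw [length_seg hj]; omega, ?_⟩
    rw [List.getD_eq_getElem _ _ (by omega)]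
    simp [seg, h1]

lemma seg_eq_seg_iff {i' j' k' : ℕ} (hik : i ≤ k) (hkj : k ≤ j) (hj : j ≤ α.length)
    (hik' : i' ≤ k') (hkj' : k' ≤ j') (hj' : j' ≤ α.length) (hl : k - i = k' - i') :
    seg α i j = seg α i' j' ↔ seg α i k = seg α i' k' ∧ seg α k j = seg α k' j' := by
  rw [← seg_append hik hkj, ← seg_append hik' hkj']
  refine ⟨fun h => List.append_inj h ?_, fun h => by rw [h.1, h.2]⟩
  rw [length_seg (by omega), length_seg (by omega), hl]

lemma length_eq_of_seg_eq {i' j' : ℕ} (hj : j ≤ α.length) (hj' : j' ≤ α.length)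
    (h : seg α i j = seg α i' j') : j - i = j' - i' := by
  have := congrArg List.length h
  rwa [length_seg hj, length_seg hj'] at this

lemma seg_of_append {u v : List Var} (hj : j ≤ α.length) (hij : i ≤ j) (h : seg α i j = u ++ v) :
    i + u.length ≤ j ∧ seg α i (i + u.length) = u ∧ seg α (i + u.length) j = v := by
  have hl := congrArg List.length h
  rw [length_seg hj, List.length_append] at hl
  have hle : i + u.length ≤ j := by omega
  rw [← seg_append (Nat.le_add_right i u.length) hle] at h
  obtain ⟨h1, h2⟩ := List.append_inj h (by rw [length_seg (by omega)]; omega)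
  exact ⟨hle, h1, h2⟩

end seg

/-! ### Labels of factors -/

section label

open Classical in
/-- The first position at which the factor of `α` from `i` to `j` occurs. -/
noncomputable def firstOcc (α : List Var) (i j : ℕ) : ℕ :=
  if h : ∃ p, seg α p (p + (j - i)) = seg α i j then Nat.find h else 0

/-- The label of the factor of `α` from `i` to `j`: a factor of length one is its own label, and the
label of a longer one is larger than all letters and encodes the positions of the first and the last
letter of its first occurrence, as a number with two digits in base `α.length`. -/
noncomputable def factorLabel (α : List Var) (i j : ℕ) : ℕ :=
  if j ≤ i + 1 then α.getD i 0
  else α.foldr max 0 + 1 + firstOcc α i j * α.length + (firstOcc α i j + (j - i) - 1)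

variable {α : List Var} {i j : ℕ}

lemma firstOcc_spec (hij : i ≤ j) : seg α (firstOcc α i j) (firstOcc α i j + (j - i)) = seg α i j ∧
    firstOcc α i j ≤ i ∧ ∀ p, seg α p (p + (j - i)) = seg α i j → firstOcc α i j ≤ p := by
  classical
  have hi : seg α i (i + (j - i)) = seg α i j := by rw [Nat.add_sub_cancel' hij]
  have h : ∃ p, seg α p (p + (j - i)) = seg α i j := ⟨i, hi⟩
  have he : firstOcc α i j = Nat.find h := by rw [firstOcc, dif_pos h]
  rw [he]
  exact ⟨Nat.find_spec h, Nat.find_min' h hi, fun p hp => Nat.find_min' h hp⟩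

lemma firstOcc_congr {i' j' : ℕ} (hl : j - i = j' - i') (h : seg α i j = seg α i' j') :
    firstOcc α i j = firstOcc α i' j' := by
  unfold firstOcc
  rw [hl, h]

lemma factorLabel_eq_iff {i' j' : ℕ} (hij : i < j) (hj : j ≤ α.length) (hij' : i' < j')
    (hj' : j' ≤ α.length) :
    factorLabel α i j = factorLabel α i' j' ↔ seg α i j = seg α i' j' := by
  have hlt : ∀ {i}, i < α.length → @LT.lt ℕ _ (α.getD i 0) (α.foldr max 0 + 1) := by
    intro i hi
    rw [List.getD_eq_getElem _ _ hi]
    exact Nat.lt_succ_of_le (foldr_max_ge (List.getElem_mem hi))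
  unfold factorLabel
  by_cases h1 : j ≤ i + 1 <;> by_cases h2 : j' ≤ i' + 1
  · obtain rfl : j = i + 1 := by omega
    obtain rfl : j' = i' + 1 := by omega
    rw [if_pos h1, if_pos h2, seg_succ (by omega), seg_succ (by omega), List.cons.injEq]
    simp
  · rw [if_pos h1, if_neg h2]
    have h := hlt (show i < α.length by omega)
    constructor
    · intro e
      rw [e] at h
      generalize firstOcc α i' j' * α.length = a at h
      omega
    · intro e
      have := length_eq_of_seg_eq hj hj' e
      omega
  · rw [if_neg h1, if_pos h2]
    have h := hlt (show i' < α.length by omega)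
    constructor
    · intro e
      rw [← e] at h
      generalize firstOcc α i j * α.length = a at h
      omega
    · intro e
      have := length_eq_of_seg_eq hj hj' e
      omega
  · rw [if_neg h1, if_neg h2]
    obtain ⟨g1, g2, -⟩ := firstOcc_spec (α := α) hij.le
    obtain ⟨g1', g2', -⟩ := firstOcc_spec (α := α) hij'.le
    constructor
    · intro e
      set f := firstOcc α i j
      set f' := firstOcc α i' j'
      have hn : 0 < α.length := by omega
      have e1 : α.length * f + (f + (j - i) - 1) = α.length * f' + (f' + (j' - i') - 1) := by
        rw [mul_comm, mul_comm α.length f']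
        omega
      have hf : f = f' := by
        have := congrArg (· / α.length) e1
        simpa [Nat.mul_add_div hn, Nat.div_eq_of_lt (show f + (j - i) - 1 < α.length by omega),
          Nat.div_eq_of_lt (show f' + (j' - i') - 1 < α.length by omega)] using this
      rw [hf] at e1
      have hl : j - i = j' - i' := by omega
      rw [← g1, ← g1', hf, hl]
    · intro e
      have hl := length_eq_of_seg_eq hj hj' e
      rw [firstOcc_congr hl e, hl]

end label

/-! ### Recursion for good bracketings -/

/-- The word has a good bracketing. -/
def WordGood (w : List Var) : Prop := ∃ b : BPat, b.flatten = w ∧ b.Good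

/-- There is a good bracketing of `u ++ v` with a bracketing of `u` and one of `v` as factors. -/
def SplitGood (u v : List Var) : Prop :=
  ∃ l r : BPat, l.flatten = u ∧ r.flatten = v ∧ (BPat.cat l r).Good

lemma SplitGood.left {u v : List Var} (h : SplitGood u v) : WordGood u := by
  obtain ⟨l, r, rfl, -, h⟩ := h
  exact ⟨l, rfl, h.1⟩

lemma WordGood.ne_nil {w : List Var} (h : WordGood w) : w ≠ [] := by
  obtain ⟨b, rfl, -⟩ := h
  exact b.flatten_ne_nil

/-- The cases of a good split of a word. If one factor of the bracketing is a factor of the other one,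
the bracketing of the latter determines that of the former. -/
lemma SplitGood.cases {u v : List Var} (h : SplitGood u v) :
    (WordGood u ∧ WordGood v ∧ u.Disjoint v) ∨ (u = v ∧ WordGood u) ∨
      (∃ y, v = u ++ y ∧ SplitGood u y) ∨ (∃ y, v = y ++ u ∧ SplitGood y u) ∨
      (∃ y, u = v ++ y ∧ SplitGood v y) ∨ ∃ y, u = y ++ v ∧ SplitGood y v := by
  obtain ⟨l, r, rfl, rfl, hl, hr, h⟩ := h
  rcases h with rfl | h | h | h
  · exact .inr (.inl ⟨rfl, l, rfl, hl⟩)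
  · cases r with
    | var => exact h.elim
    | cat a b =>
      rcases h with rfl | rfl
      · exact .inr (.inr (.inl ⟨_, rfl, a, b, rfl, rfl, hr⟩))
      · exact .inr (.inr (.inr (.inl ⟨_, rfl, a, b, rfl, rfl, hr⟩)))
  · cases l with
    | var => exact h.elim
    | cat a b =>
      rcases h with rfl | rfl
      · exact .inr (.inr (.inr (.inr (.inl ⟨_, rfl, a, b, rfl, rfl, hl⟩))))
      · exact .inr (.inr (.inr (.inr (.inr ⟨_, rfl, a, b, rfl, rfl, hl⟩))))
  · exact .inl ⟨⟨l, rfl, hl⟩, ⟨r, rfl, hr⟩, h⟩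

section intervals

variable (α : List Var)

/-- `SplitGood` for adjacent factors of `α`. -/
def SegGood (i k j : ℕ) : Prop := SplitGood (seg α i k) (seg α k j)

open Classical in
/-- The last position `m < b` at which the factor from `i` to `j` has a good split (zero if there is
none). -/
noncomputable def lastSplit (i j : ℕ) : ℕ → ℕ
  | 0 => 0
  | b + 1 => if i < b ∧ b < j ∧ SegGood α i b j then b else lastSplit i j b

/-- The position at which the algorithm splits the factor from `i` to `j`; zero for a single letter. -/
noncomputable def splitPos (i j : ℕ) : ℕ := lastSplit α i j α.length

/-- The factors have good bracketings and no common letter. -/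
def CaseDisjoint (i k j : ℕ) : Prop :=
  WordGood (seg α i k) ∧ WordGood (seg α k j) ∧ (seg α i k).Disjoint (seg α k j)

/-- The factors are equal and have a good bracketing. -/
def CaseEqual (i k j : ℕ) : Prop := seg α i k = seg α k j ∧ WordGood (seg α i k)

/-- The left factor is the left part of a good split of the right one. -/
def CaseRL (i k j : ℕ) : Prop :=
  k - i < j - k ∧ seg α i k = seg α k (k + (k - i)) ∧ SegGood α k (k + (k - i)) j

/-- The left factor is the right part of a good split of the right one. -/
def CaseRR (i k j : ℕ) : Prop :=
  k - i < j - k ∧ seg α i k = seg α (j - (k - i)) j ∧ SegGood α k (j - (k - i)) j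

/-- The right factor is the left part of a good split of the left one. -/
def CaseLL (i k j : ℕ) : Prop :=
  j - k < k - i ∧ seg α i (i + (j - k)) = seg α k j ∧ SegGood α i (i + (j - k)) k

/-- The right factor is the right part of a good split of the left one. -/
def CaseLR (i k j : ℕ) : Prop :=
  j - k < k - i ∧ seg α (k - (j - k)) k = seg α k j ∧ SegGood α i (k - (j - k)) k

open Classical in
/-- The positions at which the two factors of a good split are split further, where zero stands for a
leaf of the concatenation tree: a single letter, or a factor whose copy is expanded elsewhere. -/
noncomputable def childSplits (i k j : ℕ) : ℕ × ℕ :=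
  if CaseLR α i k j then (k - (j - k), 0)
  else if CaseLL α i k j then (i + (j - k), 0)
  else if CaseRR α i k j then (0, j - (k - i))
  else if CaseRL α i k j then (0, k + (k - i))
  else if CaseEqual α i k j then (splitPos α i k, 0)
  else (splitPos α i k, splitPos α k j)

variable {α} {i k j : ℕ}

lemma SegGood.cases (hik : i < k) (hkj : k < j) (hj : j ≤ α.length) (h : SegGood α i k j) :
    CaseDisjoint α i k j ∨ CaseEqual α i k j ∨ CaseRL α i k j ∨ CaseRR α i k j ∨
      CaseLL α i k j ∨ CaseLR α i k j := by
  have hlu := length_seg (i := i) (show k ≤ α.length by omega)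
  have hlv := length_seg (i := k) hj
  have pos : ∀ {y : List Var}, y ≠ [] → 0 < y.length := fun h => List.length_pos_of_ne_nil h
  have right : ∀ {u v : List Var}, SplitGood u v → v ≠ [] := by
    rintro u v ⟨l, r, -, rfl, -⟩
    exact r.flatten_ne_nil
  rcases SplitGood.cases h with h | h | ⟨y, he, h⟩ | ⟨y, he, h⟩ | ⟨y, he, h⟩ | ⟨y, he, h⟩
  · exact .inl h
  · exact .inr (.inl h)
  · refine .inr (.inr (.inl ?_))
    obtain ⟨h1, h2, h3⟩ := seg_of_append hj hkj.le he
    have := pos (right h)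
    have hl := congrArg List.length he
    rw [List.length_append] at hl
    rw [hlu] at h1 h2 h3
    refine ⟨by omega, h2.symm, ?_⟩
    unfold SegGood
    rwa [h2, h3]
  · refine .inr (.inr (.inr (.inl ?_)))
    obtain ⟨h1, h2, h3⟩ := seg_of_append hj hkj.le he
    have := pos h.left.ne_nil
    have hl := congrArg List.length he
    rw [List.length_append] at hl
    have e : k + y.length = j - (k - i) := by omega
    rw [e] at h2 h3
    refine ⟨by omega, h3.symm, ?_⟩
    unfold SegGood
    rwa [h2, h3]
  · refine .inr (.inr (.inr (.inr (.inl ?_))))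
    obtain ⟨h1, h2, h3⟩ := seg_of_append (by omega) hik.le he
    have := pos (right h)
    have hl := congrArg List.length he
    rw [List.length_append] at hl
    rw [hlv] at h1 h2 h3
    refine ⟨by omega, h2, ?_⟩
    unfold SegGood
    rwa [h2, h3]
  · refine .inr (.inr (.inr (.inr (.inr ?_))))
    obtain ⟨h1, h2, h3⟩ := seg_of_append (by omega) hik.le he
    have := pos h.left.ne_nil
    have hl := congrArg List.length he
    rw [List.length_append] at hl
    have e : i + y.length = k - (j - k) := by omega
    rw [e] at h2 h3
    refine ⟨by omega, h3, ?_⟩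
    unfold SegGood
    rwa [h2, h3]

lemma lastSplit_spec {b m : ℕ} (hm : m < b) (h : i < m ∧ m < j ∧ SegGood α i m j) :
    i < lastSplit α i j b ∧ lastSplit α i j b < j ∧ SegGood α i (lastSplit α i j b) j := by
  induction b with
  | zero => omega
  | succ b ih =>
    rw [lastSplit]
    split_ifs with hb
    · exact hb
    · refine ih ?_
      rcases Nat.lt_succ_iff_lt_or_eq.1 hm with h' | rfl
      · exact h'
      · exact (hb h).elim

lemma splitPos_succ (i : ℕ) : splitPos α i (i + 1) = 0 := by
  have : ∀ b, lastSplit α i (i + 1) b = 0 := by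
    intro b
    induction b with
    | zero => rfl
    | succ b ih => rw [lastSplit, if_neg (by omega), ih]
  exact this _

lemma exists_segGood (hij : i + 1 < j) (hj : j ≤ α.length) (h : WordGood (seg α i j)) :
    ∃ k, i < k ∧ k < j ∧ SegGood α i k j := by
  obtain ⟨b, hb, hg⟩ := h
  have hl := congrArg List.length hb
  rw [length_seg hj] at hl
  cases b with
  | var x => simp [BPat.flatten] at hl; omega
  | cat l r =>
    obtain ⟨h1, h2, h3⟩ := seg_of_append hj (by omega) hb.symm
    have := List.length_pos_of_ne_nil l.flatten_ne_nil
    have := List.length_pos_of_ne_nil r.flatten_ne_nil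
    simp only [BPat.flatten, List.length_append] at hl
    exact ⟨i + l.flatten.length, by omega, by omega, l, r, h2.symm, h3.symm, hg⟩

/-- `Emits α wl i k j T`: the algorithm emits the tree `T` for the factor from `i` to `j`, split at
position `k` or taken as a leaf if `k = 0`. The word `w` has the label `wl w`. -/
inductive Emits (α : List Var) (wl : List Var → Var) : ℕ → ℕ → ℕ → LTree → Prop
  | leaf {i j : ℕ} (hij : i < j) (hj : j ≤ α.length) : Emits α wl i 0 j (.leaf (wl (seg α i j)))
  | node {i k j : ℕ} {L R : LTree} (hik : i < k) (hkj : k < j) (hj : j ≤ α.length)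
      (h : SegGood α i k j) (hL : Emits α wl i (childSplits α i k j).1 k L)
      (hR : Emits α wl k (childSplits α i k j).2 j R) :
      Emits α wl i k j (.node (wl (seg α i j)) L R)

/-- The emitted tree is the pruned tree of a good bracketing. -/
lemma exists_emits (wl : List Var → Var) (m : ℕ) : ∀ i j, i < j → j ≤ α.length → j - i ≤ m →
    (WordGood (seg α i j) → ∃ b : BPat, b.flatten = seg α i j ∧ b.Good ∧
      Emits α wl i (splitPos α i j) j (b.concatTree fun s => wl s.flatten)) ∧
    ∀ k, i < k → k < j → SegGood α i k j → ∃ l r : BPat, l.flatten = seg α i k ∧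
      r.flatten = seg α k j ∧ (BPat.cat l r).Good ∧
      Emits α wl i k j ((BPat.cat l r).concatTree fun s => wl s.flatten) := by
  induction m with
  | zero => intro i j hij _ hm; omega
  | succ m ih =>
    intro i j hij hj hm
    have hsplit : ∀ k, i < k → k < j → SegGood α i k j → ∃ l r : BPat, l.flatten = seg α i k ∧
        r.flatten = seg α k j ∧ (BPat.cat l r).Good ∧
        Emits α wl i k j ((BPat.cat l r).concatTree fun s => wl s.flatten) := by
      intro k hik hkj h
      have hself : ∀ {t : BPat}, ¬ t.HasChild t := fun h => absurd h.len_lt (lt_irrefl _)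
      have hasymm : ∀ {s t : BPat}, s.HasChild t → ¬ t.HasChild s := fun h h' => by
        have := h.len_lt
        have := h'.len_lt
        omega
      have hne : ∀ {s t : BPat}, s.HasChild t → s ≠ t := fun h e => hself (e ▸ h)
      have hjk : k ≤ α.length := by omega
      -- the code of the two children determines that of the node
      have fin : ∀ l r : BPat, l.flatten = seg α i k → r.flatten = seg α k j →
          (BPat.cat l r).Good →
          Emits α wl i (childSplits α i k j).1 k
            (if r.HasChild l then .leaf (wl l.flatten) else l.concatTree fun s => wl s.flatten) →
          Emits α wl k (childSplits α i k j).2 j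
            (if l = r ∨ l.HasChild r then .leaf (wl r.flatten)
              else r.concatTree fun s => wl s.flatten) →
          ∃ l r : BPat, l.flatten = seg α i k ∧ r.flatten = seg α k j ∧ (BPat.cat l r).Good ∧
            Emits α wl i k j ((BPat.cat l r).concatTree fun s => wl s.flatten) := by
        intro l r h1 h2 h3 h4 h5
        refine ⟨l, r, h1, h2, h3, ?_⟩
        have : (BPat.cat l r).flatten = seg α i j := by
          rw [BPat.flatten, h1, h2, seg_append hik.le hkj.le]
        rw [BPat.concatTree, this]
        exact .node hik hkj hj h h4 h5
      -- the left factor is a leaf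
      have finR : ∀ (l a b : BPat), l.flatten = seg α i k → (BPat.cat a b).flatten = seg α k j →
          (BPat.cat a b).Good → (BPat.cat a b).HasChild l → (childSplits α i k j).1 = 0 →
          Emits α wl k (childSplits α i k j).2 j
            ((BPat.cat a b).concatTree fun s => wl s.flatten) →
          ∃ l r : BPat, l.flatten = seg α i k ∧ r.flatten = seg α k j ∧ (BPat.cat l r).Good ∧
            Emits α wl i k j ((BPat.cat l r).concatTree fun s => wl s.flatten) := by
        intro l a b h1 h2 h3 h4 h5 h6
        refine fin l (.cat a b) h1 h2 ⟨h3.of_mem_subs h4.mem_subs, h3, .inr (.inl h4)⟩ ?_ ?_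
        · rw [if_pos h4, h5, h1]
          exact .leaf hik hjk
        · rwa [if_neg]
          rintro (h | h)
          · exact hne h4 h.symm
          · exact hasymm h4 h
      have finL : ∀ (a b r : BPat), (BPat.cat a b).flatten = seg α i k → r.flatten = seg α k j →
          (BPat.cat a b).Good → (BPat.cat a b).HasChild r → (childSplits α i k j).2 = 0 →
          Emits α wl i (childSplits α i k j).1 k
            ((BPat.cat a b).concatTree fun s => wl s.flatten) →
          ∃ l r : BPat, l.flatten = seg α i k ∧ r.flatten = seg α k j ∧ (BPat.cat l r).Good ∧
            Emits α wl i k j ((BPat.cat l r).concatTree fun s => wl s.flatten) := by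
        intro a b r h1 h2 h3 h4 h5 h6
        refine fin (.cat a b) r h1 h2 ⟨h3, h3.of_mem_subs h4.mem_subs, .inr (.inr (.inl h4))⟩ ?_ ?_
        · rwa [if_neg (hasymm h4)]
        · rw [if_pos (.inr h4), h5, h2]
          exact .leaf hkj hj
      have hcases := h.cases hik hkj hj
      by_cases c6 : CaseLR α i k j
      · have hc : childSplits α i k j = (k - (j - k), 0) := by rw [childSplits, if_pos c6]
        obtain ⟨d1, d2, d3⟩ := c6
        obtain ⟨a, b, h1, h2, h3, h4⟩ := (ih i k hik hjk (by omega)).2 _ (by omega) (by omega) d3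
        refine finL a b b ?_ (h2.trans d2) h3 (.inr rfl) (by rw [hc]) (by rwa [hc])
        rw [BPat.flatten, h1, h2, seg_append (by omega) (by omega)]
      by_cases c5 : CaseLL α i k j
      · have hc : childSplits α i k j = (i + (j - k), 0) := by
          rw [childSplits, if_neg c6, if_pos c5]
        obtain ⟨d1, d2, d3⟩ := c5
        obtain ⟨a, b, h1, h2, h3, h4⟩ := (ih i k hik hjk (by omega)).2 _ (by omega) (by omega) d3
        refine finL a b a ?_ (h1.trans d2) h3 (.inl rfl) (by rw [hc]) (by rwa [hc])
        rw [BPat.flatten, h1, h2, seg_append (by omega) (by omega)]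
      by_cases c4 : CaseRR α i k j
      · have hc : childSplits α i k j = (0, j - (k - i)) := by
          rw [childSplits, if_neg c6, if_neg c5, if_pos c4]
        obtain ⟨d1, d2, d3⟩ := c4
        obtain ⟨a, b, h1, h2, h3, h4⟩ := (ih k j hkj hj (by omega)).2 _ (by omega) (by omega) d3
        refine finR b a b (h2.trans d2.symm) ?_ h3 (.inr rfl) (by rw [hc]) (by rwa [hc])
        rw [BPat.flatten, h1, h2, seg_append (by omega) (by omega)]
      by_cases c3 : CaseRL α i k j
      · have hc : childSplits α i k j = (0, k + (k - i)) := by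
          rw [childSplits, if_neg c6, if_neg c5, if_neg c4, if_pos c3]
        obtain ⟨d1, d2, d3⟩ := c3
        obtain ⟨a, b, h1, h2, h3, h4⟩ := (ih k j hkj hj (by omega)).2 _ (by omega) (by omega) d3
        refine finR a a b (h1.trans d2.symm) ?_ h3 (.inl rfl) (by rw [hc]) (by rwa [hc])
        rw [BPat.flatten, h1, h2, seg_append (by omega) (by omega)]
      by_cases c2 : CaseEqual α i k j
      · have hc : childSplits α i k j = (splitPos α i k, 0) := by
          rw [childSplits, if_neg c6, if_neg c5, if_neg c4, if_neg c3, if_pos c2]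
        obtain ⟨b, h1, h2, h3⟩ := (ih i k hik hjk (by omega)).1 c2.2
        refine fin b b h1 (h1.trans c2.1) ⟨h2, h2, .inl rfl⟩ ?_ ?_
        · rwa [if_neg hself, hc]
        · rw [if_pos (.inl rfl), h1, c2.1, hc]
          exact .leaf hkj hj
      · have hc : childSplits α i k j = (splitPos α i k, splitPos α k j) := by
          rw [childSplits, if_neg c6, if_neg c5, if_neg c4, if_neg c3, if_neg c2]
        obtain ⟨c1, c1', hd⟩ : CaseDisjoint α i k j := by tauto
        obtain ⟨a, h1, h2, h3⟩ := (ih i k hik hjk (by omega)).1 c1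
        obtain ⟨b, g1, g2, g3⟩ := (ih k j hkj hj (by omega)).1 c1'
        have hnd : ∀ {x}, x ∈ a.subs → x ∈ b.subs → False := fun ha hb =>
          BPat.not_disjoint_of_mem_subs ha hb (by rwa [h1, g1])
        refine fin a b h1 g1 ⟨h2, g2, .inr (.inr (.inr (by rwa [h1, g1])))⟩ ?_ ?_
        · rwa [if_neg fun h => hnd a.self_mem_subs h.mem_subs, hc]
        · rwa [if_neg, hc]
          rintro (rfl | h)
          · exact hnd a.self_mem_subs a.self_mem_subs
          · exact hnd h.mem_subs b.self_mem_subs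
    refine ⟨fun h => ?_, hsplit⟩
    by_cases hl : i + 1 < j
    · obtain ⟨k, hk⟩ := exists_segGood hl hj h
      obtain ⟨s1, s2, s3⟩ := lastSplit_spec (b := α.length) (by omega) hk
      obtain ⟨l, r, h1, h2, h3, h4⟩ := hsplit _ s1 s2 s3
      exact ⟨.cat l r, by rw [BPat.flatten, h1, h2, seg_append s1.le s2.le], h3, h4⟩
    · obtain rfl : j = i + 1 := by omega
      rw [splitPos_succ]
      refine ⟨.var (α.getD i 0), (seg_succ (by omega)).symm, trivial, ?_⟩
      have e : (BPat.var (α.getD i 0)).flatten = seg α i (i + 1) := (seg_succ (by omega)).symm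
      rw [BPat.concatTree, e]
      exact .leaf hij hj

/-- The conditions of the algorithm are not only necessary but also sufficient. -/
lemma segGood_of_cases (hik : i < k) (hkj : k < j)
    (h : CaseDisjoint α i k j ∨ CaseEqual α i k j ∨ CaseRL α i k j ∨ CaseRR α i k j ∨
      CaseLL α i k j ∨ CaseLR α i k j) : SegGood α i k j := by
  have hflat : ∀ {i k j : ℕ} {a b : BPat}, i ≤ k → k ≤ j → a.flatten = seg α i k →
      b.flatten = seg α k j → (BPat.cat a b).flatten = seg α i j := by
    intro i k j a b h1 h2 h3 h4
    rw [BPat.flatten, h3, h4, seg_append h1 h2]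
  rcases h with ⟨⟨a, ha, ga⟩, ⟨b, hb, gb⟩, hd⟩ | ⟨he, a, ha, ga⟩ | ⟨h1, h2, a, b, ha, hb, g⟩ |
    ⟨h1, h2, a, b, ha, hb, g⟩ | ⟨h1, h2, a, b, ha, hb, g⟩ | ⟨h1, h2, a, b, ha, hb, g⟩
  · exact ⟨a, b, ha, hb, ga, gb, .inr (.inr (.inr (by rwa [ha, hb])))⟩
  · exact ⟨a, a, ha, ha.trans he, ga, ga, .inl rfl⟩
  · exact ⟨a, .cat a b, ha.trans h2.symm, hflat (by omega) (by omega) ha hb, g.1, g,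
      .inr (.inl (.inl rfl))⟩
  · exact ⟨b, .cat a b, hb.trans h2.symm, hflat (by omega) (by omega) ha hb, g.2.1, g,
      .inr (.inl (.inr rfl))⟩
  · exact ⟨.cat a b, a, hflat (by omega) (by omega) ha hb, ha.trans h2, g, g.1,
      .inr (.inr (.inl (.inl rfl)))⟩
  · exact ⟨.cat a b, b, hflat (by omega) (by omega) ha hb, hb.trans h2, g, g.2.1,
      .inr (.inr (.inl (.inr rfl)))⟩

end intervals

/-! ### Reasoning about programs -/

section stlemmas

variable (σ : St) (d v : Loc) (a p p' i k j i' k' j' : ℕ) (T T' : Tab)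

@[simp] lemma St.var_setVar : (σ.setVar d a).var v = if v = d then a else σ.var v := by
  simp [St.setVar, Function.update_apply]

@[simp] lemma St.raw_setVar : (σ.setVar d a).raw = σ.raw := rfl

@[simp] lemma St.tab_setVar : (σ.setVar d a).tab = σ.tab := rfl

@[simp] lemma St.var_setRaw : (σ.setRaw p a).var = σ.var := rfl

@[simp] lemma St.raw_setRaw : (σ.setRaw p a).raw p' = if p' = p then a else σ.raw p' := by
  simp [St.setRaw, Function.update_apply]

@[simp] lemma St.tab_setRaw : (σ.setRaw p a).tab = σ.tab := rfl

@[simp] lemma St.var_setTab : (σ.setTab T i k j a).var = σ.var := rfl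

@[simp] lemma St.raw_setTab : (σ.setTab T i k j a).raw = σ.raw := rfl

@[simp] lemma St.tab_setTab : (σ.setTab T i k j a).tab T' i' k' j' =
    if T' = T ∧ i' = i ∧ k' = k ∧ j' = j then a else σ.tab T' i' k' j' := rfl

end stlemmas

/-- Execute `s` if the values of `a` and `b` are equal. -/
def Stmt.ifEq (a b : Loc) (s : Stmt) : Stmt := .ite a b .skip (.ite b a .skip s)

lemma Stmt.exec_ifEq (n : ℕ) (a b : Loc) (s : Stmt) (σ : St) :
    (Stmt.ifEq a b s).exec n σ = if σ.var a = σ.var b then s.exec n σ else σ := by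
  simp only [ifEq, exec]
  split_ifs <;> first | rfl | omega

/-- The variables that are assigned a value. -/
def Op.writtenVars : Op → List Loc
  | .const d _ | .inc d _ | .copy d _ | .sub d _ _ | .rd d _ | .ld d _ _ _ _ => [d]
  | .wr _ _ | .st _ _ _ _ _ => []

/-- The tables that are written to. -/
def Op.writtenTabs : Op → List Tab
  | .st T _ _ _ _ => [T]
  | _ => []

/-- Whether an input and output cell is written to. -/
def Op.writesRaw : Op → Bool
  | .wr _ _ => true
  | _ => false

/-- The variables that are assigned a value, including the loop variables. -/
def Stmt.writtenVars : Stmt → List Loc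
  | .skip => []
  | .op o => o.writtenVars
  | .seq s t => s.writtenVars ++ t.writtenVars
  | .ite _ _ s t => s.writtenVars ++ t.writtenVars
  | .loop x s => x :: s.writtenVars

/-- The tables that are written to. -/
def Stmt.writtenTabs : Stmt → List Tab
  | .skip => []
  | .op o => o.writtenTabs
  | .seq s t => s.writtenTabs ++ t.writtenTabs
  | .ite _ _ s t => s.writtenTabs ++ t.writtenTabs
  | .loop _ s => s.writtenTabs

/-- Whether input and output cells are written to. -/
def Stmt.writesRaw : Stmt → Bool
  | .skip => false
  | .op o => o.writesRaw
  | .seq s t => s.writesRaw || t.writesRaw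
  | .ite _ _ s t => s.writesRaw || t.writesRaw
  | .loop _ s => s.writesRaw

/-- The states `σ` and `τ` agree on everything that `s` does not write. -/
structure Frame (s : Stmt) (σ τ : St) : Prop where
  var : ∀ v, v ∉ s.writtenVars → τ.var v = σ.var v
  tab : ∀ T, T ∉ s.writtenTabs → τ.tab T = σ.tab T
  raw : s.writesRaw = false → τ.raw = σ.raw

lemma Frame.refl (s : Stmt) (σ : St) : Frame s σ σ := ⟨fun _ _ => rfl, fun _ _ => rfl, fun _ => rfl⟩

lemma Frame.trans {s : Stmt} {σ τ υ : St} (h : Frame s σ τ) (h' : Frame s τ υ) : Frame s σ υ :=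
  ⟨fun v hv => (h'.var v hv).trans (h.var v hv), fun T hT => (h'.tab T hT).trans (h.tab T hT),
    fun hr => (h'.raw hr).trans (h.raw hr)⟩

/-- Induction along a loop. -/
lemma Stmt.loop_induct {n : ℕ} {x : Loc} {s : Stmt} {σ : St} (I : ℕ → St → Prop) (h0 : I 0 σ)
    (hs : ∀ m τ, m < n → I m τ → I (m + 1) (s.exec n (τ.setVar x m))) :
    I n ((Stmt.loop x s).exec n σ) := by
  have : ∀ m, m ≤ n → I m (Nat.rec (motive := fun _ => St) σ
      (fun i τ => s.exec n (τ.setVar x i)) m) := by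
    intro m
    induction m with
    | zero => intro _; exact h0
    | succ m ih => intro hm; exact hs m _ (by omega) (ih (by omega))
  exact this n le_rfl

lemma Stmt.frame (n : ℕ) (s : Stmt) (σ : St) : Frame s σ (s.exec n σ) := by
  induction s generalizing σ with
  | skip => exact Frame.refl _ _
  | op o =>
    cases o <;> refine ⟨fun v hv => ?_, fun T hT => ?_, fun hr => ?_⟩ <;>
      simp_all [exec, Op.exec, writtenVars, Op.writtenVars, writtenTabs, Op.writtenTabs, writesRaw,
        Op.writesRaw]
    funext i k j
    simp [hT]
  | seq s t ihs iht =>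
    have h1 := ihs σ
    have h2 := iht (s.exec n σ)
    refine ⟨fun v hv => ?_, fun T hT => ?_, fun hr => ?_⟩
    · simp only [writtenVars, List.mem_append, not_or] at hv
      exact (h2.var v hv.2).trans (h1.var v hv.1)
    · simp only [writtenTabs, List.mem_append, not_or] at hT
      exact (h2.tab T hT.2).trans (h1.tab T hT.1)
    · simp only [writesRaw, Bool.or_eq_false_iff] at hr
      exact (h2.raw hr.2).trans (h1.raw hr.1)
  | ite a b s t ihs iht =>
    have h1 := ihs σ
    have h2 := iht σ
    simp only [exec]
    refine ⟨fun v hv => ?_, fun T hT => ?_, fun hr => ?_⟩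
    · simp only [writtenVars, List.mem_append, not_or] at hv
      split_ifs
      · exact h1.var v hv.1
      · exact h2.var v hv.2
    · simp only [writtenTabs, List.mem_append, not_or] at hT
      split_ifs
      · exact h1.tab T hT.1
      · exact h2.tab T hT.2
    · simp only [writesRaw, Bool.or_eq_false_iff] at hr
      split_ifs
      · exact h1.raw hr.1
      · exact h2.raw hr.2
  | loop x s ih =>
    refine loop_induct (fun _ => Frame (.loop x s) σ) (Frame.refl _ _) fun m τ _ h => h.trans ?_
    have h1 := ih (τ.setVar x m)
    refine ⟨fun v hv => ?_, h1.tab, h1.raw⟩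
    simp only [writtenVars, List.mem_cons, not_or] at hv
    rw [h1.var v hv.2, St.var_setVar, if_neg hv.1]

/-- Induction along a loop, where everything that the loop does not write is known not to change. -/
lemma Stmt.loop_induct_frame {n : ℕ} {x : Loc} {s : Stmt} {σ : St} (I : ℕ → St → Prop)
    (h0 : I 0 σ) (hs : ∀ m τ, m < n → Frame (.loop x s) σ τ → I m τ →
      I (m + 1) (s.exec n (τ.setVar x m))) : I n ((Stmt.loop x s).exec n σ) := by
  refine (loop_induct (fun m τ => Frame (.loop x s) σ τ ∧ I m τ) ⟨Frame.refl _ _, h0⟩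
    fun m τ hm h => ⟨h.1.trans ?_, hs m τ hm h.1 h.2⟩).2
  have h1 := Stmt.frame n s (τ.setVar x m)
  refine ⟨fun v hv => ?_, h1.tab, h1.raw⟩
  simp only [writtenVars, List.mem_cons, not_or] at hv
  rw [h1.var v hv.2, St.var_setVar, if_neg hv.1]

/-! ### Computation of the labels -/

namespace Prog

/-- Find the greatest letter, and store the letters as labels of the factors of length one. -/
def letters : Stmt :=
  .loop .x (.op (.rd .v .x) ;; .ite .max .v (.op (.copy .max .v)) .skip ;; .op (.inc .y .x) ;;
    .op (.st .lab .x .zero .y .v))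

/-- Test whether the factor from `i` to `j = y + 1` also occurs at the position `p < i`, from `p` to `q`,
and copy the label if it does. Two factors are equal if they agree up to the last letter, which is
known from their labels, and in the last letter. As there is no addition, `q` is computed as
`n - (n - p - (j - i))`. -/
def matchStep : Stmt :=
  .ite .p .i
    (.op (.sub .u .j .i) ;;
      .op (.sub .q .n .p) ;; .op (.sub .q .q .u) ;; .op (.sub .q .n .q) ;; .op (.sub .r .q .one) ;;
      .op (.ld .u .lab .p .zero .r) ;; .op (.ld .v .lab .i .zero .y) ;;
      .ifEq .u .v
        (.op (.ld .u .lab .r .zero .q) ;; .op (.ld .v .lab .y .zero .j) ;;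
          .ifEq .u .v (.op (.ld .lab .lab .p .zero .q))))
    .skip

/-- Determine the label of the factor from `i` to `j = y + 1`; it is new, unless the factor has occurred
before. The counter `fresh` is increased in any case, so that its value depends only on `i` and `y`. -/
def labelStep : Stmt :=
  .op (.inc .j .y) ;; .op (.copy .lab .fresh) ;; .op (.inc .fresh .fresh) ;; .op (.inc .i' .i) ;;
    .ite .i' .j (.loop .p matchStep ;; .op (.st .lab .i .zero .j .lab)) .skip

/-- Store the labels of all factors in the table `lab`. -/
def labels : Stmt :=
  letters ;; .op (.inc .fresh .max) ;; .loop .i (.loop .y labelStep)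

end Prog

/-- The constants of a program have their values. -/
structure Ready (n : ℕ) (σ : St) : Prop where
  zero : σ.var .zero = 0
  one : σ.var .one = 1
  n : σ.var .n = n

lemma Ready.of_frame {n : ℕ} {s : Stmt} {σ τ : St} (h : Ready n σ) (hF : Frame s σ τ)
    (hs : .zero ∉ s.writtenVars ∧ .one ∉ s.writtenVars ∧ .n ∉ s.writtenVars) : Ready n τ :=
  ⟨(hF.var _ hs.1).trans h.zero, (hF.var _ hs.2.1).trans h.one, (hF.var _ hs.2.2).trans h.n⟩

variable {α : List Var}

lemma factorLabel_succ (α : List Var) (i : ℕ) : factorLabel α i (i + 1) = α.getD i 0 := by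
  rw [factorLabel, if_pos le_rfl]

lemma exec_letters {σ : St} (hσ : Ready α.length σ) (hmax : σ.var .max = 0)
    (hraw : ∀ p < α.length, σ.raw p = α.getD p 0) :
    (Prog.letters.exec α.length σ).var .max = α.foldr max 0 ∧
      ∀ i < α.length, (Prog.letters.exec α.length σ).tab .lab i 0 (i + 1) = α.getD i 0 := by
  have h := Stmt.loop_induct_frame (n := α.length) (x := .x) (σ := σ)
    (s := .op (.rd .v .x) ;; .ite .max .v (.op (.copy .max .v)) .skip ;; .op (.inc .y .x) ;;
      .op (.st .lab .x .zero .y .v))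
    (fun m τ => τ.var .max = (α.take m).foldr max 0 ∧
      ∀ i < m, τ.tab .lab i 0 (i + 1) = α.getD i 0)
    ⟨by simpa using hmax, by simp⟩ (by
      intro m τ hm hF ⟨h1, h2⟩
      have hz := (hσ.of_frame hF (by decide)).zero
      have hr : τ.raw m = α.getD m 0 := by rw [hF.raw rfl]; exact hraw m hm
      have hmin : min m (4 * α.length) = m := by omega
      have hfold : (α.take (m + 1)).foldr max 0 = max ((α.take m).foldr max 0) (α.getD m 0) := by
        have aux : ∀ (l : List ℕ) (a : ℕ), (l ++ [a]).foldr max 0 = max (l.foldr max 0) a := by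
          intro l a
          induction l with
          | nil => simp
          | cons b l ih => simp only [List.cons_append, List.foldr_cons, ih, max_assoc]
        rw [List.take_add_one, List.getElem?_eq_getElem hm, List.getD_eq_getElem _ _ hm]
        exact aux _ _
      rw [hfold]
      by_cases hlt : (α.take m).foldr max 0 < α.getD m 0
      · have hlt' := hlt
        rw [List.getD_eq_getElem?_getD] at hlt' hr
        constructor
        · simp [Stmt.exec, Op.exec, hmin, hr, h1, hlt', le_of_lt hlt']
        · intro i hi
          by_cases him : i = m
          · subst him
            simp [Stmt.exec, Op.exec, hmin, hr, h1, hlt', hz]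
          · simpa [Stmt.exec, Op.exec, hmin, hr, h1, hlt', him] using h2 i (by omega)
      · have hlt' := hlt
        rw [List.getD_eq_getElem?_getD] at hlt' hr
        constructor
        · simp [Stmt.exec, Op.exec, hmin, hr, h1, hlt', not_lt.1 hlt']
        · intro i hi
          by_cases him : i = m
          · subst him
            simp [Stmt.exec, Op.exec, hmin, hr, h1, hlt', hz]
          · simpa [Stmt.exec, Op.exec, hmin, hr, h1, hlt', him] using h2 i (by omega))
  rw [List.take_length] at h
  exact h

lemma exec_matchLoop {σ : St} {i y : ℕ} (hσ : Ready α.length σ) (hi : σ.var .i = i)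
    (hy : σ.var .y = y) (hj : σ.var .j = y + 1) (hiy : i < y) (hyn : y < α.length)
    (hT : ∀ i' j', i' < j' → j' ≤ α.length → (j' = i' + 1 ∨ i' < i ∨ (i' = i ∧ j' ≤ y)) →
      σ.tab .lab i' 0 j' = factorLabel α i' j') (hlab : σ.var .lab =
        α.foldr max 0 + 1 + i * α.length + y) :
    ((Stmt.loop .p Prog.matchStep).exec α.length σ).var .lab = factorLabel α i (y + 1) := by
  have h := Stmt.loop_induct_frame (n := α.length) (x := .p) (σ := σ) (s := Prog.matchStep)
    (fun m τ => ((∃ p < m, p < i ∧ seg α p (p + (y + 1 - i)) = seg α i (y + 1)) →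
        τ.var .lab = factorLabel α i (y + 1)) ∧
      ((¬ ∃ p < m, p < i ∧ seg α p (p + (y + 1 - i)) = seg α i (y + 1)) →
        τ.var .lab = σ.var .lab))
    ⟨by simp, by simp⟩ (by
      intro m τ hm hF ⟨h1, h2⟩
      have hR := hσ.of_frame hF (by decide)
      have hz := hR.zero
      have ho := hR.one
      have hn := hR.n
      have hi' := (hF.var .i (by decide)).trans hi
      have hy' := (hF.var .y (by decide)).trans hy
      have hj' := (hF.var .j (by decide)).trans hj
      have hT' := hF.tab .lab (by decide)
      -- the effect of one step
      have hstep : (Prog.matchStep.exec α.length (τ.setVar .p m)).var .lab =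
          if m < i ∧ seg α m (m + (y + 1 - i)) = seg α i (y + 1) then factorLabel α i (y + 1)
          else τ.var .lab := by
        by_cases hmi : m < i
        · have hq : α.length - (α.length - m - (y + 1 - i)) = m + (y + 1 - i) := by omega
          have hq1 : m + (y + 1 - i) - 1 = m + (y - i) := by omega
          have e1 : σ.tab .lab m 0 (m + (y - i)) = factorLabel α m (m + (y - i)) :=
            hT _ _ (by omega) (by omega) (by omega)
          have e2 : σ.tab .lab i 0 y = factorLabel α i y :=
            hT _ _ (by omega) (by omega) (by omega)
          have e3 : σ.tab .lab (m + (y - i)) 0 (m + (y + 1 - i)) =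
              factorLabel α (m + (y - i)) (m + (y + 1 - i)) :=
            hT _ _ (by omega) (by omega) (by omega)
          have e4 : σ.tab .lab y 0 (y + 1) = factorLabel α y (y + 1) :=
            hT _ _ (by omega) (by omega) (by omega)
          have e5 : σ.tab .lab m 0 (m + (y + 1 - i)) = factorLabel α m (m + (y + 1 - i)) :=
            hT _ _ (by omega) (by omega) (by omega)
          have hiff := seg_eq_seg_iff (α := α) (i := m) (k := m + (y - i)) (j := m + (y + 1 - i))
            (i' := i) (k' := y) (j' := y + 1) (by omega) (by omega) (by omega) (by omega) (by omega)
            (by omega) (by omega)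
          rw [← factorLabel_eq_iff (by omega) (by omega) (by omega) (by omega),
            ← factorLabel_eq_iff (i := m) (i' := i) (by omega) (by omega) (by omega) (by omega),
            ← factorLabel_eq_iff (i' := y) (by omega) (by omega) (by omega) (by omega)] at hiff
          have hEq := factorLabel_eq_iff (α := α) (i := m) (j := m + (y + 1 - i)) (i' := i)
            (j' := y + 1) (by omega) (by omega) (by omega) (by omega)
          simp only [← hEq]
          simp [Prog.matchStep, Stmt.exec, Stmt.exec_ifEq, Op.exec, hz, ho, hn, hi', hy', hj', hT',
            hmi, hq, hq1, e1, e2]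
          by_cases c1 : factorLabel α m (m + (y - i)) = factorLabel α i y
          · by_cases c2 : factorLabel α (m + (y - i)) (m + (y + 1 - i)) = factorLabel α y (y + 1)
            · simp [c1, c2, e3, e4, e5, hiff]
            · simp [c1, c2, e3, e4, hiff]
          · simp [c1, hiff]
        · simp [Prog.matchStep, Stmt.exec, hi', hmi]
      rw [hstep]
      have hex : (∃ p < m + 1, p < i ∧ seg α p (p + (y + 1 - i)) = seg α i (y + 1)) ↔
          (∃ p < m, p < i ∧ seg α p (p + (y + 1 - i)) = seg α i (y + 1)) ∨
            (m < i ∧ seg α m (m + (y + 1 - i)) = seg α i (y + 1)) := by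
        constructor
        · rintro ⟨p, hp, hp'⟩
          rcases Nat.lt_succ_iff_lt_or_eq.1 hp with hp | rfl
          · exact .inl ⟨p, hp, hp'⟩
          · exact .inr hp'
        · rintro (⟨p, hp, hp'⟩ | hp')
          · exact ⟨p, by omega, hp'⟩
          · exact ⟨m, by omega, hp'⟩
      rw [hex]
      by_cases c : m < i ∧ seg α m (m + (y + 1 - i)) = seg α i (y + 1)
      · simp [c]
      · simp only [or_false, c]
        exact ⟨h1, h2⟩)
  obtain ⟨h1, h2⟩ := h
  by_cases c : ∃ p < α.length, p < i ∧ seg α p (p + (y + 1 - i)) = seg α i (y + 1)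
  · exact h1 c
  · rw [h2 c, hlab, factorLabel, if_neg (by omega)]
    -- the factor occurs at position `i` for the first time
    obtain ⟨f1, f2, -⟩ := firstOcc_spec (α := α) (i := i) (j := y + 1) (by omega)
    have hf : firstOcc α i (y + 1) = i := by
      by_contra hne
      exact c ⟨_, by omega, by omega, f1⟩
    rw [hf]
    omega

lemma exec_labelStep {σ : St} {i y : ℕ} (hσ : Ready α.length σ) (hi : σ.var .i = i)
    (hy : σ.var .y = y) (hyn : y < α.length)
    (hT : ∀ i' j', i' < j' → j' ≤ α.length → (j' = i' + 1 ∨ i' < i ∨ (i' = i ∧ j' ≤ y)) →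
      σ.tab .lab i' 0 j' = factorLabel α i' j') (hfr : σ.var .fresh =
        α.foldr max 0 + 1 + i * α.length + y) :
    (Prog.labelStep.exec α.length σ).var .fresh = α.foldr max 0 + 1 + i * α.length + (y + 1) ∧
    ∀ i' j', i' < j' → j' ≤ α.length → (j' = i' + 1 ∨ i' < i ∨ (i' = i ∧ j' ≤ y + 1)) →
      (Prog.labelStep.exec α.length σ).tab .lab i' 0 j' = factorLabel α i' j' := by
  set σ' := (((σ.setVar .j (y + 1)).setVar .lab (σ.var .fresh)).setVar .fresh
    (σ.var .fresh + 1)).setVar .i' (i + 1) with hσ'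
  have hexec : Prog.labelStep.exec α.length σ = if i + 1 < y + 1 then
      (Stmt.op (.st .lab .i .zero .j .lab)).exec α.length
        ((Stmt.loop .p Prog.matchStep).exec α.length σ') else σ' := by
    simp [Prog.labelStep, Stmt.exec, Op.exec, hi, hy, hσ']
  rw [hexec]
  by_cases hiy : i < y
  · rw [if_pos (by omega)]
    have hF := Stmt.frame α.length (Stmt.loop .p Prog.matchStep) σ'
    have hm := exec_matchLoop (α := α) (σ := σ') (i := i) (y := y)
      ⟨by simp [hσ', hσ.zero], by simp [hσ', hσ.one], by simp [hσ', hσ.n]⟩ (by simp [hσ', hi])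
      (by simp [hσ', hy]) (by simp [hσ']) hiy hyn (by simpa [hσ'] using hT) (by simp [hσ', hfr])
    generalize (Stmt.loop .p Prog.matchStep).exec α.length σ' = τ at hF hm
    have h1 : τ.var .fresh = σ.var .fresh + 1 := (hF.var .fresh (by decide)).trans (by simp [hσ'])
    have h2 : τ.var .i = i := (hF.var .i (by decide)).trans (by simp [hσ', hi])
    have h3 : τ.var .zero = 0 := (hF.var .zero (by decide)).trans (by simp [hσ', hσ.zero])
    have h4 : τ.var .j = y + 1 := (hF.var .j (by decide)).trans (by simp [hσ'])
    have h5 : τ.tab .lab = σ.tab .lab := (hF.tab .lab (by decide)).trans (by simp [hσ'])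
    constructor
    · simp [Stmt.exec, Op.exec, h1, hfr, add_assoc]
    · intro i' j' hij hj hc
      simp only [Stmt.exec, Op.exec, St.tab_setTab, h2, h3, h4, h5, hm, true_and]
      split_ifs with he
      · rw [he.1, he.2]
      · exact hT i' j' hij hj (by omega)
  · rw [if_neg (by omega)]
    constructor
    · simp [hσ', hfr, add_assoc]
    · intro i' j' hij hj hc
      simp only [hσ', St.tab_setVar]
      exact hT i' j' hij hj (by omega)

lemma exec_labels {σ : St} (hσ : Ready α.length σ) (hmax : σ.var .max = 0)
    (hraw : ∀ p < α.length, σ.raw p = α.getD p 0) :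
    ∀ i j, i < j → j ≤ α.length →
      (Prog.labels.exec α.length σ).tab .lab i 0 j = factorLabel α i j := by
  obtain ⟨h1, h2⟩ := exec_letters hσ hmax hraw
  have hF := Stmt.frame α.length Prog.letters σ
  have hR := hσ.of_frame hF (by decide)
  simp only [Prog.labels, Stmt.exec, Op.exec]
  generalize Prog.letters.exec α.length σ = σ₁ at h1 h2 hF hR
  rw [h1]
  set σ₂ := σ₁.setVar .fresh (α.foldr max 0 + 1) with hσ₂
  have hR2 : Ready α.length σ₂ :=
    ⟨by simp [hσ₂, hR.zero], by simp [hσ₂, hR.one], by simp [hσ₂, hR.n]⟩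
  have hmain := Stmt.loop_induct_frame (n := α.length) (x := .i) (σ := σ₂)
    (s := .loop .y Prog.labelStep)
    (fun m τ => τ.var .fresh = α.foldr max 0 + 1 + m * α.length ∧
      ∀ i j, i < j → j ≤ α.length → (j = i + 1 ∨ i < m) → τ.tab .lab i 0 j = factorLabel α i j)
    ⟨by simp [hσ₂], by
      intro i j hij hj hc
      obtain rfl : j = i + 1 := by omega
      rw [factorLabel_succ]
      exact h2 i (by omega)⟩ (by
      intro m τ hm hFτ ⟨g1, g2⟩
      have hRτ := hR2.of_frame hFτ (by decide)
      have hin := Stmt.loop_induct_frame (n := α.length) (x := .y) (σ := τ.setVar .i m)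
        (s := Prog.labelStep)
        (fun y υ => υ.var .fresh = α.foldr max 0 + 1 + m * α.length + y ∧
          ∀ i j, i < j → j ≤ α.length → (j = i + 1 ∨ i < m ∨ (i = m ∧ j ≤ y)) →
            υ.tab .lab i 0 j = factorLabel α i j)
        ⟨by simp [g1], by
          intro i j hij hj hc
          exact g2 i j hij hj (by omega)⟩ (by
          intro y υ hy hFυ ⟨k1, k2⟩
          have hRυ : Ready α.length υ := Ready.of_frame (σ := τ.setVar .i m)
            ⟨by simp [hRτ.zero], by simp [hRτ.one], by simp [hRτ.n]⟩ hFυ (by decide)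
          exact exec_labelStep ⟨by simp [hRυ.zero], by simp [hRυ.one], by simp [hRυ.n]⟩
            (by simp [hFυ.var .i (by decide)]) (by simp) hy (by simpa using k2) (by simp [k1]))
      refine ⟨hin.1.trans (by ring), fun i j hij hj hc => hin.2 i j hij hj (by omega)⟩)
  exact fun i j hij hj => hmain.2 i j hij hj (by omega)

/-! ### Computation of the splits -/

namespace Prog

/-- Set `w` to one if positions `p` of the left factor and `q` of the right one have the same
letter. -/
def compareStep : Stmt :=
  .ite .p .i .skip (.ite .p .k (.ite .q .k .skip (.ite .q .j
    (.op (.inc .r .p) ;; .op (.inc .s .q) ;; .op (.ld .u .lab .p .zero .r) ;;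
      .op (.ld .v .lab .q .zero .s) ;; .ifEq .u .v (.op (.const .w 1))) .skip)) .skip)

/-- Test whether the two factors have good bracketings and no common letter. -/
def caseDisjoint : Stmt :=
  .op (.ld .u .good .i .zero .k) ;; .ite .zero .u
    (.op (.ld .u .good .k .zero .j) ;; .ite .zero .u
      (.op (.const .w 0) ;; .loop .p (.loop .q compareStep) ;; .ite .zero .w .skip
        (.op (.const .ok 1) ;; .op (.ld .ls .split .i .zero .k) ;;
          .op (.ld .rs .split .k .zero .j))) .skip) .skip

/-- Test whether the two factors are equal and have a good bracketing. -/
def caseEqual : Stmt :=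
  .op (.ld .u .lab .i .zero .k) ;; .op (.ld .v .lab .k .zero .j) ;; .ifEq .u .v
    (.op (.ld .u .good .i .zero .k) ;; .ite .zero .u
      (.op (.const .ok 1) ;; .op (.ld .ls .split .i .zero .k) ;; .op (.const .rs 0)) .skip)

/-- If the factors from `a` to `b` and from `c` to `d` are equal and there is a good split of the
factor from `e` to `f` at `q`, then there is a good split with the given splits of its factors. -/
def caseMatch (a b c d e f l r : Loc) : Stmt :=
  .op (.ld .u .lab a .zero b) ;; .op (.ld .v .lab c .zero d) ;; .ifEq .u .v
    (.op (.ld .u .ok e .q f) ;; .ite .zero .u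
      (.op (.const .ok 1) ;; .op (.copy .ls l) ;; .op (.copy .rs r)) .skip)

/-- Test whether the left factor is the left part of a good split of the right one. -/
def caseRL : Stmt :=
  .op (.sub .s .k .i) ;; .op (.sub .t .j .k) ;; .ite .s .t
    (.op (.sub .q .n .k) ;; .op (.sub .q .q .s) ;; .op (.sub .q .n .q) ;;
      caseMatch .i .k .k .q .k .j .zero .q) .skip

/-- Test whether the left factor is the right part of a good split of the right one. -/
def caseRR : Stmt :=
  .op (.sub .s .k .i) ;; .op (.sub .t .j .k) ;; .ite .s .t
    (.op (.sub .q .j .s) ;; caseMatch .i .k .q .j .k .j .zero .q) .skip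

/-- Test whether the right factor is the left part of a good split of the left one. -/
def caseLL : Stmt :=
  .op (.sub .s .k .i) ;; .op (.sub .t .j .k) ;; .ite .t .s
    (.op (.sub .q .n .i) ;; .op (.sub .q .q .t) ;; .op (.sub .q .n .q) ;;
      caseMatch .i .q .k .j .i .k .q .zero) .skip

/-- Test whether the right factor is the right part of a good split of the left one. -/
def caseLR : Stmt :=
  .op (.sub .s .k .i) ;; .op (.sub .t .j .k) ;; .ite .t .s
    (.op (.sub .q .k .t) ;; caseMatch .q .k .k .j .i .k .q .zero) .skip

/-- Determine whether the factor from `i` to `j` has a good split at `k`. If several cases apply, the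
last one determines the splits `ls` and `rs` of the two parts. -/
def splitStep : Stmt :=
  .op (.const .ok 0) ;; caseDisjoint ;; caseEqual ;; caseRL ;; caseRR ;; caseLL ;; caseLR

/-- Determine the splits of the factor from `i` to `j`. -/
def splitLoop : Stmt :=
  .loop .k (.ite .i .k (.ite .k .j (splitStep ;; .op (.st .ok .i .k .j .ok) ;;
    .op (.st .ls .i .k .j .ls) ;; .op (.st .rs .i .k .j .rs) ;;
    .ite .zero .ok (.op (.const .good 1) ;; .op (.copy .split .k)) .skip) .skip) .skip)

/-- Fill the tables for the factor from `i` to `j = y + 1`. -/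
def tableStep : Stmt :=
  .op (.inc .j .y) ;; .ite .i .j (.op (.inc .i' .i) ;; .op (.const .good 0) ;;
    .op (.const .split 0) ;; .ite .i' .j .skip (.op (.const .good 1)) ;; splitLoop ;;
    .op (.st .good .i .zero .j .good) ;; .op (.st .split .i .zero .j .split)) .skip

/-- Fill the tables. The factors that begin farther to the right come first, and among those with the
same beginning the shorter ones, so that all proper factors of a factor precede it. -/
def tables : Stmt :=
  .loop .x (.op (.sub .i .n .one) ;; .op (.sub .i .i .x) ;; .loop .y tableStep)

end Prog

open Classical in
/-- The truth value of a proposition as a number. -/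
noncomputable def ind (p : Prop) : ℕ := if p then 1 else 0

@[simp] lemma ind_pos {p : Prop} : 0 < ind p ↔ p := by
  unfold ind
  split_ifs with h <;> simp [h]

@[simp] lemma ind_true : ind True = 1 := if_pos trivial

@[simp] lemma ind_false : ind False = 0 := if_neg not_false

lemma ind_of_true {p : Prop} (h : p) : ind p = 1 := if_pos h

lemma ind_of_false {p : Prop} (h : ¬ p) : ind p = 0 := if_neg h

/-- The tables are correct for the split at `k` of the factor from `i` to `j`. -/
structure Entry (α : List Var) (tab : Tab → ℕ → ℕ → ℕ → ℕ) (i k j : ℕ) : Prop where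
  ok : tab .ok i k j = ind (SegGood α i k j)
  ls : SegGood α i k j → tab .ls i k j = (childSplits α i k j).1
  rs : SegGood α i k j → tab .rs i k j = (childSplits α i k j).2

/-- The tables are correct for the factor from `i` to `j`. -/
structure Filled (α : List Var) (tab : Tab → ℕ → ℕ → ℕ → ℕ) (i j : ℕ) : Prop where
  good : tab .good i 0 j = ind (WordGood (seg α i j))
  split : tab .split i 0 j = splitPos α i j
  entry : ∀ k, i < k → k < j → Entry α tab i k j

lemma Filled.congr {α : List Var} {tab tab' : Tab → ℕ → ℕ → ℕ → ℕ} {i j : ℕ}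
    (h : Filled α tab i j) (ht : ∀ T k, tab' T i k j = tab T i k j) : Filled α tab' i j :=
  ⟨(ht _ _).trans h.good, (ht _ _).trans h.split, fun k h1 h2 =>
    ⟨(ht _ _).trans (h.entry k h1 h2).ok, fun hg => (ht _ _).trans ((h.entry k h1 h2).ls hg),
      fun hg => (ht _ _).trans ((h.entry k h1 h2).rs hg)⟩⟩

/-- The situation in which the split at `k` of the factor from `i` to `j` is examined. -/
structure SplitCtx (α : List Var) (i k j : ℕ) (σ : St) : Prop where
  ready : Ready α.length σ
  hik : i < k
  hkj : k < j
  hj : j ≤ α.length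
  var_i : σ.var .i = i
  var_k : σ.var .k = k
  var_j : σ.var .j = j
  lab : ∀ i j, i < j → j ≤ α.length → σ.tab .lab i 0 j = factorLabel α i j
  left : Filled α σ.tab i k
  right : Filled α σ.tab k j

lemma Stmt.tab_exec {n : ℕ} {s : Stmt} {σ : St} (h : s.writtenTabs = []) :
    (s.exec n σ).tab = σ.tab := by
  funext T
  exact (Stmt.frame n s σ).tab T (by simp [h])

lemma SplitCtx.exec {α : List Var} {i k j : ℕ} {σ : St} (h : SplitCtx α i k j σ) (s : Stmt)
    (hs : s.writtenTabs = []) (hv : (.zero ∉ s.writtenVars ∧ .one ∉ s.writtenVars ∧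
      .n ∉ s.writtenVars) ∧ .i ∉ s.writtenVars ∧ .k ∉ s.writtenVars ∧ .j ∉ s.writtenVars) :
    SplitCtx α i k j (s.exec α.length σ) := by
  have hF := Stmt.frame α.length s σ
  have ht : (s.exec α.length σ).tab = σ.tab := Stmt.tab_exec hs
  exact ⟨h.ready.of_frame hF hv.1, h.hik, h.hkj, h.hj, (hF.var _ hv.2.1).trans h.var_i,
    (hF.var _ hv.2.2.1).trans h.var_k, (hF.var _ hv.2.2.2).trans h.var_j, ht ▸ h.lab, ht ▸ h.left,
    ht ▸ h.right⟩

/-- The current knowledge about a split: whether a case that makes it good has been found, and the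
splits of the two factors in this case. -/
def Known (σ : St) (p : Prop) (c : ℕ × ℕ) : Prop :=
  σ.var .ok = ind p ∧ (p → σ.var .ls = c.1 ∧ σ.var .rs = c.2)

open Classical in
/-- The effect of the test of one more case `q`, which takes precedence over the previous cases. -/
lemma Known.override {σ τ : St} {p q : Prop} {c d : ℕ × ℕ} (h : Known σ p c)
    (h1 : q → τ.var .ok = 1 ∧ τ.var .ls = d.1 ∧ τ.var .rs = d.2)
    (h2 : ¬ q → τ.var .ok = σ.var .ok ∧ τ.var .ls = σ.var .ls ∧ τ.var .rs = σ.var .rs) :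
    Known τ (q ∨ p) (if q then d else c) := by
  by_cases hq : q
  · obtain ⟨a, b, e⟩ := h1 hq
    exact ⟨by rw [a, ind_of_true (.inl hq)], fun _ => by rw [if_pos hq]; exact ⟨b, e⟩⟩
  · obtain ⟨a, b, e⟩ := h2 hq
    rw [if_neg hq, show (q ∨ p) = p by simp [hq]]
    exact ⟨a.trans h.1, fun hp => ⟨b.trans (h.2 hp).1, e.trans (h.2 hp).2⟩⟩

section cases

variable {α : List Var} {i k j : ℕ} {σ : St}

lemma exec_compare (h : SplitCtx α i k j σ) (hw : σ.var .w = 0) :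
    0 < ((Stmt.loop .p (.loop .q Prog.compareStep)).exec α.length σ).var .w ↔
      ¬ (seg α i k).Disjoint (seg α k j) := by
  have hR := h.ready
  have hik := h.hik
  have hkj := h.hkj
  have hj := h.hj
  have key := Stmt.loop_induct_frame (n := α.length) (x := .p) (σ := σ)
    (s := .loop .q Prog.compareStep)
    (fun m τ => 0 < τ.var .w ↔ ∃ p q, p < m ∧ i ≤ p ∧ p < k ∧ k ≤ q ∧ q < j ∧
      α.getD p 0 = α.getD q 0) (by simp [hw]) (by
    intro p τ hp hF hτ
    have inner := Stmt.loop_induct_frame (n := α.length) (x := .q) (σ := τ.setVar .p p)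
      (s := Prog.compareStep)
      (fun m υ => 0 < υ.var .w ↔ (0 < τ.var .w ∨ ∃ q, q < m ∧ i ≤ p ∧ p < k ∧ k ≤ q ∧ q < j ∧
        α.getD p 0 = α.getD q 0)) (by simp) (by
      intro q υ hq hF' hυ
      have vp : υ.var .p = p := (hF'.var .p (by decide)).trans (by simp)
      have vi : υ.var .i = i :=
        (hF'.var .i (by decide)).trans ((hF.var .i (by decide)).trans h.var_i)
      have vk : υ.var .k = k :=
        (hF'.var .k (by decide)).trans ((hF.var .k (by decide)).trans h.var_k)
      have vj : υ.var .j = j :=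
        (hF'.var .j (by decide)).trans ((hF.var .j (by decide)).trans h.var_j)
      have vz : υ.var .zero = 0 :=
        (hF'.var .zero (by decide)).trans ((hF.var .zero (by decide)).trans hR.zero)
      have vt : υ.tab .lab = σ.tab .lab :=
        (hF'.tab .lab (by decide)).trans (hF.tab .lab (by decide))
      have e1 : σ.tab .lab p 0 (p + 1) = α.getD p 0 := by
        rw [h.lab _ _ (by omega) (by omega), factorLabel_succ]
      have e2 : σ.tab .lab q 0 (q + 1) = α.getD q 0 := by
        rw [h.lab _ _ (by omega) (by omega), factorLabel_succ]
      have hstep : 0 < (Prog.compareStep.exec α.length (υ.setVar .q q)).var .w ↔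
          0 < υ.var .w ∨ (i ≤ p ∧ p < k ∧ k ≤ q ∧ q < j ∧ α.getD p 0 = α.getD q 0) := by
        by_cases c1 : p < i
        · simp [Prog.compareStep, Stmt.exec, vp, vi, c1, not_le.2 c1]
        by_cases c2 : p < k
        swap
        · simp [Prog.compareStep, Stmt.exec, vp, vi, vk, c1, c2]
        by_cases c3 : q < k
        · simp [Prog.compareStep, Stmt.exec, vp, vi, vk, c1, c2, c3, not_le.2 c3]
        by_cases c4 : q < j
        swap
        · simp [Prog.compareStep, Stmt.exec, vp, vi, vk, vj, c1, c2, c3, c4]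
        by_cases c5 : α.getD p 0 = α.getD q 0
        · have c5' := c5
          rw [List.getD_eq_getElem?_getD, List.getD_eq_getElem?_getD] at c5'
          simp [Prog.compareStep, Stmt.exec, Stmt.exec_ifEq, Op.exec, vp, vi, vk, vj, vz, vt, c1, c2,
            c3, c4, c5', e1, e2, not_lt.1 c1, not_lt.1 c3]
        · have c5' := c5
          rw [List.getD_eq_getElem?_getD, List.getD_eq_getElem?_getD] at c5'
          simp [Prog.compareStep, Stmt.exec, Stmt.exec_ifEq, Op.exec, vp, vi, vk, vj, vz, vt, c1, c2,
            c3, c4, c5', e1, e2]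
      rw [hstep, hυ]
      constructor
      · rintro ((h | ⟨q', hq', h⟩) | h)
        · exact .inl h
        · exact .inr ⟨q', by omega, h⟩
        · exact .inr ⟨q, by omega, h⟩
      · rintro (h | ⟨q', hq', h⟩)
        · exact .inl (.inl h)
        · rcases Nat.lt_succ_iff_lt_or_eq.1 hq' with hq' | rfl
          · exact .inl (.inr ⟨q', hq', h⟩)
          · exact .inr h)
    refine inner.trans ?_
    rw [hτ]
    constructor
    · rintro (⟨p', q, hp', h⟩ | ⟨q, hq, h⟩)
      · exact ⟨p', q, by omega, h⟩
      · exact ⟨p, q, by omega, h⟩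
    · rintro ⟨p', q, hp', h⟩
      rcases Nat.lt_succ_iff_lt_or_eq.1 hp' with hp' | rfl
      · exact .inl ⟨p', q, hp', h⟩
      · exact .inr ⟨q, by omega, h⟩)
  refine key.trans ?_
  constructor
  · rintro ⟨p, q, -, h1, h2, h3, h4, h5⟩ hd
    exact hd ((mem_seg (by omega)).2 ⟨p, h1, h2, rfl⟩) ((mem_seg hj).2 ⟨q, h3, h4, h5.symm⟩)
  · intro hd
    by_contra hne
    refine hd fun a ha hb => hne ?_
    obtain ⟨p, h1, h2, h5⟩ := (mem_seg (by omega)).1 ha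
    obtain ⟨q, h3, h4, h6⟩ := (mem_seg hj).1 hb
    exact ⟨p, q, by omega, h1, h2, h3, h4, h5.trans h6.symm⟩

lemma exec_caseDisjoint (h : SplitCtx α i k j σ) (hσ : σ.var .ok = 0) :
    Known (Prog.caseDisjoint.exec α.length σ) (CaseDisjoint α i k j)
      (splitPos α i k, splitPos α k j) := by
  have hz := h.ready.zero
  by_cases c1 : WordGood (seg α i k)
  swap
  · have : ¬ CaseDisjoint α i k j := fun h => c1 h.1
    refine ⟨?_, fun h => absurd h this⟩
    simp [Prog.caseDisjoint, Stmt.exec, Op.exec, hz, h.var_i, h.var_k, h.left.good, c1, hσ,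
      ind_of_false this]
  by_cases c2 : WordGood (seg α k j)
  swap
  · have : ¬ CaseDisjoint α i k j := fun h => c2 h.2.1
    refine ⟨?_, fun h => absurd h this⟩
    simp [Prog.caseDisjoint, Stmt.exec, Op.exec, hz, h.var_i, h.var_k, h.var_j, h.left.good,
      h.right.good, c1, c2, hσ, ind_of_false this]
  set σ' := ((σ.setVar .u (ind (WordGood (seg α i k)))).setVar .u
    (ind (WordGood (seg α k j)))).setVar .w 0 with hσ'
  have hcmp := exec_compare (α := α) (i := i) (k := k) (j := j) (σ := σ')
    ⟨⟨by simp [hσ', hz], by simp [hσ', h.ready.one], by simp [hσ', h.ready.n]⟩, h.hik, h.hkj, h.hj,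
      by simp [hσ', h.var_i], by simp [hσ', h.var_k], by simp [hσ', h.var_j], by
        simpa [hσ'] using h.lab, h.left, h.right⟩ (by simp [hσ'])
  have hF := Stmt.frame α.length (.loop .p (.loop .q Prog.compareStep)) σ'
  have hexec : Prog.caseDisjoint.exec α.length σ = (Stmt.ite .zero .w .skip
        (.op (.const .ok 1) ;; .op (.ld .ls .split .i .zero .k) ;;
          .op (.ld .rs .split .k .zero .j))).exec α.length
      ((Stmt.loop .p (.loop .q Prog.compareStep)).exec α.length σ') := by
    rw [Prog.caseDisjoint]
    simp only [Stmt.exec, Op.exec, St.var_setVar, St.tab_setVar, hz, h.var_i, h.var_k, h.var_j,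
      h.left.good, h.right.good, reduceCtorEq, if_false, if_true, ind_pos, c1, c2, hσ']
  rw [hexec]
  generalize (Stmt.loop .p (.loop .q Prog.compareStep)).exec α.length σ' = τ at hcmp hF
  have vz : τ.var .zero = 0 := (hF.var .zero (by decide)).trans (by simp [hσ', hz])
  have vi : τ.var .i = i := (hF.var .i (by decide)).trans (by simp [hσ', h.var_i])
  have vk : τ.var .k = k := (hF.var .k (by decide)).trans (by simp [hσ', h.var_k])
  have vj : τ.var .j = j := (hF.var .j (by decide)).trans (by simp [hσ', h.var_j])
  have vo : τ.var .ok = 0 := (hF.var .ok (by decide)).trans (by simp [hσ', hσ])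
  have vt : τ.tab .split = σ.tab .split := hF.tab .split (by decide)
  by_cases c3 : (seg α i k).Disjoint (seg α k j)
  · have : CaseDisjoint α i k j := ⟨c1, c2, c3⟩
    have hw : ¬ 0 < τ.var .w := fun h => hcmp.1 h c3
    simp [Known, Stmt.exec, Op.exec, vz, vi, vk, vj, vt, hw, ind_of_true this, h.left.split,
      h.right.split]
  · have : ¬ CaseDisjoint α i k j := fun h => c3 h.2.2
    have hw : 0 < τ.var .w := hcmp.2 c3
    simp [Known, Stmt.exec, vz, vo, hw, this]

open Classical in
lemma exec_caseEqual (h : SplitCtx α i k j σ) {p : Prop} {c : ℕ × ℕ} (hσ : Known σ p c) :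
    Known (Prog.caseEqual.exec α.length σ) (CaseEqual α i k j ∨ p)
      (if CaseEqual α i k j then (splitPos α i k, 0) else c) := by
  have hz := h.ready.zero
  have hik := h.hik
  have hkj := h.hkj
  have hj := h.hj
  have hEq := factorLabel_eq_iff (α := α) hik (by omega) hkj hj
  have l1 := h.lab i k hik (by omega)
  have l2 := h.lab k j hkj hj
  refine hσ.override (fun hc => ?_) (fun hc => ?_)
  · simp [Prog.caseEqual, Stmt.exec, Stmt.exec_ifEq, Op.exec, hz, h.var_i, h.var_k, h.var_j,
      h.left.good, h.left.split, l1, l2, hEq, if_pos hc.1, hc.2]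
  · by_cases c1 : seg α i k = seg α k j
    · have c2 : ¬ WordGood (seg α i k) := fun h => hc ⟨c1, h⟩
      simp [Prog.caseEqual, Stmt.exec, Stmt.exec_ifEq, Op.exec, hz, h.var_i, h.var_k, h.var_j,
        h.left.good, l1, l2, hEq, if_pos c1, c2]
    · simp [Prog.caseEqual, Stmt.exec, Stmt.exec_ifEq, Op.exec, hz, h.var_i, h.var_k, h.var_j,
        l1, l2, hEq, c1]

open Classical in
lemma exec_caseRL (h : SplitCtx α i k j σ) {p : Prop} {c : ℕ × ℕ} (hσ : Known σ p c) :
    Known (Prog.caseRL.exec α.length σ) (CaseRL α i k j ∨ p)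
      (if CaseRL α i k j then (0, k + (k - i)) else c) := by
  have hz := h.ready.zero
  have hn := h.ready.n
  have hik := h.hik
  have hkj := h.hkj
  have hj := h.hj
  by_cases c0 : k - i < j - k
  swap
  · have hc : ¬ CaseRL α i k j := fun h => c0 h.1
    refine hσ.override (fun h => absurd h hc) fun _ => ?_
    simp [Prog.caseRL, Stmt.exec, Op.exec, h.var_i, h.var_k, h.var_j, c0]
  have hq : α.length - (α.length - k - (k - i)) = k + (k - i) := by omega
  have hEq := factorLabel_eq_iff (α := α) (i := i) (j := k) (i' := k) (j' := k + (k - i)) hik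
    (by omega) (by omega) (by omega)
  have l1 := h.lab i k hik (by omega)
  have l2 := h.lab k (k + (k - i)) (by omega) (by omega)
  have l3 := (h.right.entry (k + (k - i)) (by omega) (by omega)).ok
  refine hσ.override (fun hc => ?_) (fun hc => ?_)
  · simp [Prog.caseRL, Prog.caseMatch, Stmt.exec, Stmt.exec_ifEq, Op.exec, hz, hn, h.var_i, h.var_k,
      h.var_j, c0, hq, l1, l2, l3, hEq, ← hc.2.1, hc.2.2]
  · by_cases c1 : seg α i k = seg α k (k + (k - i))
    · have c2 : ¬ SegGood α k (k + (k - i)) j := fun h => hc ⟨c0, c1, h⟩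
      simp [Prog.caseRL, Prog.caseMatch, Stmt.exec, Stmt.exec_ifEq, Op.exec, hz, hn, h.var_i,
        h.var_k, h.var_j, c0, hq, l1, l2, l3, hEq, if_pos c1, c2]
    · simp [Prog.caseRL, Prog.caseMatch, Stmt.exec, Stmt.exec_ifEq, Op.exec, hz, hn, h.var_i,
        h.var_k, h.var_j, c0, hq, l1, l2, hEq, c1]

open Classical in
lemma exec_caseRR (h : SplitCtx α i k j σ) {p : Prop} {c : ℕ × ℕ} (hσ : Known σ p c) :
    Known (Prog.caseRR.exec α.length σ) (CaseRR α i k j ∨ p)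
      (if CaseRR α i k j then (0, j - (k - i)) else c) := by
  have hz := h.ready.zero
  have hik := h.hik
  have hkj := h.hkj
  have hj := h.hj
  by_cases c0 : k - i < j - k
  swap
  · have hc : ¬ CaseRR α i k j := fun h => c0 h.1
    refine hσ.override (fun h => absurd h hc) fun _ => ?_
    simp [Prog.caseRR, Stmt.exec, Op.exec, h.var_i, h.var_k, h.var_j, c0]
  have hEq := factorLabel_eq_iff (α := α) (i := i) (j := k) (i' := j - (k - i)) (j' := j) hik
    (by omega) (by omega) (by omega)
  have l1 := h.lab i k hik (by omega)
  have l2 := h.lab (j - (k - i)) j (by omega) (by omega)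
  have l3 := (h.right.entry (j - (k - i)) (by omega) (by omega)).ok
  refine hσ.override (fun hc => ?_) (fun hc => ?_)
  · simp [Prog.caseRR, Prog.caseMatch, Stmt.exec, Stmt.exec_ifEq, Op.exec, hz, h.var_i, h.var_k,
      h.var_j, c0, l1, l2, l3, hEq, ← hc.2.1, hc.2.2]
  · by_cases c1 : seg α i k = seg α (j - (k - i)) j
    · have c2 : ¬ SegGood α k (j - (k - i)) j := fun h => hc ⟨c0, c1, h⟩
      simp [Prog.caseRR, Prog.caseMatch, Stmt.exec, Stmt.exec_ifEq, Op.exec, hz, h.var_i,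
        h.var_k, h.var_j, c0, l1, l2, l3, hEq, if_pos c1, c2]
    · simp [Prog.caseRR, Prog.caseMatch, Stmt.exec, Stmt.exec_ifEq, Op.exec, hz, h.var_i,
        h.var_k, h.var_j, c0, l1, l2, hEq, c1]

open Classical in
lemma exec_caseLL (h : SplitCtx α i k j σ) {p : Prop} {c : ℕ × ℕ} (hσ : Known σ p c) :
    Known (Prog.caseLL.exec α.length σ) (CaseLL α i k j ∨ p)
      (if CaseLL α i k j then (i + (j - k), 0) else c) := by
  have hz := h.ready.zero
  have hn := h.ready.n
  have hik := h.hik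
  have hkj := h.hkj
  have hj := h.hj
  by_cases c0 : j - k < k - i
  swap
  · have hc : ¬ CaseLL α i k j := fun h => c0 h.1
    refine hσ.override (fun h => absurd h hc) fun _ => ?_
    simp [Prog.caseLL, Stmt.exec, Op.exec, h.var_i, h.var_k, h.var_j, c0]
  have hq : α.length - (α.length - i - (j - k)) = i + (j - k) := by omega
  have hEq := factorLabel_eq_iff (α := α) (i := i) (j := i + (j - k)) (i' := k) (j' := j)
    (by omega) (by omega) (by omega) (by omega)
  have l1 := h.lab i (i + (j - k)) (by omega) (by omega)
  have l2 := h.lab k j (by omega) (by omega)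
  have l3 := (h.left.entry (i + (j - k)) (by omega) (by omega)).ok
  refine hσ.override (fun hc => ?_) (fun hc => ?_)
  · simp [Prog.caseLL, Prog.caseMatch, Stmt.exec, Stmt.exec_ifEq, Op.exec, hz, hn, h.var_i, h.var_k,
      h.var_j, c0, hq, l1, l2, l3, hEq, hc.2.1, hc.2.2]
  · by_cases c1 : seg α i (i + (j - k)) = seg α k j
    · have c2 : ¬ SegGood α i (i + (j - k)) k := fun h => hc ⟨c0, c1, h⟩
      simp [Prog.caseLL, Prog.caseMatch, Stmt.exec, Stmt.exec_ifEq, Op.exec, hz, hn, h.var_i,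
        h.var_k, h.var_j, c0, hq, l1, l2, l3, hEq, if_pos c1, c2]
    · simp [Prog.caseLL, Prog.caseMatch, Stmt.exec, Stmt.exec_ifEq, Op.exec, hz, hn, h.var_i,
        h.var_k, h.var_j, c0, hq, l1, l2, hEq, c1]

open Classical in
lemma exec_caseLR (h : SplitCtx α i k j σ) {p : Prop} {c : ℕ × ℕ} (hσ : Known σ p c) :
    Known (Prog.caseLR.exec α.length σ) (CaseLR α i k j ∨ p)
      (if CaseLR α i k j then (k - (j - k), 0) else c) := by
  have hz := h.ready.zero
  have hik := h.hik
  have hkj := h.hkj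
  have hj := h.hj
  by_cases c0 : j - k < k - i
  swap
  · have hc : ¬ CaseLR α i k j := fun h => c0 h.1
    refine hσ.override (fun h => absurd h hc) fun _ => ?_
    simp [Prog.caseLR, Stmt.exec, Op.exec, h.var_i, h.var_k, h.var_j, c0]
  have hEq := factorLabel_eq_iff (α := α) (i := k - (j - k)) (j := k) (i' := k) (j' := j)
    (by omega) (by omega) (by omega) (by omega)
  have l1 := h.lab (k - (j - k)) k (by omega) (by omega)
  have l2 := h.lab k j (by omega) (by omega)
  have l3 := (h.left.entry (k - (j - k)) (by omega) (by omega)).ok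
  refine hσ.override (fun hc => ?_) (fun hc => ?_)
  · simp [Prog.caseLR, Prog.caseMatch, Stmt.exec, Stmt.exec_ifEq, Op.exec, hz, h.var_i, h.var_k,
      h.var_j, c0, l1, l2, l3, hEq, hc.2.1, hc.2.2]
  · by_cases c1 : seg α (k - (j - k)) k = seg α k j
    · have c2 : ¬ SegGood α i (k - (j - k)) k := fun h => hc ⟨c0, c1, h⟩
      simp [Prog.caseLR, Prog.caseMatch, Stmt.exec, Stmt.exec_ifEq, Op.exec, hz, h.var_i,
        h.var_k, h.var_j, c0, l1, l2, l3, hEq, if_pos c1, c2]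
    · simp [Prog.caseLR, Prog.caseMatch, Stmt.exec, Stmt.exec_ifEq, Op.exec, hz, h.var_i,
        h.var_k, h.var_j, c0, l1, l2, hEq, c1]

lemma Stmt.exec_seq (n : ℕ) (s t : Stmt) (σ : St) :
    (s ;; t).exec n σ = t.exec n (s.exec n σ) := rfl

lemma exec_splitStep (h : SplitCtx α i k j σ) :
    Known (Prog.splitStep.exec α.length σ) (SegGood α i k j) (childSplits α i k j) := by
  have hiff : SegGood α i k j ↔ CaseLR α i k j ∨ CaseLL α i k j ∨ CaseRR α i k j ∨
      CaseRL α i k j ∨ CaseEqual α i k j ∨ CaseDisjoint α i k j :=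
    ⟨fun hg => by have := hg.cases h.hik h.hkj h.hj; tauto, fun hc =>
      segGood_of_cases h.hik h.hkj (by tauto)⟩
  rw [hiff, childSplits]
  simp only [Prog.splitStep, Stmt.exec_seq]
  have h0 := h.exec (.op (.const .ok 0)) rfl (by decide)
  have k0 : ((Stmt.op (.const .ok 0)).exec α.length σ).var .ok = 0 := by simp [Stmt.exec, Op.exec]
  generalize (Stmt.op (.const .ok 0)).exec α.length σ = σ₀ at h0 k0 ⊢
  have k1 := exec_caseDisjoint h0 k0
  have h1 := h0.exec Prog.caseDisjoint rfl (by decide)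
  generalize Prog.caseDisjoint.exec α.length σ₀ = σ₁ at h1 k1 ⊢
  have k2 := exec_caseEqual h1 k1
  have h2 := h1.exec Prog.caseEqual rfl (by decide)
  generalize Prog.caseEqual.exec α.length σ₁ = σ₂ at h2 k2 ⊢
  have k3 := exec_caseRL h2 k2
  have h3 := h2.exec Prog.caseRL rfl (by decide)
  generalize Prog.caseRL.exec α.length σ₂ = σ₃ at h3 k3 ⊢
  have k4 := exec_caseRR h3 k3
  have h4 := h3.exec Prog.caseRR rfl (by decide)
  generalize Prog.caseRR.exec α.length σ₃ = σ₄ at h4 k4 ⊢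
  have k5 := exec_caseLL h4 k4
  have h5 := h4.exec Prog.caseLL rfl (by decide)
  generalize Prog.caseLL.exec α.length σ₄ = σ₅ at h5 k5 ⊢
  have k6 := exec_caseLR h5 k5
  exact k6

end cases

section tables

variable {α : List Var} {i j : ℕ} {σ : St}

lemma exec_splitLoop (hR : Ready α.length σ) (hij : i < j) (hj : j ≤ α.length)
    (vi : σ.var .i = i) (vj : σ.var .j = j)
    (hlab : ∀ i j, i < j → j ≤ α.length → σ.tab .lab i 0 j = factorLabel α i j)
    (hleft : ∀ k, i < k → k < j → Filled α σ.tab i k)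
    (hright : ∀ k, i < k → k < j → Filled α σ.tab k j)
    (hgood : σ.var .good = if i + 1 < j then 0 else 1) (hsplit : σ.var .split = 0) :
    (Prog.splitLoop.exec α.length σ).var .good = ind (WordGood (seg α i j)) ∧
    (Prog.splitLoop.exec α.length σ).var .split = splitPos α i j ∧
    (∀ k, i < k → k < j → Entry α (Prog.splitLoop.exec α.length σ).tab i k j) ∧
    ∀ T i' k' j', i' ≠ i ∨ j' ≠ j ∨ k' ≤ i →
      (Prog.splitLoop.exec α.length σ).tab T i' k' j' = σ.tab T i' k' j' := by
  have key := Stmt.loop_induct_frame (n := α.length) (x := .k) (σ := σ)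
    (s := .ite .i .k (.ite .k .j (Prog.splitStep ;; .op (.st .ok .i .k .j .ok) ;;
      .op (.st .ls .i .k .j .ls) ;; .op (.st .rs .i .k .j .rs) ;;
      .ite .zero .ok (.op (.const .good 1) ;; .op (.copy .split .k)) .skip) .skip) .skip)
    (fun m τ => τ.var .good = ind (¬ i + 1 < j ∨ ∃ k < m, i < k ∧ k < j ∧ SegGood α i k j) ∧
      τ.var .split = lastSplit α i j m ∧
      (∀ k, i < k → k < j → k < m → Entry α τ.tab i k j) ∧
      ∀ T i' k' j', i' ≠ i ∨ j' ≠ j ∨ k' ≤ i → τ.tab T i' k' j' = σ.tab T i' k' j')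
    ⟨by rw [hgood]; simp only [ind]; split_ifs <;> simp_all, by simpa [lastSplit] using hsplit, by omega,
      fun _ _ _ _ _ => rfl⟩ (by
    intro k τ hk hF ⟨t1, t2, t3, t4⟩
    have hRτ := hR.of_frame hF (by decide)
    have vi' : τ.var .i = i := (hF.var .i (by decide)).trans vi
    have vj' : τ.var .j = j := (hF.var .j (by decide)).trans vj
    by_cases c : i < k ∧ k < j
    swap
    · have hex : (∃ k' < k + 1, i < k' ∧ k' < j ∧ SegGood α i k' j) ↔
          ∃ k' < k, i < k' ∧ k' < j ∧ SegGood α i k' j := by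
        constructor
        · rintro ⟨k', h1, h2, h3, h4⟩
          have : k' ≠ k := by rintro rfl; exact c ⟨h2, h3⟩
          exact ⟨k', by omega, h2, h3, h4⟩
        · rintro ⟨k', h1, h2⟩
          exact ⟨k', by omega, h2⟩
      have hexec : ∀ s, (Stmt.ite .i .k (.ite .k .j s .skip) .skip).exec α.length (τ.setVar .k k) =
          τ.setVar .k k := by
        intro s
        simp only [Stmt.exec, St.var_setVar, vi', vj', reduceCtorEq, if_false, if_true]
        split_ifs <;> first | rfl | omega
      rw [hexec, hex]
      refine ⟨by simpa using t1, ?_, fun k' h1 h2 h3 => ?_, t4⟩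
      · rw [lastSplit, if_neg fun h => c ⟨h.1, h.2.1⟩]
        simpa using t2
      · have : k' ≠ k := by rintro rfl; exact c ⟨h1, h2⟩
        exact t3 k' h1 h2 (by omega)
    obtain ⟨hik, hkj⟩ := c
    -- the tables for shorter factors have not changed
    have tr : ∀ {a b}, Filled α σ.tab a b → (a ≠ i ∨ b ≠ j) → Filled α τ.tab a b :=
      fun {a b} h hab => h.congr fun T k' => t4 T a k' b (by tauto)
    have hctx : SplitCtx α i k j (τ.setVar .k k) :=
      ⟨⟨by simp [hRτ.zero], by simp [hRτ.one], by simp [hRτ.n]⟩, hik, hkj, hj, by simp [vi'],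
        by simp, by simp [vj'], fun a b hab hb => (t4 _ _ _ _ (by omega)).trans (hlab a b hab hb),
        tr (hleft k hik hkj) (by omega), tr (hright k hik hkj) (by omega)⟩
    obtain ⟨s1, s2⟩ := exec_splitStep hctx
    have hS := hctx.exec Prog.splitStep rfl (by decide)
    have hG := (Stmt.frame α.length Prog.splitStep (τ.setVar .k k)).var .good (by decide)
    have hP := (Stmt.frame α.length Prog.splitStep (τ.setVar .k k)).var .split (by decide)
    have hT : (Prog.splitStep.exec α.length (τ.setVar .k k)).tab = τ.tab := Stmt.tab_exec rfl
    have hexec : ∀ s, (Stmt.ite .i .k (.ite .k .j (Prog.splitStep ;; s) .skip) .skip).exec α.length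
        (τ.setVar .k k) = s.exec α.length (Prog.splitStep.exec α.length (τ.setVar .k k)) := by
      intro s
      simp only [Stmt.exec, St.var_setVar, vi', vj', reduceCtorEq, if_false, if_true]
      rw [if_pos hik, if_pos hkj]
    rw [hexec]
    generalize Prog.splitStep.exec α.length (τ.setVar .k k) = υ at s1 s2 hS hG hP hT
    have e1 : (¬ i + 1 < j ∨ ∃ k' < k + 1, i < k' ∧ k' < j ∧ SegGood α i k' j) ↔
        SegGood α i k j ∨ (¬ i + 1 < j ∨ ∃ k' < k, i < k' ∧ k' < j ∧ SegGood α i k' j) := by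
      constructor
      · rintro (h | ⟨k', h1, h2, h3, h4⟩)
        · exact .inr (.inl h)
        · rcases Nat.lt_succ_iff_lt_or_eq.1 h1 with h1 | rfl
          · exact .inr (.inr ⟨k', h1, h2, h3, h4⟩)
          · exact .inl h4
      · rintro (h | h | ⟨k', h1, h2⟩)
        · exact .inr ⟨k, by omega, hik, hkj, h⟩
        · exact .inl h
        · exact .inr ⟨k', by omega, h2⟩
    have hE : ∀ k', k' ≠ k → i < k' → k' < j → k' < k + 1 → Entry α τ.tab i k' j :=
      fun k' h1 h2 h3 h4 => t3 k' h2 h3 (by omega)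
    rw [e1]
    by_cases c : SegGood α i k j
    · obtain ⟨s2, s3⟩ := s2 c
      refine ⟨?_, ?_, fun k' h1 h2 h3 => ?_, fun T i' k' j' h => ?_⟩
      · simp [Stmt.exec, Op.exec, hS.ready.zero, s1, c, ind_of_true]
      · simp [Stmt.exec, Op.exec, hS.ready.zero, s1, c, lastSplit, hik, hkj, hS.var_k]
      · by_cases hk' : k' = k
        · subst hk'
          constructor <;>
            simp [Stmt.exec, Op.exec, hS.ready.zero, hS.var_i, hS.var_k, hS.var_j, s1, s2, s3, c]
        · have := hE k' hk' h1 h2 h3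
          constructor <;>
            simp [Stmt.exec, Op.exec, hS.ready.zero, hS.var_i, hS.var_k, hS.var_j, s1, c, hT, hk',
              this.ok] <;>
            first | exact this.ls | exact this.rs
      · have : ¬ (i' = i ∧ k' = k ∧ j' = j) := by omega
        simp [Stmt.exec, Op.exec, hS.ready.zero, hS.var_i, hS.var_k, hS.var_j, s1, c, hT, this,
          t4 T i' k' j' h]
    · refine ⟨?_, ?_, fun k' h1 h2 h3 => ?_, fun T i' k' j' h => ?_⟩
      · simpa [Stmt.exec, Op.exec, hS.ready.zero, s1, c, hG] using t1
      · simpa [Stmt.exec, Op.exec, hS.ready.zero, s1, c, lastSplit, hP] using t2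
      · by_cases hk' : k' = k
        · subst hk'
          constructor <;>
            simp [Stmt.exec, Op.exec, hS.ready.zero, hS.var_i, hS.var_k, hS.var_j, s1, c]
        · have := hE k' hk' h1 h2 h3
          constructor <;>
            simp [Stmt.exec, Op.exec, hS.ready.zero, hS.var_i, hS.var_k, hS.var_j, s1, c, hT, hk',
              this.ok] <;>
            first | exact this.ls | exact this.rs
      · have : ¬ (i' = i ∧ k' = k ∧ j' = j) := by omega
        simp [Stmt.exec, Op.exec, hS.ready.zero, hS.var_i, hS.var_k, hS.var_j, s1, c, hT, this,
          t4 T i' k' j' h])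
  obtain ⟨t1, t2, t3, t4⟩ := key
  refine ⟨t1.trans (congrArg ind (propext ?_)), t2, fun k h1 h2 => t3 k h1 h2 (by omega), t4⟩
  constructor
  · rintro (h | ⟨k, -, h1, h2, a, b, ha, hb, hg⟩)
    · obtain rfl : j = i + 1 := by omega
      exact ⟨.var (α.getD i 0), (seg_succ (by omega)).symm, trivial⟩
    · exact ⟨.cat a b, by rw [BPat.flatten, ha, hb, seg_append h1.le h2.le], hg⟩
  · intro h
    by_cases hl : i + 1 < j
    · obtain ⟨k, h1, h2, h3⟩ := exists_segGood hl hj h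
      exact .inr ⟨k, by omega, h1, h2, h3⟩
    · exact .inl hl

lemma exec_tableStep {y : ℕ} (hR : Ready α.length σ) (vi : σ.var .i = i) (vy : σ.var .y = y)
    (hy : y < α.length)
    (hlab : ∀ i j, i < j → j ≤ α.length → σ.tab .lab i 0 j = factorLabel α i j)
    (hfill : ∀ i' j', i' < j' → j' ≤ α.length → (i < i' ∨ i' = i ∧ j' ≤ y) →
      Filled α σ.tab i' j') :
    ∀ i' j', i' < j' → j' ≤ α.length → (i < i' ∨ i' = i ∧ j' ≤ y + 1) →
      Filled α (Prog.tableStep.exec α.length σ).tab i' j' := by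
  by_cases hij : i < y + 1
  swap
  · intro i' j' h1 h2 h3
    have : Prog.tableStep.exec α.length σ = σ.setVar .j (y + 1) := by
      simp [Prog.tableStep, Stmt.exec, Op.exec, vi, vy, hij]
    rw [this]
    exact hfill i' j' h1 h2 (by omega)
  set σ' := (Stmt.ite .i' .j .skip (.op (.const .good 1))).exec α.length
    ((((σ.setVar .j (y + 1)).setVar .i' (i + 1)).setVar .good 0).setVar .split 0) with hσ'
  have hexec : Prog.tableStep.exec α.length σ =
      ((Stmt.op (.st .good .i .zero .j .good)) ;; .op (.st .split .i .zero .j .split)).exec α.length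
        (Prog.splitLoop.exec α.length σ') := by
    rw [Prog.tableStep, hσ']
    simp only [Stmt.exec_seq]
    simp [Stmt.exec, Op.exec, vi, vy, hij]
  have hv : ∀ v, v ≠ .j → v ≠ .i' → v ≠ .good → v ≠ .split → σ'.var v = σ.var v := by
    intro v h1 h2 h3 h4
    rw [hσ']
    simp only [Stmt.exec, Op.exec]
    split_ifs <;> simp [h1, h2, h3, h4]
  have ht : σ'.tab = σ.tab := by
    rw [hσ', Stmt.tab_exec rfl]
    rfl
  have vj' : σ'.var .j = y + 1 := by
    simp only [hσ', Stmt.exec, Op.exec]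
    split_ifs <;> simp
  have vg' : σ'.var .good = if i + 1 < y + 1 then 0 else 1 := by
    simp only [hσ', Stmt.exec, Op.exec, St.var_setVar, reduceCtorEq, if_true, if_false]
    split_ifs <;> simp
  have vs' : σ'.var .split = 0 := by
    simp only [hσ', Stmt.exec, Op.exec]
    split_ifs <;> simp
  have hv' : ∀ v, v ∉ [Loc.j, .i', .good, .split] → σ'.var v = σ.var v := by
    intro v h
    simp only [List.mem_cons, not_or] at h
    exact hv v h.1 h.2.1 h.2.2.1 h.2.2.2.1
  have hR' : Ready α.length σ' := ⟨(hv' _ (by decide)).trans hR.zero,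
    (hv' _ (by decide)).trans hR.one, (hv' _ (by decide)).trans hR.n⟩
  have vi' : σ'.var .i = i := (hv' _ (by decide)).trans vi
  obtain ⟨s1, s2, s3, s4⟩ := exec_splitLoop hR' hij hy vi' vj' (ht ▸ hlab)
    (fun k h1 h2 => ht ▸ hfill i k h1 (by omega) (by omega))
    (fun k h1 h2 => ht ▸ hfill k (y + 1) h2 (by omega) (by omega)) vg' vs'
  have hF := Stmt.frame α.length Prog.splitLoop σ'
  rw [hexec]
  generalize Prog.splitLoop.exec α.length σ' = τ at s1 s2 s3 s4 hF
  have wi : τ.var .i = i := (hF.var .i (by decide)).trans vi'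
  have wj : τ.var .j = y + 1 := (hF.var .j (by decide)).trans vj'
  have wz : τ.var .zero = 0 := (hF.var .zero (by decide)).trans hR'.zero
  intro i' j' h1 h2 h3
  by_cases he : i' = i ∧ j' = y + 1
  · obtain ⟨rfl, rfl⟩ := he
    refine ⟨?_, ?_, fun k g1 g2 => ?_⟩
    · simp [Stmt.exec, Op.exec, wi, wj, wz, s1]
    · simp [Stmt.exec, Op.exec, wi, wj, wz, s2]
    · have := s3 k g1 g2
      constructor <;> simp [Stmt.exec, Op.exec, this.ok] <;> first | exact this.ls | exact this.rs
  · refine (hfill i' j' h1 h2 (by omega)).congr fun T k => ?_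
    have hne : ∀ k', ¬ (i' = i ∧ k' = 0 ∧ j' = y + 1) := fun k' h => he ⟨h.1, h.2.2⟩
    rw [← ht, ← s4 T i' k j' (by omega)]
    simp only [Stmt.exec, Op.exec, St.tab_setTab, wi, wj, wz, St.var_setTab]
    rw [if_neg fun h => he ⟨h.2.1, h.2.2.2⟩, if_neg fun h => he ⟨h.2.1, h.2.2.2⟩]

lemma exec_tables (hR : Ready α.length σ)
    (hlab : ∀ i j, i < j → j ≤ α.length → σ.tab .lab i 0 j = factorLabel α i j) :
    ∀ i j, i < j → j ≤ α.length → Filled α (Prog.tables.exec α.length σ).tab i j := by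
  have key := Stmt.loop_induct_frame (n := α.length) (x := .x) (σ := σ)
    (s := .op (.sub .i .n .one) ;; .op (.sub .i .i .x) ;; .loop .y Prog.tableStep)
    (fun m τ => ∀ i j, i < j → j ≤ α.length → α.length ≤ i + m → Filled α τ.tab i j)
    (by intro i j h1 h2 h3; omega) (by
      intro x τ hx hF hτ
      have hRτ := hR.of_frame hF (by decide)
      have ht : τ.tab .lab = σ.tab .lab := hF.tab .lab (by decide)
      simp only [Stmt.exec_seq]
      set τ' := (Stmt.op (.sub .i .i .x)).exec α.length
        ((Stmt.op (.sub .i .n .one)).exec α.length (τ.setVar .x x)) with hτ'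
      have vi : τ'.var .i = α.length - 1 - x := by simp [hτ', Stmt.exec, Op.exec, hRτ.one, hRτ.n]
      have hRτ' : Ready α.length τ' := ⟨by simp [hτ', Stmt.exec, Op.exec, hRτ.zero],
        by simp [hτ', Stmt.exec, Op.exec, hRτ.one], by simp [hτ', Stmt.exec, Op.exec, hRτ.n]⟩
      have inner := Stmt.loop_induct_frame (n := α.length) (x := .y) (σ := τ')
        (s := Prog.tableStep)
        (fun y υ => ∀ i j, i < j → j ≤ α.length →
          (α.length - 1 - x < i ∨ i = α.length - 1 - x ∧ j ≤ y) → Filled α υ.tab i j)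
        (fun i j h1 h2 h3 => hτ i j h1 h2 (by omega)) (by
          intro y υ hy hF' hυ
          have hRυ := hRτ'.of_frame hF' (by decide)
          have ht' : υ.tab .lab = τ.tab .lab := hF'.tab .lab (by decide)
          have vi' : υ.var .i = α.length - 1 - x := (hF'.var .i (by decide)).trans vi
          refine exec_tableStep ⟨by simp [hRυ.zero], by simp [hRυ.one], by simp [hRυ.n]⟩
            (by simp [vi']) (by simp) hy (fun i j h1 h2 => ?_) hυ
          rw [St.tab_setVar, ht', ht]
          exact hlab i j h1 h2)
      exact fun i j h1 h2 h3 => inner i j h1 h2 (by omega))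
  exact fun i j h1 h2 => key i j h1 h2 (by omega)

end tables

/-! ### Output of the concatenation tree -/

namespace Prog

/-- Push a factor together with its split onto the stack. -/
def push (i k j : Loc) : Stmt :=
  .op (.st .stackI .top .zero .zero i) ;; .op (.st .stackK .top .zero .zero k) ;;
    .op (.st .stackJ .top .zero .zero j) ;; .op (.inc .top .top)

/-- Write a value to the output. -/
def emit (a : Loc) : Stmt := .op (.wr .out a) ;; .op (.inc .out .out)

/-- Pop a factor from the stack, write the code of its node, and push its two parts if it is split. -/
def treeStep : Stmt :=
  .ite .zero .top
    (.op (.sub .top .top .one) ;; .op (.ld .i .stackI .top .zero .zero) ;;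
      .op (.ld .k .stackK .top .zero .zero) ;; .op (.ld .j .stackJ .top .zero .zero) ;;
      .op (.ld .v .lab .i .zero .j) ;;
      .ite .zero .k
        (emit .one ;; emit .v ;; .op (.ld .ls .ls .i .k .j) ;; .op (.ld .rs .rs .i .k .j) ;;
          push .k .rs .j ;; push .i .ls .k)
        (emit .zero ;; emit .v)) .skip

/-- Write the preorder code of the concatenation tree, whose root has the label zero. The two loops take
`n * n ≥ 2 * n - 1` steps, which is enough for all nodes. -/
def tree : Stmt :=
  .op (.st .lab .zero .zero .n .zero) ;; .op (.const .out 0) ;; .op (.const .top 0) ;;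
    .op (.ld .k .split .zero .zero .n) ;; push .zero .k .n ;; .loop .x (.loop .y treeStep)

/-- Decide whether the input has a good bracketing, and write its concatenation tree if it has one and
is not a single letter. -/
def main : Stmt :=
  .op (.const .one 1) ;; labels ;; tables ;; .op (.ld .ans .good .zero .zero .n) ;;
    .ite .zero .ans (.ite .one .n tree .skip) .skip

end Prog

/-- The number of nodes. -/
def LTree.size : LTree → ℕ
  | .leaf _ => 1
  | .node _ l r => 1 + l.size + r.size

lemma LTree.size_pos (T : LTree) : 0 < T.size := by
  cases T <;> simp only [size] <;> omega

lemma LTree.length_code (T : LTree) : T.code.length = 2 * T.size := by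
  induction T with
  | leaf x => rfl
  | node z l r ihl ihr => simp only [code, size, List.length_cons, List.length_append, ihl, ihr]; ring

lemma BPat.size_concatTree (ν : BPat → Var) (b : BPat) :
    (b.concatTree ν).size + 1 ≤ 2 * b.len := by
  induction b with
  | var x => simp [concatTree, LTree.size]
  | cat l r ihl ihr =>
    have := l.len_pos
    have := r.len_pos
    simp only [concatTree, len_cat]
    split_ifs <;> simp only [LTree.size] <;> omega

section stack

variable (α : List Var) (wl : List Var → Var)

/-- The stack of height `h` holds factors for which the given trees have to be written, the topmost
one first. -/
def Stacked (tab : Tab → ℕ → ℕ → ℕ → ℕ) : ℕ → List LTree → Prop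
  | 0, [] => True
  | h + 1, T :: ts => Emits α wl (tab .stackI h 0 0) (tab .stackK h 0 0) (tab .stackJ h 0 0) T ∧
      Stacked tab h ts
  | _, _ => False

/-- The output consists of the beginning of `c`, and the stack corresponds to the rest. At most `m`
nodes remain to be written. -/
structure Writing (c : List ℕ) (m : ℕ) (σ : St) (w : List ℕ) (ts : List LTree) : Prop where
  eq : c = w ++ ts.flatMap LTree.code
  out : σ.var .out = w.length
  raw : ∀ p < w.length, w[p]? = some (σ.raw p)
  stacked : Stacked α wl σ.tab (σ.var .top) ts
  size : (ts.map LTree.size).sum ≤ m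

variable {α wl}

lemma Stacked.congr {tab tab' : Tab → ℕ → ℕ → ℕ → ℕ} {h : ℕ} {ts : List LTree}
    (hs : Stacked α wl tab h ts) (ht : ∀ T, ∀ m < h, tab' T m 0 0 = tab T m 0 0) :
    Stacked α wl tab' h ts := by
  induction h generalizing ts with
  | zero => cases ts <;> exact hs
  | succ h ih =>
    cases ts with
    | nil => exact hs
    | cons T ts =>
      refine ⟨?_, ih hs.2 fun T m hm => ht T m (by omega)⟩
      rw [ht _ h (by omega), ht _ h (by omega), ht _ h (by omega)]
      exact hs.1

lemma exec_push {n : ℕ} {σ : St} {a b c : Loc} {T : LTree} {ts : List LTree}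
    (hz : σ.var .zero = 0) (hs : Stacked α wl σ.tab (σ.var .top) ts)
    (hT : Emits α wl (σ.var a) (σ.var b) (σ.var c) T) :
    Stacked α wl ((Prog.push a b c).exec n σ).tab (((Prog.push a b c).exec n σ).var .top)
      (T :: ts) := by
  have e : ((Prog.push a b c).exec n σ).var .top = σ.var .top + 1 := by
    simp [Prog.push, Stmt.exec, Op.exec]
  rw [e]
  refine ⟨?_, hs.congr fun T' m hm => ?_⟩
  · simpa [Prog.push, Stmt.exec, Op.exec, hz] using hT
  · simp [Prog.push, Stmt.exec, Op.exec, hm.ne]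

lemma exec_emit {n : ℕ} {σ : St} {a : Loc} {w : List ℕ} (hout : σ.var .out = w.length)
    (hraw : ∀ p < w.length, w[p]? = some (σ.raw p)) (hw : w.length ≤ 4 * n) :
    ((Prog.emit a).exec n σ).var .out = (w ++ [σ.var a]).length ∧
      ∀ p < (w ++ [σ.var a]).length,
        (w ++ [σ.var a])[p]? = some (((Prog.emit a).exec n σ).raw p) := by
  constructor
  · simp [Prog.emit, Stmt.exec, Op.exec, hout]
  · intro p hp
    simp only [List.length_append, List.length_singleton] at hp
    by_cases hpw : p < w.length
    · rw [List.getElem?_append_left hpw, hraw p hpw]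
      simp [Prog.emit, Stmt.exec, Op.exec, hout, hw, hpw.ne]
    · obtain rfl : p = w.length := by omega
      simp [Prog.emit, Stmt.exec, Op.exec, hout, hw]

lemma exec_treeStep {σ : St} (hR : Ready α.length σ)
    (hlab : ∀ i j, i < j → j ≤ α.length → σ.tab .lab i 0 j = wl (seg α i j))
    (hls : ∀ i k j, i < k → k < j → j ≤ α.length → SegGood α i k j →
      σ.tab .ls i k j = (childSplits α i k j).1 ∧ σ.tab .rs i k j = (childSplits α i k j).2)
    {c : List ℕ} (hc : c.length ≤ 4 * α.length) {m : ℕ}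
    (h : ∃ w ts, Writing α wl c (m + 1) σ w ts) :
    ∃ w ts, Writing α wl c m (Prog.treeStep.exec α.length σ) w ts := by
  obtain ⟨w, ts, h1, h2, h3, h4, h5⟩ := h
  cases ts with
  | nil =>
    have htop : σ.var .top = 0 := by
      cases ht : σ.var .top with
      | zero => rfl
      | succ t => rw [ht] at h4; exact h4.elim
    have hexec : Prog.treeStep.exec α.length σ = σ := by
      simp [Prog.treeStep, Stmt.exec, hR.zero, htop]
    rw [hexec]
    exact ⟨w, [], h1, h2, h3, h4, by simp⟩
  | cons T ts =>
    obtain ⟨t, ht⟩ : ∃ t, σ.var .top = t + 1 := by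
      cases ht : σ.var .top with
      | zero => rw [ht] at h4; exact h4.elim
      | succ t => exact ⟨t, rfl⟩
    rw [ht] at h4
    obtain ⟨hE, hS⟩ := h4
    have hclen := congrArg List.length h1
    have hTlen := T.length_code
    have hTpos := T.size_pos
    simp only [List.flatMap_cons, List.length_append] at hclen
    simp only [List.map_cons, List.sum_cons] at h5
    -- the state after the factor has been read from the stack
    set σ' := ((((σ.setVar .top t).setVar .i (σ.tab .stackI t 0 0)).setVar .k
      (σ.tab .stackK t 0 0)).setVar .j (σ.tab .stackJ t 0 0)).setVar .v
      (σ.tab .lab (σ.tab .stackI t 0 0) 0 (σ.tab .stackJ t 0 0)) with hσ'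
    have hexec : Prog.treeStep.exec α.length σ = (Stmt.ite .zero .k
        (Prog.emit .one ;; Prog.emit .v ;; .op (.ld .ls .ls .i .k .j) ;;
          .op (.ld .rs .rs .i .k .j) ;; Prog.push .k .rs .j ;; Prog.push .i .ls .k)
        (Prog.emit .zero ;; Prog.emit .v)).exec α.length σ' := by
      rw [Prog.treeStep]
      generalize Stmt.ite .zero .k _ _ = s
      simp [Stmt.exec, Op.exec, hR.zero, hR.one, ht, hσ']
    have hR' : Ready α.length σ' :=
      ⟨by simp [hσ', hR.zero], by simp [hσ', hR.one], by simp [hσ', hR.n]⟩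
    have vi : σ'.var .i = σ.tab .stackI t 0 0 := by simp [hσ']
    have vk : σ'.var .k = σ.tab .stackK t 0 0 := by simp [hσ']
    have vj : σ'.var .j = σ.tab .stackJ t 0 0 := by simp [hσ']
    have vv : σ'.var .v = σ.tab .lab (σ.tab .stackI t 0 0) 0 (σ.tab .stackJ t 0 0) := by simp [hσ']
    have vt : σ'.var .top = t := by simp [hσ']
    have vo : σ'.var .out = w.length := by simp [hσ', h2]
    have ht' : σ'.tab = σ.tab := rfl
    have hr' : ∀ p < w.length, w[p]? = some (σ'.raw p) := h3
    rw [hexec]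
    clear_value σ'
    generalize σ.tab .stackI t 0 0 = i at *
    generalize σ.tab .stackK t 0 0 = k at *
    generalize σ.tab .stackJ t 0 0 = j at *
    cases hE with
    | leaf hij hj =>
      rw [hlab i j hij hj] at vv
      simp only [Stmt.exec]
      rw [if_neg (by rw [vk, hR'.zero]; exact lt_irrefl 0)]
      obtain ⟨o1, r1⟩ := exec_emit (n := α.length) (a := .zero) vo hr' (by omega)
      have F1 := Stmt.frame α.length (Prog.emit .zero) σ'
      generalize (Prog.emit .zero).exec α.length σ' = σ₁ at *
      obtain ⟨o2, r2⟩ := exec_emit (n := α.length) (a := .v) o1 r1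
        (by simp only [List.length_append, List.length_singleton]; omega)
      have F2 := Stmt.frame α.length (Prog.emit .v) σ₁
      generalize (Prog.emit .v).exec α.length σ₁ = σ₂ at *
      refine ⟨_, ts, ?_, o2, r2, ?_, by omega⟩
      · rw [h1, F1.var .v (by decide), vv, hR'.zero]
        simp [LTree.code]
      · rw [F2.var .top (by decide), F1.var .top (by decide), vt]
        refine hS.congr fun T m _ => ?_
        rw [F2.tab T (by simp [Prog.emit, Stmt.writtenTabs, Op.writtenTabs]),
          F1.tab T (by simp [Prog.emit, Stmt.writtenTabs, Op.writtenTabs]), ht']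
    | @node i k j L R hik hkj hj hg hL hR2 =>
      rw [hlab i j (hik.trans hkj) hj] at vv
      simp only [Stmt.exec]
      rw [if_pos (by rw [vk, hR'.zero]; omega)]
      obtain ⟨o1, r1⟩ := exec_emit (n := α.length) (a := .one) vo hr' (by omega)
      have F1 := Stmt.frame α.length (Prog.emit .one) σ'
      have T1 : ((Prog.emit .one).exec α.length σ').tab = σ'.tab := Stmt.tab_exec rfl
      generalize (Prog.emit .one).exec α.length σ' = σ₁ at *
      obtain ⟨o2, r2⟩ := exec_emit (n := α.length) (a := .v) o1 r1
        (by simp only [List.length_append, List.length_singleton]; omega)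
      have F2 := Stmt.frame α.length (Prog.emit .v) σ₁
      have T2 : ((Prog.emit .v).exec α.length σ₁).tab = σ₁.tab := Stmt.tab_exec rfl
      generalize (Prog.emit .v).exec α.length σ₁ = σ₂ at *
      have hv : ∀ v, v ∉ (Prog.emit .v).writtenVars → σ₂.var v = σ'.var v := fun v hv =>
        (F2.var v hv).trans (F1.var v hv)
      have ht2 : σ₂.tab = σ.tab := by rw [T2, T1, ht']
      obtain ⟨c1, c2⟩ := hls i k j hik hkj hj hg
      set σ₃ := (Op.ld .rs .rs .i .k .j).exec α.length ((Op.ld .ls .ls .i .k .j).exec α.length σ₂)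
        with hσ₃
      have wi : σ₂.var .i = i := (hv .i (by decide)).trans vi
      have wk : σ₂.var .k = k := (hv .k (by decide)).trans vk
      have wj : σ₂.var .j = j := (hv .j (by decide)).trans vj
      have w3 : ∀ v, v ≠ .ls → v ≠ .rs → σ₃.var v = σ₂.var v := by
        intro v g1 g2
        simp [hσ₃, Op.exec, g1, g2]
      have wls : σ₃.var .ls = (childSplits α i k j).1 := by
        simp [hσ₃, Op.exec, wi, wk, wj, ht2, c1]
      have wrs : σ₃.var .rs = (childSplits α i k j).2 := by
        simp [hσ₃, Op.exec, wi, wk, wj, ht2, c2]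
      have t3 : σ₃.tab = σ.tab := ht2
      have r3 : σ₃.raw = σ₂.raw := rfl
      clear_value σ₃
      have vz3 : σ₃.var .zero = 0 :=
        (w3 .zero (by decide) (by decide)).trans ((hv _ (by decide)).trans hR'.zero)
      have vt3 : σ₃.var .top = t :=
        (w3 .top (by decide) (by decide)).trans ((hv _ (by decide)).trans vt)
      have vi3 : σ₃.var .i = i := (w3 .i (by decide) (by decide)).trans wi
      have vk3 : σ₃.var .k = k := (w3 .k (by decide) (by decide)).trans wk
      have vj3 : σ₃.var .j = j := (w3 .j (by decide) (by decide)).trans wj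
      have S4 := exec_push (n := α.length) (σ := σ₃) (a := .k) (b := .rs) (c := .j) (T := R)
        (ts := ts) vz3 (by rw [t3, vt3]; exact hS) (by rw [vk3, wrs, vj3]; exact hR2)
      have F4 := Stmt.frame α.length (Prog.push .k .rs .j) σ₃
      generalize (Prog.push .k .rs .j).exec α.length σ₃ = σ₄ at *
      have S5 := exec_push (n := α.length) (σ := σ₄) (a := .i) (b := .ls) (c := .k) (T := L)
        (ts := R :: ts) ((F4.var .zero (by decide)).trans vz3) S4
        (by rw [F4.var .i (by decide), F4.var .ls (by decide), F4.var .k (by decide), vi3, wls, vk3]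
            exact hL)
      have F5 := Stmt.frame α.length (Prog.push .i .ls .k) σ₄
      generalize (Prog.push .i .ls .k).exec α.length σ₄ = σ₅ at *
      refine ⟨w ++ [σ'.var .one] ++ [σ₁.var .v], L :: R :: ts, ?_, ?_, ?_, S5, ?_⟩
      · rw [h1, F1.var .v (by decide), vv, hR'.one]
        simp [LTree.code]
      · rw [F5.var .out (by decide), F4.var .out (by decide), w3 .out (by decide) (by decide), o2]
      · rw [F5.raw rfl, F4.raw rfl, r3]
        exact r2
      · simp only [LTree.size] at h5
        simp only [List.map_cons, List.sum_cons]
        omega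

end stack

lemma exec_tree {α : List Var} {wl : List Var → Var} {σ : St} (hR : Ready α.length σ)
    (hn : 0 < α.length)
    (hlab : ∀ i j, i < j → j ≤ α.length →
      wl (seg α i j) = if i = 0 ∧ j = α.length then 0 else σ.tab .lab i 0 j)
    (hfill : ∀ i j, i < j → j ≤ α.length → Filled α σ.tab i j) {T : LTree}
    (hT : Emits α wl 0 (splitPos α 0 α.length) α.length T) (hsize : T.size + 1 ≤ 2 * α.length) :
    ∀ p (h : p < T.code.length), (Prog.tree.exec α.length σ).raw p = T.code[p] := by
  have hlen := T.length_code
  rw [Prog.tree]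
  simp only [Stmt.exec_seq]
  set σ₁ := (Stmt.op (.ld .k .split .zero .zero .n)).exec α.length
    ((Stmt.op (.const .top 0)).exec α.length ((Stmt.op (.const .out 0)).exec α.length
      ((Stmt.op (.st .lab .zero .zero .n .zero)).exec α.length σ))) with hσ₁
  have hR1 : Ready α.length σ₁ := ⟨by simp [hσ₁, Stmt.exec, Op.exec, hR.zero],
    by simp [hσ₁, Stmt.exec, Op.exec, hR.one], by simp [hσ₁, Stmt.exec, Op.exec, hR.n]⟩
  have vt : σ₁.var .top = 0 := by simp [hσ₁, Stmt.exec, Op.exec]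
  have vo : σ₁.var .out = 0 := by simp [hσ₁, Stmt.exec, Op.exec]
  have vk : σ₁.var .k = splitPos α 0 α.length := by
    simp [hσ₁, Stmt.exec, Op.exec, hR.zero, hR.n, (hfill 0 α.length hn le_rfl).split]
  have t1 : ∀ i j, i < j → j ≤ α.length → σ₁.tab .lab i 0 j = wl (seg α i j) := by
    intro i j hij hj
    rw [hlab i j hij hj]
    simp [hσ₁, Stmt.exec, Op.exec, hR.zero, hR.n]
  have t2 : ∀ i k j, i < k → k < j → j ≤ α.length → SegGood α i k j →
      σ₁.tab .ls i k j = (childSplits α i k j).1 ∧ σ₁.tab .rs i k j = (childSplits α i k j).2 := by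
    intro i k j hik hkj hj hg
    have := (hfill i j (by omega) hj).entry k hik hkj
    simp [hσ₁, Stmt.exec, Op.exec, this.ls hg, this.rs hg]
  clear_value σ₁
  have S := exec_push (n := α.length) (σ := σ₁) (a := .zero) (b := .k) (c := .n) (T := T)
    (ts := []) (wl := wl) (α := α) hR1.zero (by rw [vt]; trivial)
    (by rw [hR1.zero, hR1.n, vk]; exact hT)
  have F := Stmt.frame α.length (Prog.push .zero .k .n) σ₁
  generalize (Prog.push .zero .k .n).exec α.length σ₁ = σ₂ at *
  have hR2 : Ready α.length σ₂ := hR1.of_frame F (by decide)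
  have hF2 : ∀ T, T ≠ .stackI → T ≠ .stackK → T ≠ .stackJ → σ₂.tab T = σ₁.tab T :=
    fun T h1 h2 h3 => F.tab T (by simp [Prog.push, Stmt.writtenTabs, Op.writtenTabs, h1, h2, h3])
  have key := Stmt.loop_induct_frame (n := α.length) (x := .x) (σ := σ₂)
    (s := .loop .y Prog.treeStep)
    (fun x τ => ∃ w ts, Writing α wl T.code (2 * α.length - 1 - x * α.length) τ w ts)
    ⟨[], [T], by simp, by rw [F.var .out (by decide), vo]; rfl, by simp, S, by simp; omega⟩ (by
      intro x τ hx hF hτ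
      have inner := Stmt.loop_induct_frame (n := α.length) (x := .y) (σ := τ.setVar .x x)
        (s := Prog.treeStep)
        (fun y υ => ∃ w ts, Writing α wl T.code (2 * α.length - 1 - (x * α.length + y)) υ w ts)
        (by
          obtain ⟨w, ts, h1, h2, h3, h4, h5⟩ := hτ
          exact ⟨w, ts, h1, by simpa using h2, h3, by simpa using h4, h5⟩) (by
          intro y υ hy hF' hυ
          have hRυ := (hR2.of_frame hF (by decide))
          have hv : ∀ v, v ≠ .x → v ∉ (Stmt.loop .y Prog.treeStep).writtenVars →
              υ.var v = τ.var v := by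
            intro v g1 g2
            rw [hF'.var v g2, St.var_setVar, if_neg g1]
          have ht : ∀ T, T ∉ Prog.treeStep.writtenTabs → υ.tab T = σ₂.tab T := fun T hT =>
            (hF'.tab T hT).trans (hF.tab T hT)
          have hl : υ.tab .lab = σ₁.tab .lab := (ht _ (by decide)).trans (hF2 _ (by decide)
            (by decide) (by decide))
          have hls : υ.tab .ls = σ₁.tab .ls := (ht _ (by decide)).trans (hF2 _ (by decide)
            (by decide) (by decide))
          have hrs : υ.tab .rs = σ₁.tab .rs := (ht _ (by decide)).trans (hF2 _ (by decide)
            (by decide) (by decide))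
          refine exec_treeStep (m := 2 * α.length - 1 - (x * α.length + (y + 1)))
            ⟨?_, ?_, ?_⟩ ?_ ?_ (by omega) ?_
          · simpa using (hv .zero (by decide) (by decide)).trans hRυ.zero
          · simpa using (hv .one (by decide) (by decide)).trans hRυ.one
          · simpa using (hv .n (by decide) (by decide)).trans hRυ.n
          · rw [St.tab_setVar, hl]
            exact t1
          · rw [St.tab_setVar, hls, hrs]
            exact t2
          · obtain ⟨w, ts, h1, h2, h3, h4, h5⟩ := hυ
            exact ⟨w, ts, h1, by simpa using h2, h3, by simpa using h4, by omega⟩)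
      obtain ⟨w, ts, h⟩ := inner
      exact ⟨w, ts, by rw [Nat.succ_mul x]; exact h⟩)
  obtain ⟨w, ts, h1, h2, h3, h4, h5⟩ := key
  have hsq : 2 * α.length - 1 - α.length * α.length = 0 := by
    rw [Nat.sub_eq_zero_iff_le]
    have : (2 * α.length : ℤ) - 1 ≤ α.length * α.length := by nlinarith [sq_nonneg ((α.length : ℤ) - 1)]
    omega
  rw [hsq] at h5
  have hts : ts = [] := by
    cases ts with
    | nil => rfl
    | cons T ts =>
      have := T.size_pos
      simp only [List.map_cons, List.sum_cons] at h5
      omega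
  rw [hts, List.flatMap_nil, List.append_nil] at h1
  intro p hp
  have := h3 p (by rw [← h1]; exact hp)
  rw [← h1, List.getElem?_eq_getElem hp] at this
  exact (Option.some.inj this).symm

/-! ### Acyclic patterns -/

namespace BPat

lemma exists_append_of_mem_subs {s b : BPat} (h : s ∈ b.subs) :
    ∃ u v, b.flatten = u ++ s.flatten ++ v := by
  induction b with
  | var x => rw [mem_subs_var] at h; exact ⟨[], [], by simp [h]⟩
  | cat l r ihl ihr =>
    rcases mem_subs_cat.1 h with rfl | h | h
    · exact ⟨[], [], by simp⟩
    · obtain ⟨u, v, h⟩ := ihl h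
      exact ⟨u, v ++ r.flatten, by simp [flatten, h]⟩
    · obtain ⟨u, v, h⟩ := ihr h
      exact ⟨l.flatten ++ u, v, by simp [flatten, h]⟩

lemma exists_seg_of_mem_subs {s b : BPat} (h : s ∈ b.subs) :
    ∃ i j, i < j ∧ j ≤ b.flatten.length ∧ seg b.flatten i j = s.flatten := by
  obtain ⟨u, v, h⟩ := exists_append_of_mem_subs h
  have := List.length_pos_of_ne_nil s.flatten_ne_nil
  refine ⟨u.length, u.length + s.flatten.length, by omega, by simp [h], ?_⟩
  rw [h, seg, List.take_left' (by simp), List.drop_left]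

end BPat

open Classical in
/-- The label of a factor of `α` as a function of the word; `α` itself has the label `𝔲 = 0`. -/
noncomputable def wordLabel (α w : List Var) : Var :=
  if w = α then univVar
  else if h : ∃ ij : ℕ × ℕ, ij.1 < ij.2 ∧ ij.2 ≤ α.length ∧ seg α ij.1 ij.2 = w then
    factorLabel α h.choose.1 h.choose.2
  else 0

section wordLabel

variable {α : List Var} {i j : ℕ}

lemma wordLabel_self (α : List Var) : wordLabel α α = univVar := if_pos rfl

lemma wordLabel_seg (hij : i < j) (hj : j ≤ α.length) (h : seg α i j ≠ α) :
    wordLabel α (seg α i j) = factorLabel α i j := by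
  have hex : ∃ ij : ℕ × ℕ, ij.1 < ij.2 ∧ ij.2 ≤ α.length ∧ seg α ij.1 ij.2 = seg α i j :=
    ⟨(i, j), hij, hj, rfl⟩
  rw [wordLabel, if_neg h, dif_pos hex]
  obtain ⟨h1, h2, h3⟩ := hex.choose_spec
  exact (factorLabel_eq_iff h1 h2 hij hj).2 h3

lemma seg_eq_self_iff (hij : i < j) (hj : j ≤ α.length) :
    seg α i j = α ↔ i = 0 ∧ j = α.length := by
  constructor
  · intro h
    have := length_seg (i := i) hj
    rw [h] at this
    omega
  · rintro ⟨rfl, rfl⟩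
    exact seg_zero_length

lemma factorLabel_ne_zero (hα : univVar ∉ α) (hij : i < j) (hj : j ≤ α.length) :
    factorLabel α i j ≠ 0 := by
  unfold factorLabel
  split_ifs
  · have hi : i < α.length := by omega
    rw [List.getD_eq_getElem _ _ hi]
    intro h
    exact hα ((show α[i] = univVar from h) ▸ List.getElem_mem hi)
  · exact Nat.ne_of_gt (by positivity)

lemma isNaming_wordLabel {b : BPat} (hb : b.Good) (hα : univVar ∉ b.flatten) :
    b.IsNaming fun s => wordLabel b.flatten s.flatten := by
  refine ⟨fun s hs t ht he => hb.flatten_injOn hs ht ?_, wordLabel_self _⟩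
  obtain ⟨i, j, hij, hj, hs⟩ := BPat.exists_seg_of_mem_subs hs
  obtain ⟨i', j', hij', hj', ht⟩ := BPat.exists_seg_of_mem_subs ht
  simp only [← hs, ← ht] at he ⊢
  by_cases c : seg b.flatten i j = b.flatten <;> by_cases c' : seg b.flatten i' j' = b.flatten
  · rw [c, c']
  · rw [c, wordLabel_self, wordLabel_seg hij' hj' c'] at he
    exact absurd he.symm (factorLabel_ne_zero hα hij' hj')
  · rw [c', wordLabel_self, wordLabel_seg hij hj c] at he
    exact absurd he (factorLabel_ne_zero hα hij hj)
  · rw [wordLabel_seg hij hj c, wordLabel_seg hij' hj' c'] at he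
    exact (factorLabel_eq_iff hij hj hij' hj').1 he

lemma wordLabel_singleton (hn : 2 ≤ α.length) {x : Var} (hx : x ∈ α) : wordLabel α [x] = x := by
  obtain ⟨i, hi, rfl⟩ := List.getElem_of_mem hx
  have hs := seg_succ hi
  rw [List.getD_eq_getElem _ _ hi] at hs
  have hne : seg α i (i + 1) ≠ α := fun h => by
    have := length_seg (i := i) (show i + 1 ≤ α.length by omega)
    rw [h] at this
    omega
  rw [← hs, wordLabel_seg (by omega) (by omega) hne, factorLabel_succ, List.getD_eq_getElem _ _ hi]

end wordLabel

/-- The naming by `wordLabel` makes the pruned tree of a good bracketing a concatenation tree. -/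
lemma BPat.Good.exists_isConcatTree_wordLabel {b : BPat} (hb : b.Good) (hα : univVar ∉ b.flatten)
    (hn : 2 ≤ b.flatten.length) : ∃ Ψ, IsDecomposition b Ψ ∧ Ψ.IsAcyclic ∧
      IsConcatTree Ψ (b.concatTree fun s => wordLabel b.flatten s.flatten) := by
  have hcat : b.IsCat := by
    cases b with
    | var x => simp [BPat.flatten] at hn
    | cat l r => exact BPat.isCat_cat l r
  refine hb.exists_isConcatTree hcat (isNaming_wordLabel hb hα) fun x hx => ?_
  exact wordLabel_singleton hn (BPat.flatten_subset_of_mem_subs hx (by simp [BPat.flatten]))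

lemma isAcyclicPattern_iff {α : List Var} (hα : univVar ∉ α) :
    IsAcyclicPattern α ↔ WordGood α := by
  constructor
  · rintro ⟨b, hb, h⟩
    exact ⟨b, hb, h.good⟩
  · rintro ⟨b, rfl, h⟩
    refine ⟨b, rfl, ?_⟩
    cases b with
    | var x =>
      have hd : IsDecomposition (.var x) ⟨[], {⟨univVar, [x]⟩}, by simp⟩ := ⟨rfl, rfl⟩
      exact ⟨_, hd, h.isAcyclic_of_isDecomposition hd⟩
    | cat l r =>
      obtain ⟨Ψ, h1, h2, -⟩ := h.exists_isConcatTree_wordLabel hα (by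
        have := l.len_pos
        have := r.len_pos
        have := BPat.len_cat l r
        unfold BPat.len at *
        omega)
      exact ⟨Ψ, h1, h2⟩

/-- The result of the program, and its output. -/
lemma exec_main {α : List Var} (hn : α ≠ []) :
    (Prog.main.exec α.length (St.init α)).var .ans = ind (WordGood α) ∧
      (WordGood α → 2 ≤ α.length → ∃ b : BPat, b.flatten = α ∧ b.Good ∧
        ∃ T, T = (b.concatTree fun s => wordLabel α s.flatten) ∧
          ∀ p (h : p < T.code.length), p ≤ 4 * α.length ∧
            (Prog.main.exec α.length (St.init α)).raw p = T.code[p]) := by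
  have hpos := List.length_pos_of_ne_nil hn
  rw [Prog.main]
  simp only [Stmt.exec_seq]
  set σ₁ := (Stmt.op (.const .one 1)).exec α.length (St.init α) with hσ₁
  have hR1 : Ready α.length σ₁ := ⟨by simp [hσ₁, Stmt.exec, Op.exec, St.init],
    by simp [hσ₁, Stmt.exec, Op.exec], by simp [hσ₁, Stmt.exec, Op.exec, St.init]⟩
  have hl := exec_labels hR1 (by simp [hσ₁, Stmt.exec, Op.exec, St.init])
    (by simp [hσ₁, Stmt.exec, Op.exec, St.init])
  have hR2 := hR1.of_frame (Stmt.frame α.length Prog.labels σ₁) (by decide)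
  generalize Prog.labels.exec α.length σ₁ = σ₂ at *
  have hf := exec_tables hR2 hl
  have hF3 := Stmt.frame α.length Prog.tables σ₂
  have hR3 := hR2.of_frame hF3 (by decide)
  generalize Prog.tables.exec α.length σ₂ = σ₃ at *
  have hl3 : ∀ i j, i < j → j ≤ α.length → σ₃.tab .lab i 0 j = factorLabel α i j := by
    rw [hF3.tab .lab (by decide)]
    exact hl
  set σ₄ := (Stmt.op (.ld .ans .good .zero .zero .n)).exec α.length σ₃ with hσ₄
  have hans : σ₄.var .ans = ind (WordGood α) := by
    simp [hσ₄, Stmt.exec, Op.exec, hR3.zero, hR3.n, (hf 0 _ hpos le_rfl).good, seg_zero_length]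
  have hR4 : Ready α.length σ₄ := ⟨by simp [hσ₄, Stmt.exec, Op.exec, hR3.zero],
    by simp [hσ₄, Stmt.exec, Op.exec, hR3.one], by simp [hσ₄, Stmt.exec, Op.exec, hR3.n]⟩
  have ht4 : σ₄.tab = σ₃.tab := rfl
  clear_value σ₄
  constructor
  · rw [(Stmt.frame α.length _ σ₄).var .ans (by decide), hans]
  · intro hg h2
    obtain ⟨b, h3, h4, h5⟩ := (exists_emits (α := α) (wordLabel α) α.length 0 α.length hpos le_rfl
      (by omega)).1 (by rwa [seg_zero_length])
    rw [seg_zero_length] at h3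
    have hsize := BPat.size_concatTree (fun s => wordLabel α s.flatten) b
    have hb : b.len = α.length := by rw [BPat.len, h3]
    rw [hb] at hsize
    have hlen := (b.concatTree fun s => wordLabel α s.flatten).length_code
    refine ⟨b, h3, h4, _, rfl, fun p hp => ⟨by omega, ?_⟩⟩
    have hexec : (Stmt.ite .zero .ans (.ite .one .n Prog.tree .skip) .skip).exec α.length σ₄ =
        Prog.tree.exec α.length σ₄ := by
      simp only [Stmt.exec]
      rw [if_pos (by rw [hR4.zero, hans]; exact ind_pos.2 hg),
        if_pos (by rw [hR4.one, hR4.n]; omega)]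
    rw [hexec]
    refine exec_tree hR4 hpos (fun i j hij hj => ?_) (by rwa [ht4]) h5 hsize p hp
    split_ifs with h
    · rw [(seg_eq_self_iff hij hj).2 h, wordLabel_self]
      rfl
    · rw [wordLabel_seg hij hj fun he => h ((seg_eq_self_iff hij hj).1 he), ht4, hl3 i j hij hj]

theorem mainTheorem2 :
    ∃ (P : Program) (C : ℕ), ∀ α : List Var, α ≠ [] → univVar ∉ α →
      ∃ t : ℕ, t ≤ C * α.length ^ 7 ∧
        Halted P (runFor P α t) ∧
        (∀ s ≤ t, (runFor P α s).FitsIn (wordLength C α)) ∧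
        (IsAcyclicPattern α → (runFor P α t).reg 0 = 1) ∧
        (¬ IsAcyclicPattern α → (runFor P α t).reg 0 = 0) ∧
        (IsAcyclicPattern α → 2 ≤ α.length →
          ∃ (b : BPat) (Ψ : TwoFCCQ) (T : LTree),
            b.flatten = α ∧ IsDecomposition b Ψ ∧ Ψ.IsAcyclic ∧ IsConcatTree Ψ T ∧
            (runFor P α t).HoldsList T.code) := by
  obtain ⟨P, C, h⟩ := Stmt.exists_program Prog.main (by decide)
  refine ⟨P, C, fun α hne hα => ?_⟩
  obtain ⟨t, ht, h1, h2, h3, h4⟩ := h α hne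
  obtain ⟨g1, g2⟩ := exec_main hne
  rw [g1] at h3
  rw [isAcyclicPattern_iff hα]
  refine ⟨t, ht, h1, h2, fun hg => h3.trans (ind_of_true hg), fun hg => h3.trans (ind_of_false hg),
    fun hg hn => ?_⟩
  obtain ⟨b, rfl, hb, T, rfl, hT⟩ := g2 hg hn
  obtain ⟨Ψ, d1, d2, d3⟩ := hb.exists_isConcatTree_wordLabel hα hn
  exact ⟨b, Ψ, _, rfl, d1, d2, d3, fun p hp => (h4 p (hT p hp).1).trans (hT p hp).2⟩
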